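/- There are universal constants $a,b,c>0$ such that the following holds. Let $\varepsilon,\delta\in(0,1)$, $C,M,p_*>0$, and let $\pi=\sum_{i=1}^K p_i\pi_i$ be a mixture of probability distributions on $\mathbb R^N$ with weights $p_i\ge p_*$, $\sum_i p_i=1$, where each $\pi_i$ satisfies the Poincaré inequality $C\cdot\mathrm{Var}_{\pi_i}[f]\le\mathbb E_{\pi_i}\|\nabla f\|^2$ for all smooth compactly supported $f$. Assume that $\pi$ has a density proportional to $e^{-V}$ with $V\in C^1(\mathbb R^N)$, and consider the Langevin diffusion with stationary distribution $\pi$, that is, the Markov process solving $dZ_t=-\nabla V(Z_t)\,dt+\sqrt2\,dB_t$, for which $\pi$ is stationary. Let $\nu_0$ be a random probability distribution on $\mathbb R^N$ with $\mathbb E\,\nu_0(A)=\pi(A)$ for every measurable $A\subseteq\mathbb R^N$, let $$m\ge a\,\frac{\log(1/\delta)}{p_*\varepsilon^2},$$ let $\nu_1,\dots,\nu_m$ be i.i.d. copies of $\nu_0$, and let $\nu=\frac1m\sum_{j=1}^m\nu_j$. Suppose that with probability at least $1-\delta$ one has $\chi^2(\nu_j\,\|\,\pi)\le M$ for all $j=1,\dots,m$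 simultaneously, where $\chi^2(\mu\,\|\,\pi)=\mathbb E_\pi[(\frac{d\mu}{d\pi}-1)^2]$ if $\mu\ll\pi$ and $\chi^2(\mu\,\|\,\pi)=\infty$ otherwise. Then, for every $T\ge0$ with $T\ge\frac{b}{C}\log(M/\varepsilon)$, the distribution $\mu_T$ obtained by running the Langevin diffusion for time $T$ from the initial distribution $\nu$ satisfies $$\Pr\big[\chi^2(\mu_T\,\|\,\pi)\le\varepsilon\big]\ge 1-c\,\delta,$$ where the probability is over the draws of $\nu_1,\dots,\nu_m$. -/

import Mathlib

open MeasureTheory ProbabilityTheory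
open scoped NNReal ENNReal

noncomputable section

/-- `μ` satisfies a Poincaré inequality with constant (at least) `C`:
`C · Var_μ[f] ≤ E_μ ‖∇f‖²`. It is required for smooth compactly supported `f`; by truncation and
mollification it then holds for all `C¹` functions `f` with `f, ‖∇f‖ ∈ L²(μ)`. -/
def PoincareInequality {N : ℕ} (μ : Measure (EuclideanSpace ℝ (Fin N))) (C : ℝ) : Prop :=
  ∀ f : EuclideanSpace ℝ (Fin N) → ℝ, ContDiff ℝ (⊤ : ℕ∞) f → HasCompactSupport f →
    C * variance f μ ≤ ∫ x, ‖gradient f x‖ ^ 2 ∂μ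

open Classical in
/-- The chi-square divergence `χ²(μ ‖ π) = E_π[(dμ/dπ - 1)²]`, infinite unless `μ ≪ π`. -/
def chiSqDiv {X : Type*} [MeasurableSpace X] (μ π : Measure X) : ℝ≥0∞ :=
  if μ ≪ π then ∫⁻ x, ENNReal.ofReal (((μ.rnDeriv π x).toReal - 1) ^ 2) ∂π else ⊤

/-- `B` is a standard Brownian motion in `ℝ^N` relative to the filtration `ℱ`. -/
structure IsStandardBrownian {N : ℕ} {Ω : Type*} {mΩ : MeasurableSpace Ω}
    (ℱ : Filtration ℝ≥0 mΩ) (P : Measure Ω)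
    (B : ℝ≥0 → Ω → EuclideanSpace ℝ (Fin N)) : Prop where
  coord : ∀ i, IsBrownianReal (fun t ω => B t ω i) P
  indep_coord : iIndepFun (fun (i : Fin N) (ω : Ω) (t : ℝ≥0) => B t ω i) P
  adapted : ∀ t, Measurable[ℱ t] (B t)
  indep_increments : ∀ s t, s ≤ t →
    Indep (ℱ s) (MeasurableSpace.comap (fun ω => B t ω - B s ω) inferInstance) P

/-- `(Z, B)` is a (weak) solution of the Langevin equation `dZ_t = -∇V(Z_t) dt + √2 dB_t`. -/
structure IsLangevinSolution {N : ℕ} (V : EuclideanSpace ℝ (Fin N) → ℝ)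
    {Ω : Type*} {mΩ : MeasurableSpace Ω} (ℱ : Filtration ℝ≥0 mΩ) (P : Measure Ω)
    (B Z : ℝ≥0 → Ω → EuclideanSpace ℝ (Fin N)) : Prop where
  brownian : IsStandardBrownian ℱ P B
  adapted : ∀ t, Measurable[ℱ t] (Z t)
  continuous_paths : ∀ ω, Continuous fun t => Z t ω
  equation : ∀ᵐ ω ∂P, ∀ t : ℝ≥0,
    Z t ω = Z 0 ω - (∫ s in (0 : ℝ)..t, gradient V (Z s.toNNReal ω)) + √2 • B t ω

/-- `κ` is the Markov transition semigroup of the Langevin diffusion with potential `V` and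
stationary distribution `π`: for each starting point `x`, the measure `κ t x` is the law at time
`t` of a solution of the Langevin equation started at `x`. -/
structure IsLangevinDiffusion {N : ℕ} (V : EuclideanSpace ℝ (Fin N) → ℝ)
    (π : Measure (EuclideanSpace ℝ (Fin N)))
    (κ : ℝ≥0 → Kernel (EuclideanSpace ℝ (Fin N)) (EuclideanSpace ℝ (Fin N))) : Prop where
  markov : ∀ t, IsMarkovKernel (κ t)
  semigroup : ∀ s t, κ (s + t) = κ t ∘ₖ κ s
  stationary : ∀ t, (κ t).Invariant π
  solution : ∀ x, ∃ (Ω : Type) (mΩ : MeasurableSpace Ω) (ℱ : Filtration ℝ≥0 mΩ)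
    (P : Measure Ω) (B Z : ℝ≥0 → Ω → EuclideanSpace ℝ (Fin N)),
    IsProbabilityMeasure P ∧ IsLangevinSolution V ℱ P B Z ∧
    (∀ᵐ ω ∂P, Z 0 ω = x) ∧ ∀ t, P.map (Z t) = κ t x

/-- The uniform mixture `(1/m) ∑_j ν_j`. -/
def uniformMixture {X : Type*} [MeasurableSpace X] {m : ℕ} (ν : Fin m → Measure X) : Measure X :=
  (m : ℝ≥0∞)⁻¹ • ∑ j, ν j

end

/-! Write P_t for the transition operators on L²(π) and F = dν/dπ − 1. Reversibility makes P_T F + 1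
the density of μ_T, so χ²(μ_T‖π) = ‖P_T F‖², and convexity of χ² gives ‖F‖² ≤ M on the good event.
Let g_i = dπ_i/dπ, which is at most 1/p_i. Summing the Poincaré inequalities of the components with
weights p_i bounds the Dirichlet form of f from below by C(‖f‖² − q(f)), where q(f) = Σ p_i⟨f, g_i⟩²
(`mixture_energy_le`): decay can fail only through an imbalance of mass between components.

The imbalance needs control at the final time alone. For a self-adjoint semigroup, log‖P_t F‖² is
convex in t. Either ‖P_T F‖² ≤ 2q(P_T F), or the energy at time T is at least (C/2)‖P_T F‖². In the
latter case the logarithmic derivative is at most −C at T, hence at all earlier times, and ‖P_T F‖²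
≤ e^{−CT}M ≤ ε (`ContractionSemigroup.norm_sq_apply_le_of_mem`,
`IsLangevinDiffusion.chiSqDiv_comp_le`).

At time T, ⟨P_T F, g_i⟩ = ∫ P_T g_i dν − 1 is an average over j of i.i.d. centred variables. Since
P_T g_i takes values in [0, 1/p_*] and has π-mean 1, these variables are bounded by 1/p_* and their
second moments are too. An exponential bound on Σ p_i(·)², obtained through cosh so that no union
over components is needed, gives q ≤ ε/2 outside an event of probability 2δ
(`measureReal_lt_weighted_deviation_le`). The assumption on χ²(ν_j‖π) costs another δ.

The analytic groundwork is to identify the generator and prove self-adjointness when V is only C¹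
and the kernels are laws of SDE solutions. On test functions the difference quotients converge to Lφ
= Δφ − ∇V·∇φ: pointwise by comparison with one Euler step, in L¹ by stationarity, then in L²
(`tendsto_integral_sub`, `tendsto_integral_abs`, `tendsto_integral_kernel_sub_sq`). A Caccioppoli
estimate shows that 1 − L has dense range on test functions
(`ae_eq_zero_of_integral_sub_langevinGen`). Hence these form a core, L is symmetric on it, and every
P_t is self-adjoint (`ContractionSemigroup.inner_apply`). -/

/-! ### Contraction semigroups on a Hilbert space with a symmetric core -/

section HilbertSemigroup

open Filter Topology Set
open scoped RealInnerProductSpace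

/-- `P` is a contraction semigroup on `H` and `D` is a set of pairs `(u, v)` in the graph of its
generator. -/
structure ContractionSemigroup {H : Type*} [NormedAddCommGroup H] [InnerProductSpace ℝ H]
    (P : ℝ → H →L[ℝ] H) (D : Set (H × H)) : Prop where
  zero : P 0 = ContinuousLinearMap.id ℝ H
  add : ∀ s t, 0 ≤ s → 0 ≤ t → ∀ x, P (s + t) x = P s (P t x)
  contraction : ∀ t, 0 ≤ t → ∀ x, ‖P t x‖ ≤ ‖x‖
  deriv : ∀ z ∈ D, Tendsto (fun h : ℝ => h⁻¹ • (P h z.1 - z.1)) (𝓝[>] 0) (𝓝 z.2)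
  dense_domain : Dense (Prod.fst '' D)
  dense_range : Dense ((fun z : H × H => z.1 - z.2) '' D)
  symm : ∀ z ∈ D, ∀ w ∈ D, ⟪z.2, w.1⟫ = ⟪z.1, w.2⟫

namespace ContractionSemigroup

variable {H : Type*} [NormedAddCommGroup H] [InnerProductSpace ℝ H]
  {P : ℝ → H →L[ℝ] H} {D : Set (H × H)}

/-! ### Strong continuity and differentiability of orbits. -/

lemma tendsto_zero_of_mem (hP : ContractionSemigroup P D) {z : H × H} (hz : z ∈ D) :
    Tendsto (fun h => P h z.1) (𝓝[>] 0) (𝓝 z.1) := by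
  have h1 : Tendsto (fun h : ℝ => h) (𝓝[>] 0) (𝓝 0) := tendsto_nhdsWithin_of_tendsto_nhds tendsto_id
  have h2 := (h1.smul (hP.deriv z hz)).add_const z.1
  rw [zero_smul, zero_add] at h2
  refine h2.congr' ?_
  filter_upwards [self_mem_nhdsWithin] with h hh
  rw [smul_inv_smul₀ (ne_of_gt hh)]
  abel

lemma tendsto_zero (hP : ContractionSemigroup P D) (x : H) :
    Tendsto (fun h => P h x) (𝓝[>] 0) (𝓝 x) := by
  rw [Metric.tendsto_nhds]
  intro ε hε
  obtain ⟨_, hzx, ⟨z, hz, rfl⟩⟩ := Metric.dense_iff.1 hP.dense_domain x (ε / 3) (by positivity)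
  have := Metric.tendsto_nhds.1 (hP.tendsto_zero_of_mem hz) (ε / 3) (by positivity)
  filter_upwards [this, self_mem_nhdsWithin] with h h1 h2
  rw [Metric.mem_ball] at hzx
  have h3 : dist (P h x) (P h z.1) ≤ dist z.1 x := by
    rw [dist_eq_norm, ← map_sub, dist_comm, dist_eq_norm]
    exact hP.contraction h (le_of_lt h2) _
  calc dist (P h x) x ≤ dist (P h x) (P h z.1) + dist (P h z.1) z.1 + dist z.1 x :=
        dist_triangle4 _ _ _ _
    _ < ε := by linarith

lemma norm_sub_le (hP : ContractionSemigroup P D) (x : H) {s t : ℝ} (hs : 0 ≤ s) (ht : 0 ≤ t) :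
    ‖P s x - P t x‖ ≤ ‖P |s - t| x - x‖ := by
  rcases le_total s t with h | h
  · have : P t x = P s (P (t - s) x) := by
      rw [← hP.add s (t - s) hs (by linarith)]; congr 2; ring
    rw [this, ← map_sub, abs_of_nonpos (by linarith), norm_sub_rev (P _ x), neg_sub]
    exact hP.contraction s hs _
  · have : P s x = P t (P (s - t) x) := by
      rw [← hP.add t (s - t) ht (by linarith)]; congr 2; ring
    rw [this, ← map_sub, abs_of_nonneg (by linarith)]
    exact hP.contraction t ht _

lemma tendsto_abs (hP : ContractionSemigroup P D) (x : H) (t : ℝ) :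
    Tendsto (fun s => ‖P |s - t| x - x‖) (𝓝 t) (𝓝 0) := by
  have h0 : Tendsto (fun h => P h x) (𝓝[≥] 0) (𝓝 x) := by
    rw [← Ioi_union_left, nhdsWithin_union]
    refine (hP.tendsto_zero x).sup ?_
    rw [nhdsWithin_singleton, tendsto_pure_left]
    intro s hs
    rw [hP.zero]
    exact mem_of_mem_nhds hs
  have h1 : Tendsto (fun s : ℝ => |s - t|) (𝓝 t) (𝓝[≥] 0) := by
    refine tendsto_nhdsWithin_iff.2 ⟨?_, Eventually.of_forall fun s => mem_Ici.2 (abs_nonneg _)⟩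
    have : Continuous fun s : ℝ => |s - t| := by fun_prop
    simpa using this.tendsto t
  have := ((h0.comp h1).sub_const x).norm
  simpa using this

lemma continuousOn (hP : ContractionSemigroup P D) (x : H) :
    ContinuousOn (fun t => P t x) (Ici 0) := by
  intro t ht
  rw [ContinuousWithinAt, tendsto_iff_norm_sub_tendsto_zero]
  refine squeeze_zero' (Eventually.of_forall fun _ => norm_nonneg _) ?_
    ((hP.tendsto_abs x t).mono_left nhdsWithin_le_nhds)
  filter_upwards [self_mem_nhdsWithin] with s hs using hP.norm_sub_le x hs ht

/-- The generator is given by a one-sided limit at time 0. To the right of t, factor out the fixed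
contraction P_t. To the left, the factor is P_s with s varying, which costs the extra term
‖P_{|s−t|} z.2 − z.2‖; strong continuity makes it vanish. -/
lemma hasDerivAt (hP : ContractionSemigroup P D) {z : H × H} (hz : z ∈ D) {t : ℝ} (ht : 0 < t) :
    HasDerivAt (fun s => P s z.1) (P t z.2) t := by
  rw [hasDerivAt_iff_tendsto_slope, ← Iio_union_Ioi, nhdsWithin_union]
  have hk : ∀ t : ℝ, Tendsto (fun s : ℝ => |s - t|) (𝓝[≠] t) (𝓝[>] 0) := by
    intro t
    refine tendsto_nhdsWithin_iff.2 ⟨?_, ?_⟩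
    · have : Continuous fun s : ℝ => |s - t| := by fun_prop
      simpa using (this.tendsto t).mono_left nhdsWithin_le_nhds
    · filter_upwards [self_mem_nhdsWithin] with s hs using abs_pos.2 (sub_ne_zero.2 hs)
  have hlim : Tendsto (fun s : ℝ => ‖|s - t|⁻¹ • (P |s - t| z.1 - z.1) - z.2‖ + ‖P |s - t| z.2 - z.2‖)
      (𝓝[≠] t) (𝓝 0) := by
    have h1 := ((hP.deriv z hz).comp (hk t)).sub_const z.2 |>.norm
    have h2 := (hP.tendsto_abs z.2 t).mono_left (nhdsWithin_le_nhds (s := {t}ᶜ))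
    simpa using h1.add h2
  refine Tendsto.sup ?_ ?_
  · rw [tendsto_iff_norm_sub_tendsto_zero]
    refine squeeze_zero' (Eventually.of_forall fun _ => norm_nonneg _) ?_
      (hlim.mono_left (nhdsWithin_mono _ fun s hs => ne_of_lt hs))
    have : ∀ᶠ s in 𝓝[<] t, 0 < s := nhdsWithin_le_nhds (lt_mem_nhds ht)
    filter_upwards [this, self_mem_nhdsWithin] with s hs hst
    have hst' : s < t := hst
    have hslope : slope (fun s => P s z.1) t s = P s (|s - t|⁻¹ • (P |s - t| z.1 - z.1)) := by
      rw [map_smul, map_sub, ← hP.add s _ hs.le (abs_nonneg _), slope_def_module,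
        abs_of_neg (by linarith), show s + -(s - t) = t by ring, ← neg_sub (P t z.1), smul_neg,
        ← neg_smul]
      congr 1
      rw [inv_neg]
    rw [hslope]
    calc ‖P s (|s - t|⁻¹ • (P |s - t| z.1 - z.1)) - P t z.2‖
        ≤ ‖P s (|s - t|⁻¹ • (P |s - t| z.1 - z.1)) - P s z.2‖ + ‖P s z.2 - P t z.2‖ :=
          norm_sub_le_norm_sub_add_norm_sub _ _ _
      _ ≤ _ := by
          gcongr
          · rw [← map_sub]; exact hP.contraction s hs.le _
          · exact hP.norm_sub_le _ hs.le ht.le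
  · rw [tendsto_iff_norm_sub_tendsto_zero]
    refine squeeze_zero' (Eventually.of_forall fun _ => norm_nonneg _) ?_
      (hlim.mono_left (nhdsWithin_mono _ fun s hs => ne_of_gt hs))
    filter_upwards [self_mem_nhdsWithin] with s hst
    have hst' : t < s := hst
    have hslope : slope (fun s => P s z.1) t s = P t (|s - t|⁻¹ • (P |s - t| z.1 - z.1)) := by
      rw [map_smul, map_sub, ← hP.add t _ ht.le (abs_nonneg _), slope_def_module,
        abs_of_pos (by linarith), show t + (s - t) = s by ring]
    rw [hslope, ← map_sub]
    exact (hP.contraction t ht.le _).trans (le_add_of_nonneg_right (norm_nonneg _))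

/-! ### Dissipativity, invariance of the core and self-adjointness. -/

lemma inner_apply_sub_nonpos (hP : ContractionSemigroup P D) (x : H) {h : ℝ} (hh : 0 ≤ h) :
    ⟪P h x - x, x⟫ ≤ 0 := by
  rw [inner_sub_left, real_inner_self_eq_norm_sq]
  have := real_inner_le_norm (P h x) x
  nlinarith [hP.contraction h hh x, norm_nonneg x]

/-- Dissipativity: contraction forces ⟨y, x⟩ ≤ 0, so ‖x‖² ≤ ⟨x − y, x⟩. The bound holds wherever the
derivative at 0 exists, so it applies to the difference of a core vector and an evolved one. -/
lemma norm_le_of_deriv (hP : ContractionSemigroup P D) {x y : H}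
    (hxy : Tendsto (fun h : ℝ => h⁻¹ • (P h x - x)) (𝓝[>] 0) (𝓝 y)) : ‖x‖ ≤ ‖x - y‖ := by
  have h1 : ⟪y, x⟫ ≤ 0 := by
    refine le_of_tendsto (hxy.inner (tendsto_const_nhds (x := x))) ?_
    filter_upwards [self_mem_nhdsWithin] with h hh
    rw [real_inner_smul_left]
    exact mul_nonpos_of_nonneg_of_nonpos (inv_nonneg.2 (le_of_lt hh))
      (hP.inner_apply_sub_nonpos x (le_of_lt hh))
  have h2 : ‖x‖ ^ 2 ≤ ‖x - y‖ * ‖x‖ := by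
    refine le_trans ?_ (real_inner_le_norm (x - y) x)
    rw [inner_sub_left, real_inner_self_eq_norm_sq]
    linarith
  by_contra hlt
  push Not at hlt
  nlinarith [norm_nonneg (x - y), norm_nonneg x]

lemma deriv_apply (hP : ContractionSemigroup P D) {z : H × H} (hz : z ∈ D) {t : ℝ} (ht : 0 ≤ t) :
    Tendsto (fun h : ℝ => h⁻¹ • (P h (P t z.1) - P t z.1)) (𝓝[>] 0) (𝓝 (P t z.2)) := by
  refine (((P t).continuous.tendsto _).comp (hP.deriv z hz)).congr' ?_
  filter_upwards [self_mem_nhdsWithin] with h hh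
  simp only [Function.comp_apply]
  rw [map_smul, map_sub, ← hP.add t h ht (le_of_lt hh), ← hP.add h t (le_of_lt hh) ht, add_comm]

/-- The closure of the core is invariant under the semigroup. -/
lemma apply_mem_closure (hP : ContractionSemigroup P D) {z : H × H} (hz : z ∈ D) {t : ℝ}
    (ht : 0 ≤ t) : (P t z.1, P t z.2) ∈ closure D := by
  rw [Metric.mem_closure_iff]
  intro ε hε
  -- Approximate (1 − A)P_t z by (1 − A)w with w in the core. As 1 − A is bounded below, this forces
  -- w.1 to be close to P_t z.1, and then w.2 to be close to P_t z.2.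
  obtain ⟨_, hwz, ⟨w, hw, rfl⟩⟩ := Metric.dense_iff.1 hP.dense_range (P t z.1 - P t z.2) (ε / 2)
    (by positivity)
  rw [Metric.mem_ball, dist_eq_norm] at hwz
  refine ⟨w, hw, ?_⟩
  have h1 : ‖w.1 - P t z.1‖ ≤ ‖(w.1 - P t z.1) - (w.2 - P t z.2)‖ := by
    refine hP.norm_le_of_deriv (((hP.deriv w hw).sub (hP.deriv_apply hz ht)).congr fun h => ?_)
    rw [map_sub, ← smul_sub]
    congr 1
    abel
  have h2 : (w.1 - P t z.1) - (w.2 - P t z.2) = w.1 - w.2 - (P t z.1 - P t z.2) := by abel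
  rw [h2] at h1
  have h3 : w.2 - P t z.2 = (w.1 - P t z.1) - (w.1 - w.2 - (P t z.1 - P t z.2)) := by abel
  have h4 : ‖w.2 - P t z.2‖ < ε := by
    rw [h3]
    exact (_root_.norm_sub_le _ _).trans_lt (by linarith)
  rw [Prod.dist_eq, max_lt_iff]
  constructor
  · rw [dist_comm, dist_eq_norm]; linarith
  · rw [dist_comm, dist_eq_norm]; exact h4

lemma symm_closure (hP : ContractionSemigroup P D) {z w : H × H} (hz : z ∈ closure D)
    (hw : w ∈ closure D) : ⟪z.2, w.1⟫ = ⟪z.1, w.2⟫ := by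
  have h1 : ∀ w ∈ D, ∀ z ∈ closure D, ⟪z.2, w.1⟫ = ⟪z.1, w.2⟫ := by
    intro w hw
    refine closure_minimal (t := {z : H × H | ⟪z.2, w.1⟫ = ⟪z.1, w.2⟫})
      (fun z hz => hP.symm z hz w hw) (isClosed_eq (by fun_prop) (by fun_prop))
  exact closure_minimal (t := {w : H × H | ⟪z.2, w.1⟫ = ⟪z.1, w.2⟫})
      (fun w hw => h1 w hw z hz) (isClosed_eq (by fun_prop) (by fun_prop)) hw

/-- The function s ↦ ⟨P_s z, P_{t−s} w⟩ interpolates between the two sides. Its derivative ⟨A P_s z,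
P_{t−s} w⟩ − ⟨P_s z, A P_{t−s} w⟩ vanishes, since both orbits stay in the closure of the symmetric
core. -/
lemma inner_apply_of_mem (hP : ContractionSemigroup P D) {z w : H × H} (hz : z ∈ D) (hw : w ∈ D)
    {t : ℝ} (ht : 0 ≤ t) : ⟪P t z.1, w.1⟫ = ⟪z.1, P t w.1⟫ := by
  have hcont : ContinuousOn (fun s => ⟪P s z.1, P (t - s) w.1⟫) (Icc 0 t) := by
    refine ContinuousOn.inner ((hP.continuousOn z.1).mono Icc_subset_Ici_self) ?_
    refine (hP.continuousOn w.1).comp (by fun_prop) fun s hs => ?_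
    simpa using hs.2
  have hder : ∀ s ∈ Ioo 0 t, HasDerivAt (fun s => ⟪P s z.1, P (t - s) w.1⟫) 0 s := by
    intro s hs
    have h1 := hP.hasDerivAt hz hs.1
    have h2 : HasDerivAt (fun s => P (t - s) w.1) (-(P (t - s) w.2)) s :=
      HasDerivAt.comp_const_sub t s (hP.hasDerivAt hw (sub_pos.2 hs.2))
    have h3 := h1.inner ℝ h2
    have := hP.symm_closure (hP.apply_mem_closure hz hs.1.le)
      (hP.apply_mem_closure hw (sub_nonneg.2 hs.2.le))
    simp only at this
    rwa [inner_neg_right, this, neg_add_cancel] at h3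
  have hconst : (fun s => ⟪P s z.1, P (t - s) w.1⟫) t = (fun s => ⟪P s z.1, P (t - s) w.1⟫) 0 := by
    rcases ht.eq_or_lt with rfl | ht
    · rfl
    obtain ⟨c, hc, hc'⟩ := exists_hasDerivAt_eq_slope (fun s => ⟪P s z.1, P (t - s) w.1⟫)
      (fun _ => 0) ht hcont hder
    rw [eq_comm, div_eq_zero_iff] at hc'
    rcases hc' with h | h
    · linarith
    · linarith
  simpa [hP.zero] using hconst

lemma inner_apply (hP : ContractionSemigroup P D) {t : ℝ} (ht : 0 ≤ t) (x y : H) :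
    ⟪P t x, y⟫ = ⟪x, P t y⟫ := by
  have h1 : ∀ w ∈ D, ∀ x, ⟪P t x, w.1⟫ = ⟪x, P t w.1⟫ := by
    intro w hw x
    refine isClosed_property (e := Subtype.val) (p := fun x => ⟪P t x, w.1⟫ = ⟪x, P t w.1⟫)
      hP.dense_domain.denseRange_val (isClosed_eq (by fun_prop) (by fun_prop)) ?_ x
    rintro ⟨_, z, hz, rfl⟩
    exact hP.inner_apply_of_mem hz hw ht
  refine isClosed_property (e := Subtype.val) (p := fun y => ⟪P t x, y⟫ = ⟪x, P t y⟫)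
    hP.dense_domain.denseRange_val (isClosed_eq (by fun_prop) (by fun_prop)) ?_ y
  rintro ⟨_, w, hw, rfl⟩
  exact h1 w hw x

/-- Log-convexity argument. With φ = ‖P_t z‖² and n = ⟨P_t z, A P_t z⟩, the quotient n/φ is
nondecreasing. If q(P_T z) is less than half of φ(T), the energy estimate gives n/φ ≤ −C/2 at T and
so on all of [0, T]; integrating φ' = 2n ≤ −Cφ gives the exponential bound. The estimate on q is
thus needed at time T only. -/
lemma norm_sq_apply_le_of_mem (hP : ContractionSemigroup P D) {C T : ℝ} {q : H → ℝ} (hT : 0 ≤ T)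
    (hC : 0 ≤ C) (hq : Continuous q)
    (henergy : ∀ z ∈ D, C * (‖z.1‖ ^ 2 - q z.1) ≤ -⟪z.2, z.1⟫) {z : H × H} (hz : z ∈ D) :
    ‖P T z.1‖ ^ 2 ≤ max (2 * q (P T z.1)) (Real.exp (-(C * T)) * ‖z.1‖ ^ 2) := by
  by_contra! hlt
  obtain ⟨hlt1, hlt2⟩ := max_lt_iff.1 hlt
  have hpos : 0 < ‖P T z.1‖ := by
    rcases (norm_nonneg (P T z.1)).eq_or_lt with h | h
    · rw [← h] at hlt2
      have : 0 ≤ Real.exp (-(C * T)) * ‖z.1‖ ^ 2 := by positivity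
      norm_num at hlt2
      linarith
    · exact h
  have hTpos : 0 < T := by
    rcases hT.eq_or_lt with rfl | h
    · simp [hP.zero] at hlt2
    · exact h
  -- An orbit that is nonzero at T was nonzero before, so quotients and logarithms below are
  -- legitimate.
  have hpost : ∀ t ∈ Icc 0 T, 0 < ‖P t z.1‖ := by
    intro t ht
    refine hpos.trans_le ?_
    have : P T z.1 = P (T - t) (P t z.1) := by
      rw [← hP.add _ _ (sub_nonneg.2 ht.2) ht.1]; congr 2; ring
    rw [this]
    exact hP.contraction _ (sub_nonneg.2 ht.2) _
  set φ : ℝ → ℝ := fun t => ‖P t z.1‖ ^ 2 with hφ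
  set n : ℝ → ℝ := fun t => ⟪P t z.1, P t z.2⟫ with hn
  have hφpos : ∀ t ∈ Icc 0 T, 0 < φ t := fun t ht => pow_pos (hpost t ht) 2
  have hφcont : ContinuousOn φ (Icc 0 T) :=
    (((hP.continuousOn z.1).mono Icc_subset_Ici_self).norm).pow 2
  have hncont : ContinuousOn n (Icc 0 T) :=
    ((hP.continuousOn z.1).mono Icc_subset_Ici_self).inner
      ((hP.continuousOn z.2).mono Icc_subset_Ici_self)
  have hφd : ∀ t ∈ Ioo 0 T, HasDerivAt φ (2 * n t) t := fun t ht =>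
    (hP.hasDerivAt hz ht.1).norm_sq
  have hnd : ∀ t ∈ Ioo 0 T, HasDerivAt n (2 * ‖P t z.2‖ ^ 2) t := by
    intro t ht
    -- By self-adjointness n(t) = ⟨P_{2t} z.1, z.2⟩. This form needs only the derivative of the
    -- orbit of z.1; z.2 need not be in the domain of the generator.
    have h1 : HasDerivAt (fun t => ⟪P (2 * t) z.1, z.2⟫) (2 * ⟪P (2 * t) z.2, z.2⟫) t := by
      have h2 : HasDerivAt (fun t : ℝ => 2 * t) 2 t := by
        simpa using (hasDerivAt_id t).const_mul (2 : ℝ)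
      have h3 := (HasDerivAt.scomp t (hP.hasDerivAt hz (t := 2 * t) (by linarith [ht.1])) h2)
      have h4 := h3.inner ℝ (hasDerivAt_const t z.2)
      simp only [Function.comp_def, inner_zero_right, zero_add] at h4
      rwa [real_inner_smul_left] at h4
    have h5 : ∀ s, 0 ≤ s → ∀ x y, ⟪P (2 * s) x, y⟫ = ⟪P s x, P s y⟫ := by
      intro s hs x y
      rw [two_mul, hP.add s s hs hs, hP.inner_apply hs]
    rw [h5 t ht.1.le, real_inner_self_eq_norm_sq] at h1
    refine h1.congr_of_eventuallyEq ?_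
    filter_upwards [lt_mem_nhds ht.1] with s hs
    exact (h5 s hs.le _ _).symm
  set r : ℝ → ℝ := fun t => n t / φ t with hr
  have hmono : MonotoneOn r (Icc 0 T) := by
    refine monotoneOn_of_deriv_nonneg (convex_Icc 0 T)
      (hncont.div hφcont fun t ht => (hφpos t ht).ne') ?_ ?_
    · rw [interior_Icc]
      intro t ht
      exact ((hnd t ht).div (hφd t ht)
        (hφpos t (Ioo_subset_Icc_self ht)).ne').differentiableAt.differentiableWithinAt
    · rw [interior_Icc]
      intro t ht
      have hrd : HasDerivAt r _ t :=
        (hnd t ht).div (hφd t ht) (hφpos t (Ioo_subset_Icc_self ht)).ne'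
      rw [hrd.deriv]
      refine div_nonneg ?_ (sq_nonneg _)
      -- Cauchy–Schwarz is exactly the nonnegativity of the numerator of (n/φ)'.
      have hcs : n t ^ 2 ≤ ‖P t z.1‖ ^ 2 * ‖P t z.2‖ ^ 2 := by
        rw [← mul_pow, ← sq_abs]
        exact pow_le_pow_left₀ (abs_nonneg _) (abs_real_inner_le_norm _ _) 2
      simp only [hφ]
      nlinarith
  have hrT : r T ≤ -(C / 2) := by
    have h1 : C * (‖P T z.1‖ ^ 2 - q (P T z.1)) ≤ -⟪P T z.2, P T z.1⟫ :=
      closure_minimal (t := {z : H × H | C * (‖z.1‖ ^ 2 - q z.1) ≤ -⟪z.2, z.1⟫}) henergy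
        (isClosed_le (by fun_prop) (by fun_prop)) (hP.apply_mem_closure hz hT)
    rw [real_inner_comm] at h1
    simp only [hr]
    rw [div_le_iff₀ (hφpos T ⟨hT, le_rfl⟩)]
    simp only [hφ, hn]
    nlinarith
  have hanti : AntitoneOn (fun t => Real.log (φ t) + C * t) (Icc 0 T) := by
    have hd : ∀ t ∈ Ioo 0 T,
        HasDerivAt (fun t => Real.log (φ t) + C * t) (2 * n t / φ t + C) t := by
      intro t ht
      have h1 := (hφd t ht).log (hφpos t (Ioo_subset_Icc_self ht)).ne'
      have h2 : HasDerivAt (fun t : ℝ => C * t) C t := by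
        simpa using (hasDerivAt_id t).const_mul C
      exact h1.add h2
    refine antitoneOn_of_deriv_nonpos (convex_Icc 0 T) ?_ ?_ ?_
    · exact (hφcont.log fun t ht => (hφpos t ht).ne').add (by fun_prop)
    · rw [interior_Icc]
      exact fun t ht => (hd t ht).differentiableAt.differentiableWithinAt
    · rw [interior_Icc]
      intro t ht
      rw [(hd t ht).deriv]
      have h1 := hmono (Ioo_subset_Icc_self ht) ⟨hT, le_rfl⟩ ht.2.le
      have h2 : 2 * n t / φ t = 2 * r t := by simp only [hr]; ring
      rw [h2]; linarith
  have h0 := hanti ⟨le_rfl, hT⟩ ⟨hT, le_rfl⟩ hT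
  simp only [mul_zero, add_zero] at h0
  have h1 : φ T ≤ Real.exp (-(C * T)) * φ 0 := by
    rw [← Real.log_le_log_iff (hφpos T ⟨hT, le_rfl⟩)
      (mul_pos (Real.exp_pos _) (hφpos 0 ⟨le_rfl, hT⟩)), Real.log_mul (Real.exp_pos _).ne'
      (hφpos 0 ⟨le_rfl, hT⟩).ne', Real.log_exp]
    linarith
  simp only [hφ, hP.zero, ContinuousLinearMap.id_apply] at h1
  linarith

lemma norm_sq_apply_le (hP : ContractionSemigroup P D) {C T : ℝ} {q : H → ℝ} (hT : 0 ≤ T)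
    (hC : 0 ≤ C) (hq : Continuous q)
    (henergy : ∀ z ∈ D, C * (‖z.1‖ ^ 2 - q z.1) ≤ -⟪z.2, z.1⟫) (x : H) :
    ‖P T x‖ ^ 2 ≤ max (2 * q (P T x)) (Real.exp (-(C * T)) * ‖x‖ ^ 2) := by
  refine isClosed_property (e := Subtype.val)
    (p := fun x => ‖P T x‖ ^ 2 ≤ max (2 * q (P T x)) (Real.exp (-(C * T)) * ‖x‖ ^ 2))
    hP.dense_domain.denseRange_val (isClosed_le (by fun_prop) (by fun_prop)) ?_ x
  rintro ⟨_, z, hz, rfl⟩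
  exact hP.norm_sq_apply_le_of_mem hT hC hq henergy hz

end ContractionSemigroup

end HilbertSemigroup

/-! ### The Markov operator of an invariant kernel on `L²` -/

section MarkovOperator

open Filter Topology
open scoped RealInnerProductSpace

variable {X : Type*} [MeasurableSpace X] {π : Measure X} {κ : Kernel X X}

/-- This is what makes the Markov operator well defined on almost-everywhere classes: changing f on
a π-null set changes its κ x-integral only for a π-null set of x. -/
lemma ProbabilityTheory.Kernel.Invariant.ae_ae (hκ : κ.Invariant π) {p : X → Prop}
    (h : ∀ᵐ x ∂π, p x) : ∀ᵐ x ∂π, ∀ᵐ y ∂κ x, p y := by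
  refine Measure.ae_ae_of_ae_comp (μ := π) (κ := κ) ?_
  rwa [hκ.def]

lemma ProbabilityTheory.Kernel.Invariant.lintegral_lintegral (hκ : κ.Invariant π) {f : X → ℝ≥0∞}
    (hf : AEMeasurable f π) : ∫⁻ x, ∫⁻ y, f y ∂κ x ∂π = ∫⁻ x, f x ∂π := by
  have h := Measure.lintegral_bind (m := π) (μ := κ) (f := f) κ.aemeasurable (by rwa [hκ.def])
  rw [hκ.def] at h
  exact h.symm

lemma ProbabilityTheory.Kernel.Invariant.integrable_kernel (hκ : κ.Invariant π) {f : X → ℝ}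
    (hf : Integrable f π) : ∀ᵐ x ∂π, Integrable f (κ x) := by
  have h : Integrable f (κ ∘ₘ π) := by rwa [hκ.def]
  exact ((Measure.integrable_comp_iff h.1).1 h).1

lemma ProbabilityTheory.Kernel.Invariant.aestronglyMeasurable_integral (hκ : κ.Invariant π)
    {f : X → ℝ} (hf : AEStronglyMeasurable f π) :
    AEStronglyMeasurable (fun x => ∫ y, f y ∂κ x) π :=
  ⟨fun x => ∫ y, hf.mk f y ∂κ x, hf.stronglyMeasurable_mk.integral_kernel, by
    filter_upwards [hκ.ae_ae hf.ae_eq_mk] with _ hx using integral_congr_ae hx⟩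

lemma enorm_integral_sq_le [IsMarkovKernel κ] {f : X → ℝ} {x : X}
    (hf : AEStronglyMeasurable f (κ x)) :
    ‖∫ y, f y ∂κ x‖ₑ ^ 2 ≤ ∫⁻ y, ‖f y‖ₑ ^ 2 ∂κ x := by
  have h1 : ‖∫ y, f y ∂κ x‖ₑ ≤ eLpNorm f 2 (κ x) := by
    refine (enorm_integral_le_lintegral_enorm f).trans ?_
    rw [← eLpNorm_one_eq_lintegral_enorm]
    exact eLpNorm_le_eLpNorm_of_exponent_le (by norm_num) hf
  calc ‖∫ y, f y ∂κ x‖ₑ ^ 2 ≤ eLpNorm f 2 (κ x) ^ 2 := by gcongr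
    _ = ∫⁻ y, ‖f y‖ₑ ^ 2 ∂κ x := by
      have := eLpNorm_nnreal_pow_eq_lintegral (f := f) (μ := κ x) (p := 2) (by norm_num)
      simpa using this

lemma ProbabilityTheory.Kernel.Invariant.eLpNorm_integral_le [IsMarkovKernel κ]
    (hκ : κ.Invariant π) {f : X → ℝ} (hf : AEStronglyMeasurable f π) :
    eLpNorm (fun x => ∫ y, f y ∂κ x) 2 π ≤ eLpNorm f 2 π := by
  have h2 : ∀ g : X → ℝ, eLpNorm g 2 π ^ 2 = ∫⁻ y, ‖g y‖ₑ ^ 2 ∂π := fun g => by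
    have := eLpNorm_nnreal_pow_eq_lintegral (f := g) (μ := π) (p := 2) (by norm_num)
    simpa using this
  rw [← ENNReal.pow_le_pow_left_iff two_ne_zero, h2, h2, ← hκ.lintegral_lintegral
    (hf.enorm.pow_const 2)]
  refine lintegral_mono_ae ?_
  filter_upwards [hκ.ae_ae hf.ae_eq_mk] with x hx
  exact enorm_integral_sq_le ⟨_, hf.stronglyMeasurable_mk, hx⟩

lemma ProbabilityTheory.Kernel.Invariant.memLp_integral [IsMarkovKernel κ]
    (hκ : κ.Invariant π) {f : X → ℝ} (hf : MemLp f 2 π) :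
    MemLp (fun x => ∫ y, f y ∂κ x) 2 π :=
  ⟨hκ.aestronglyMeasurable_integral hf.1, (hκ.eLpNorm_integral_le hf.1).trans_lt hf.2⟩

/-- The operator `f ↦ (x ↦ ∫ f dκ(x))` on `L²(π)`, for a Markov kernel `κ` that leaves `π`
invariant. -/
noncomputable def markovOp [IsProbabilityMeasure π] [IsMarkovKernel κ] (hκ : κ.Invariant π) :
    Lp ℝ 2 π →L[ℝ] Lp ℝ 2 π :=
  LinearMap.mkContinuous
    { toFun := fun f => (hκ.memLp_integral (Lp.memLp f)).toLp
      map_add' := fun f g => by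
        rw [← MemLp.toLp_add]
        refine MemLp.toLp_congr _ _ ?_
        filter_upwards [hκ.ae_ae (Lp.coeFn_add f g),
          hκ.integrable_kernel ((Lp.memLp f).integrable (by norm_num)),
          hκ.integrable_kernel ((Lp.memLp g).integrable (by norm_num))] with x hx hf hg
        rw [integral_congr_ae hx]
        exact integral_add hf hg
      map_smul' := fun c f => by
        simp only [RingHom.id_apply]
        rw [← MemLp.toLp_const_smul]
        refine MemLp.toLp_congr _ _ ?_
        filter_upwards [hκ.ae_ae (Lp.coeFn_smul c f)] with x hx
        rw [integral_congr_ae hx]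
        exact integral_const_mul c _ } 1 fun f => by
    simp only [LinearMap.coe_mk, AddHom.coe_mk, one_mul]
    rw [Lp.norm_toLp, Lp.norm_def]
    exact ENNReal.toReal_mono (Lp.eLpNorm_ne_top f)
      (hκ.eLpNorm_integral_le (Lp.aestronglyMeasurable f))

variable [IsProbabilityMeasure π] [IsMarkovKernel κ]

lemma coeFn_markovOp (hκ : κ.Invariant π) (f : Lp ℝ 2 π) :
    markovOp hκ f =ᵐ[π] fun x => ∫ y, f y ∂κ x :=
  MemLp.coeFn_toLp (hκ.memLp_integral (Lp.memLp f))

lemma norm_markovOp_apply_le (hκ : κ.Invariant π) (f : Lp ℝ 2 π) : ‖markovOp hκ f‖ ≤ ‖f‖ := by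
  rw [markovOp]
  refine (ContinuousLinearMap.le_of_opNorm_le _
    (LinearMap.mkContinuous_norm_le _ zero_le_one _) f).trans (by rw [one_mul])

lemma markovOp_comp {η ζ : Kernel X X} [IsMarkovKernel η] [IsMarkovKernel ζ]
    (hκ : κ.Invariant π) (hη : η.Invariant π) (hζ : ζ.Invariant π) (h : ζ = κ ∘ₖ η)
    (f : Lp ℝ 2 π) : markovOp hζ f = markovOp hη (markovOp hκ f) := by
  refine Lp.ext ?_
  filter_upwards [coeFn_markovOp hζ f, coeFn_markovOp hη (markovOp hκ f),
    hη.ae_ae (coeFn_markovOp hκ f),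
    hζ.integrable_kernel ((Lp.memLp f).integrable (by norm_num))] with x h1 h2 h3 h4
  rw [h1, h2, integral_congr_ae h3, h, Kernel.integral_comp]
  rwa [h] at h4

lemma markovOp_id (hκ : κ.Invariant π) (h : κ = Kernel.id) :
    markovOp hκ = ContinuousLinearMap.id ℝ (Lp ℝ 2 π) := by
  ext1 f
  refine Lp.ext ?_
  obtain ⟨g, hg, hfg⟩ := Lp.aestronglyMeasurable f
  filter_upwards [coeFn_markovOp hκ f, hκ.ae_ae hfg, hfg] with x h1 h2 h3
  rw [h1, integral_congr_ae h2, h, Kernel.id_apply, integral_dirac' _ _ hg, ← h3]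
  rfl

end MarkovOperator

/-! ### Partial derivatives and the Langevin generator -/

section Generator

open Filter Topology Set
open scoped RealInnerProductSpace ContDiff

variable {N : ℕ}

/-- The `i`-th partial derivative. -/
noncomputable def pderiv (i : Fin N) (f : EuclideanSpace ℝ (Fin N) → ℝ)
    (x : EuclideanSpace ℝ (Fin N)) : ℝ :=
  fderiv ℝ f x (EuclideanSpace.single i 1)

/-- The Langevin generator `Δ - ∇V · ∇`. -/
noncomputable def langevinGen (V φ : EuclideanSpace ℝ (Fin N) → ℝ)
    (x : EuclideanSpace ℝ (Fin N)) : ℝ :=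
  ∑ i, (pderiv i (pderiv i φ) x - pderiv i V x * pderiv i φ x)

variable {f g φ V : EuclideanSpace ℝ (Fin N) → ℝ} {i : Fin N}

lemma contDiff_pderiv (hf : ContDiff ℝ ∞ f) (i : Fin N) : ContDiff ℝ ∞ (pderiv i f) :=
  (hf.fderiv_right (m := ∞) (by norm_num)).clm_apply contDiff_const

lemma continuous_pderiv (hf : ContDiff ℝ 1 f) (i : Fin N) : Continuous (pderiv i f) :=
  (hf.continuous_fderiv one_ne_zero).clm_apply continuous_const

lemma tsupport_pderiv_subset (i : Fin N) (f : EuclideanSpace ℝ (Fin N) → ℝ) :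
    tsupport (pderiv i f) ⊆ tsupport f :=
  tsupport_fderiv_apply_subset ℝ _

lemma HasCompactSupport.pderiv (hf : HasCompactSupport f) (i : Fin N) :
    HasCompactSupport (pderiv i f) :=
  hf.fderiv_apply ℝ _

lemma pderiv_mul {x : EuclideanSpace ℝ (Fin N)} (hf : DifferentiableAt ℝ f x)
    (hg : DifferentiableAt ℝ g x) :
    pderiv i (fun y => f y * g y) x = f x * pderiv i g x + pderiv i f x * g x := by
  simp [pderiv, fderiv_fun_mul hf hg, mul_comm]

lemma integral_mul_pderiv (hf : ContDiff ℝ 1 f) (hg : ContDiff ℝ 1 g) (hgs : HasCompactSupport g)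
    (i : Fin N) : ∫ x, f x * pderiv i g x = -∫ x, pderiv i f x * g x := by
  refine integral_mul_fderiv_eq_neg_fderiv_mul_of_integrable ?_ ?_ ?_
    (fun x _ => hf.differentiable one_ne_zero x) (fun x _ => hg.differentiable one_ne_zero x)
  · exact ((continuous_pderiv hf i).mul hg.continuous).integrable_of_hasCompactSupport hgs.mul_left
  · exact (hf.continuous.mul (continuous_pderiv hg i)).integrable_of_hasCompactSupport
      (hgs.pderiv i).mul_left
  · exact (hf.continuous.mul hg.continuous).integrable_of_hasCompactSupport hgs.mul_left

lemma gradient_apply (f : EuclideanSpace ℝ (Fin N) → ℝ) (x : EuclideanSpace ℝ (Fin N))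
    (i : Fin N) : gradient f x i = pderiv i f x := by
  have h1 : ⟪gradient f x, EuclideanSpace.single i (1 : ℝ)⟫ = pderiv i f x := by
    rw [gradient, InnerProductSpace.toDual_symm_apply, pderiv]
  rw [← h1, EuclideanSpace.inner_single_right]
  simp

lemma norm_gradient_sq (f : EuclideanSpace ℝ (Fin N) → ℝ) (x : EuclideanSpace ℝ (Fin N)) :
    ‖gradient f x‖ ^ 2 = ∑ i, pderiv i f x ^ 2 := by
  rw [EuclideanSpace.norm_sq_eq]
  exact Finset.sum_congr rfl fun i _ => by rw [gradient_apply, Real.norm_eq_abs, sq_abs]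

lemma continuous_gradient (hf : ContDiff ℝ 1 f) : Continuous (gradient f) :=
  (InnerProductSpace.toDual ℝ _).symm.continuous.comp (hf.continuous_fderiv one_ne_zero)

lemma fderiv_apply_eq_sum (f : EuclideanSpace ℝ (Fin N) → ℝ) (x v : EuclideanSpace ℝ (Fin N)) :
    fderiv ℝ f x v = ∑ i, v i * pderiv i f x := by
  conv_lhs => rw [← (EuclideanSpace.basisFun (Fin N) ℝ).sum_repr v]
  simp [pderiv]

lemma continuous_langevinGen (hV : ContDiff ℝ 1 V) (hφ : ContDiff ℝ ∞ φ) :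
    Continuous (langevinGen V φ) :=
  continuous_finsetSum _ fun i _ =>
    (contDiff_pderiv (contDiff_pderiv hφ i) i).continuous.sub
      ((continuous_pderiv hV i).mul (contDiff_pderiv hφ i).continuous)

lemma langevinGen_eq_zero {x : EuclideanSpace ℝ (Fin N)} (hx : x ∉ tsupport φ) :
    langevinGen V φ x = 0 := by
  refine Finset.sum_eq_zero fun i _ => ?_
  have h1 : pderiv i φ x = 0 := image_eq_zero_of_notMem_tsupport fun h =>
    hx (tsupport_pderiv_subset i φ h)
  have h2 : pderiv i (pderiv i φ) x = 0 := image_eq_zero_of_notMem_tsupport fun h =>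
    hx (tsupport_pderiv_subset i φ (tsupport_pderiv_subset i _ h))
  simp [h1, h2]

lemma hasCompactSupport_langevinGen (hφ : HasCompactSupport φ) :
    HasCompactSupport (langevinGen V φ) :=
  hφ.of_isClosed_subset (isClosed_tsupport _) (closure_minimal (fun x hx => by
    by_contra h
    exact hx (langevinGen_eq_zero h)) (isClosed_tsupport _))

lemma pderiv_exp_neg (hV : ContDiff ℝ 1 V) (c : ℝ) (x : EuclideanSpace ℝ (Fin N)) :
    pderiv i (fun y => c * Real.exp (-V y)) x = -(pderiv i V x * (c * Real.exp (-V x))) := by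
  have h1 : HasFDerivAt (fun y => c * Real.exp (-V y))
      (c • (Real.exp (-V x) • -fderiv ℝ V x)) x :=
    ((hV.differentiable one_ne_zero x).hasFDerivAt.neg.exp).const_mul c
  simp only [pderiv, h1.fderiv, smul_apply, neg_apply,
    smul_eq_mul]
  ring

/-- The generator is symmetric for the weight `exp (-V)`, with Dirichlet form `∫ ∇φ · ∇g`. -/
lemma integral_langevinGen_mul (hV : ContDiff ℝ 1 V) (hφ : ContDiff ℝ ∞ φ)
    (hφs : HasCompactSupport φ) (hg : ContDiff ℝ 1 g) (c : ℝ) :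
    ∫ x, langevinGen V φ x * g x * (c * Real.exp (-V x)) =
      -∫ x, (∑ i, pderiv i φ x * pderiv i g x) * (c * Real.exp (-V x)) := by
  set ρ : EuclideanSpace ℝ (Fin N) → ℝ := fun x => c * Real.exp (-V x) with hρ
  have hρ1 : ContDiff ℝ 1 ρ := contDiff_const.mul hV.neg.exp
  have hi : ∀ i, ∫ x, (pderiv i (pderiv i φ) x - pderiv i V x * pderiv i φ x) * g x * ρ x =
      -∫ x, pderiv i φ x * pderiv i g x * ρ x := by
    intro i
    have hφi := contDiff_pderiv hφ i
    have h1 := integral_mul_pderiv (f := fun y => g y * ρ y) (hg.mul hρ1) (hφi.of_le (by norm_num)) (hφs.pderiv i) i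
    have hc1 : Continuous fun x => g x * ρ x := hg.continuous.mul hρ1.continuous
    have hI1 : Integrable fun x => g x * ρ x * pderiv i (pderiv i φ) x :=
      (hc1.mul (contDiff_pderiv hφi i).continuous).integrable_of_hasCompactSupport
        ((hφs.pderiv i).pderiv i).mul_left
    have hI2 : Integrable fun x => pderiv i V x * (g x * ρ x) * pderiv i φ x :=
      (((continuous_pderiv hV i).mul hc1).mul hφi.continuous).integrable_of_hasCompactSupport
        (hφs.pderiv i).mul_left
    have hI3 : Integrable fun x => pderiv i g x * ρ x * pderiv i φ x :=
      (((continuous_pderiv hg i).mul hρ1.continuous).mul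
        hφi.continuous).integrable_of_hasCompactSupport (hφs.pderiv i).mul_left
    -- Differentiating the weight produces a term that cancels the drift of the generator, leaving
    -- only the derivative of g.
    have h2 : ∀ x, pderiv i (fun y => g y * ρ y) x * pderiv i φ x =
        pderiv i g x * ρ x * pderiv i φ x - pderiv i V x * (g x * ρ x) * pderiv i φ x := by
      intro x
      rw [pderiv_mul (hg.differentiable one_ne_zero x) (hρ1.differentiable one_ne_zero x),
        pderiv_exp_neg hV c x]
      ring
    calc ∫ x, (pderiv i (pderiv i φ) x - pderiv i V x * pderiv i φ x) * g x * ρ x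
        = ∫ x, (g x * ρ x * pderiv i (pderiv i φ) x - pderiv i V x * (g x * ρ x) * pderiv i φ x) :=
          integral_congr_ae (ae_of_all _ fun x => by ring)
      _ = -∫ x, pderiv i g x * ρ x * pderiv i φ x := by
          rw [integral_sub hI1 hI2]
          rw [h1, integral_congr_ae (ae_of_all _ h2), integral_sub hI3 hI2]
          ring
      _ = _ := by
          congr 1
          exact integral_congr_ae (ae_of_all _ fun x => by ring)
  simp only [langevinGen, Finset.sum_mul]
  rw [integral_finsetSum, integral_finsetSum, ← Finset.sum_neg_distrib]
  · exact Finset.sum_congr rfl fun i _ => hi i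
  · intro i _
    refine (((contDiff_pderiv hφ i).continuous.mul (continuous_pderiv hg i)).mul
      hρ1.continuous).integrable_of_hasCompactSupport ?_
    exact (hφs.pderiv i).mul_right.mul_right
  · intro i _
    refine ((((contDiff_pderiv (contDiff_pderiv hφ i) i).continuous.sub ((continuous_pderiv hV i).mul
      (contDiff_pderiv hφ i).continuous)).mul hg.continuous).mul
      hρ1.continuous).integrable_of_hasCompactSupport ?_
    exact ((((hφs.pderiv i).pderiv i).sub (hφs.pderiv i).mul_left).mul_right).mul_right

end Generator

/-! ### Mollification in `L²` -/

section Mollification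

open Filter Topology Set
open scoped RealInnerProductSpace ContDiff Convolution

/-- The integral is the L² inner product of a·f with f, and multiplication by the bounded function a
is continuous on L². -/
lemma tendsto_integral_mul_sq {X ι : Type*} [MeasurableSpace X] {μ : Measure X} {l : Filter ι}
    {f : X → ℝ} {F : ι → X → ℝ} (hf : MemLp f 2 μ) (hF : ∀ n, MemLp (F n) 2 μ)
    (h : Tendsto (fun n => eLpNorm (F n - f) 2 μ) l (𝓝 0)) {a : X → ℝ}
    (ha : AEStronglyMeasurable a μ) {A : ℝ} (hA : ∀ x, |a x| ≤ A) :
    Tendsto (fun n => ∫ x, a x * F n x ^ 2 ∂μ) l (𝓝 (∫ x, a x * f x ^ 2 ∂μ)) := by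
  have hmem : ∀ g : X → ℝ, MemLp g 2 μ → MemLp (fun x => a x * g x) 2 μ := fun g hg =>
    MemLp.of_le_mul (c := A) hg (ha.mul hg.1) (ae_of_all _ fun x => by
      rw [norm_mul]; exact mul_le_mul_of_nonneg_right (hA x) (norm_nonneg _))
  have hin : ∀ (g : X → ℝ) (hg : MemLp g 2 μ),
      ∫ x, a x * g x ^ 2 ∂μ = ⟪(hmem g hg).toLp, hg.toLp⟫ := by
    intro g hg
    rw [L2.inner_def]
    refine integral_congr_ae ?_
    filter_upwards [hg.coeFn_toLp, (hmem g hg).coeFn_toLp] with x h1 h2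
    rw [h1, h2]
    simp only [RCLike.inner_apply, conj_trivial]
    ring
  simp_rw [hin f hf, fun n => hin (F n) (hF n)]
  have h1 : Tendsto (fun n => (hF n).toLp) l (𝓝 hf.toLp) :=
    (Lp.tendsto_Lp_iff_tendsto_eLpNorm'' F hF f hf).2 h
  have h2 : Tendsto (fun n => (hmem _ (hF n)).toLp) l (𝓝 (hmem _ hf).toLp) := by
    refine (Lp.tendsto_Lp_iff_tendsto_eLpNorm'' (fun n x => a x * F n x) (fun n => hmem _ (hF n))
      (fun x => a x * f x) (hmem _ hf)).2 ?_
    have h3 : Tendsto (fun n => ENNReal.ofReal A * eLpNorm (F n - f) 2 μ) l (𝓝 0) := by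
      simpa using ENNReal.Tendsto.const_mul h (Or.inr ENNReal.ofReal_ne_top)
    refine tendsto_of_tendsto_of_tendsto_of_le_of_le tendsto_const_nhds h3 (fun _ => zero_le) ?_
    intro n
    refine eLpNorm_le_mul_eLpNorm_of_ae_le_mul (ae_of_all _ fun x => ?_) 2
    simp only [Pi.sub_apply, ← mul_sub, norm_mul]
    exact mul_le_mul_of_nonneg_right (hA x) (norm_nonneg _)
  exact h2.inner h1

variable {E : Type*} [NormedAddCommGroup E] [InnerProductSpace ℝ E] [FiniteDimensional ℝ E]
  [MeasurableSpace E] [BorelSpace E]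

lemma tendsto_eLpNorm_translate {f : E → ℝ} (hf : MemLp f 2 (volume : Measure E)) :
    Tendsto (fun y : E => eLpNorm (fun x => f (x - y) - f x) 2 volume) (𝓝 0) (𝓝 0) := by
  have hmp : ∀ y : E, MeasurePreserving (fun x : E => x - y) volume volume := fun y =>
    measurePreserving_sub_right volume y
  let T : E → C(E, E) := fun y => ⟨fun x => x - y, by fun_prop⟩
  have hT : Continuous T := ContinuousMap.continuous_of_continuous_uncurry _ (by
    simp only [T, Function.uncurry_def, ContinuousMap.coe_mk]; fun_prop)
  have h1 : Continuous fun y : E => Lp.compMeasurePreserving (T y) (hmp y) hf.toLp :=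
    Continuous.compMeasurePreservingLp (f := fun _ : E => hf.toLp) continuous_const hT hmp
      (by norm_num)
  have h2 : ∀ y, Lp.compMeasurePreserving (T y) (hmp y) hf.toLp =
      (hf.comp_measurePreserving (hmp y)).toLp := fun y =>
    Lp.toLp_compMeasurePreserving hf (hmp y)
  simp_rw [h2] at h1
  have h3 := h1.tendsto 0
  have h4 : (hf.comp_measurePreserving (hmp 0)).toLp = hf.toLp :=
    MemLp.toLp_congr _ _ (ae_of_all _ fun x => by simp)
  rw [h4] at h3
  exact (Lp.tendsto_Lp_iff_tendsto_eLpNorm'' _ (fun y => hf.comp_measurePreserving (hmp y)) _ hf).1 h3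

/-- The normalised bump is the density of a probability measure on a ball of radius `rOut`, so f ⋆ η
− f is an average of the differences f(· − y) − f. Jensen's inequality and Tonelli then bound its L²
norm by the worst translate. -/
lemma eLpNorm_convolution_sub_le {f : E → ℝ} (hf : MemLp f 2 (volume : Measure E))
    (hfm : Measurable f) (φ : ContDiffBump (0 : E)) {ε : ℝ≥0∞}
    (hε : ∀ y : E, ‖y‖ ≤ φ.rOut → eLpNorm (fun x => f (x - y) - f x) 2 volume ≤ ε) :
    eLpNorm (f ⋆[ContinuousLinearMap.lsmul ℝ ℝ, volume] φ.normed volume - f) 2 volume ≤ ε := by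
  set η := φ.normed volume with hη
  have hηc : Continuous η := φ.continuous_normed
  have hη0 : ∀ y, 0 ≤ η y := φ.nonneg_normed
  let μ : Measure E := volume.withDensity fun y => ENNReal.ofReal (η y)
  have hμ : IsProbabilityMeasure μ := ⟨by
    rw [withDensity_apply _ MeasurableSet.univ, Measure.restrict_univ,
      ← ofReal_integral_eq_lintegral_ofReal φ.integrable_normed (ae_of_all _ hη0),
      φ.integral_normed, ENNReal.ofReal_one]⟩
  have hμi : ∀ g : E → ℝ, ∫ y, g y ∂μ = ∫ y, η y * g y := by
    intro g
    rw [integral_withDensity_eq_integral_toReal_smul (by fun_prop) (by simp)]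
    exact integral_congr_ae (ae_of_all _ fun y => by simp [ENNReal.toReal_ofReal (hη0 y)])
  have hconv : ∀ x, (f ⋆[ContinuousLinearMap.lsmul ℝ ℝ, volume] η - f) x =
      ∫ y, (f (x - y) - f x) ∂μ := by
    intro x
    have hint : Integrable fun y => η y * f (x - y) := by
      have hL2 : MemLp (fun y => f (x - y)) 2 (volume : Measure E) :=
        hf.comp_measurePreserving (Measure.measurePreserving_sub_left volume x)
      exact (φ.continuous_normed.memLp_of_hasCompactSupport φ.hasCompactSupport_normed :
        MemLp η 2 volume).integrable_mul hL2
    rw [hμi, Pi.sub_apply, convolution_eq_swap]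
    simp only [ContinuousLinearMap.lsmul_apply, smul_eq_mul]
    have h1 : ∀ y, η y * (f (x - y) - f x) = η y * f (x - y) - η y * f x := fun y => by ring
    simp_rw [h1]
    rw [integral_sub hint (φ.integrable_normed.mul_const _), integral_mul_const, φ.integral_normed,
      one_mul]
    congr 1
    exact integral_congr_ae (ae_of_all _ fun y => by simp [mul_comm])
  have hμs : ∀ᵐ y ∂μ, ‖y‖ ≤ φ.rOut := by
    rw [ae_withDensity_iff (by fun_prop)]
    refine ae_of_all _ fun y hy => ?_
    have : y ∈ Function.support η := fun h => hy (by simp [h])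
    rw [φ.support_normed_eq, mem_ball_zero_iff] at this
    exact this.le
  have h2 : ∀ g : E → ℝ, eLpNorm g 2 (volume : Measure E) ^ 2 = ∫⁻ y, ‖g y‖ₑ ^ 2 := fun g => by
    have := eLpNorm_nnreal_pow_eq_lintegral (f := g) (μ := (volume : Measure E)) (p := 2)
      (by norm_num)
    simpa using this
  rw [← ENNReal.pow_le_pow_left_iff two_ne_zero, h2]
  have hm : Measurable fun p : E × E => ‖f (p.1 - p.2) - f p.1‖ₑ ^ 2 := by fun_prop
  calc ∫⁻ x, ‖(f ⋆[ContinuousLinearMap.lsmul ℝ ℝ, volume] η - f) x‖ₑ ^ 2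
      ≤ ∫⁻ x, ∫⁻ y, ‖f (x - y) - f x‖ₑ ^ 2 ∂μ := by
        refine lintegral_mono fun x => ?_
        rw [hconv x]
        have := enorm_integral_sq_le (κ := Kernel.const E μ) (x := x)
          (f := fun y => f (x - y) - f x) (by
            have : Measurable fun y => f (x - y) - f x := by fun_prop
            exact this.aestronglyMeasurable)
        simpa only [Kernel.const_apply] using this
    _ = ∫⁻ y, (∫⁻ x, ‖f (x - y) - f x‖ₑ ^ 2) ∂μ := lintegral_lintegral_swap hm.aemeasurable
    _ ≤ ∫⁻ y, ε ^ 2 ∂μ := by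
        refine lintegral_mono_ae ?_
        filter_upwards [hμs] with y hy
        rw [← h2]
        exact ENNReal.pow_le_pow_left (hε y hy)
    _ = ε ^ 2 := by simp

lemma memLp_convolution {f : E → ℝ} (hf : MemLp f 2 (volume : Measure E)) (hfm : Measurable f)
    (φ : ContDiffBump (0 : E)) :
    MemLp (f ⋆[ContinuousLinearMap.lsmul ℝ ℝ, volume] φ.normed volume) 2 volume := by
  have hc : Continuous (f ⋆[ContinuousLinearMap.lsmul ℝ ℝ, volume] φ.normed volume) :=
    φ.hasCompactSupport_normed.continuous_convolution_right _
      (hf.locallyIntegrable (by norm_num)) φ.continuous_normed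
  have h1 : MemLp (f ⋆[ContinuousLinearMap.lsmul ℝ ℝ, volume] φ.normed volume - f) 2 volume := by
    refine ⟨hc.aestronglyMeasurable.sub hf.1, ?_⟩
    -- Only finiteness matters here, so the triangle inequality bound by twice the norm of f is
    -- enough.
    refine (eLpNorm_convolution_sub_le (ε := eLpNorm f 2 volume + eLpNorm f 2 volume) hf hfm φ
      fun y _ => ?_).trans_lt (ENNReal.add_lt_top.2 ⟨hf.2, hf.2⟩)
    have hmp := measurePreserving_sub_right (volume : Measure E) y
    refine (eLpNorm_sub_le (f := fun x => f (x - y)) (hf.comp_measurePreserving hmp).1 hf.1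
      (by norm_num)).trans ?_
    have := eLpNorm_comp_measurePreserving (p := 2) hf.1 hmp
    simp only [Function.comp_def] at this
    rw [this]
  simpa using h1.add hf

lemma tendsto_eLpNorm_convolution_sub {f : E → ℝ} (hf : MemLp f 2 (volume : Measure E))
    (hfm : Measurable f) {φ : ℕ → ContDiffBump (0 : E)}
    (hφ : Tendsto (fun n => (φ n).rOut) atTop (𝓝 0)) :
    Tendsto (fun n => eLpNorm
      (f ⋆[ContinuousLinearMap.lsmul ℝ ℝ, volume] (φ n).normed volume - f) 2 volume)
      atTop (𝓝 0) := by
  rw [ENNReal.tendsto_nhds_zero]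
  intro ε hε
  obtain ⟨r, hr, hr'⟩ := Metric.eventually_nhds_iff.1
    (ENNReal.tendsto_nhds_zero.1 (tendsto_eLpNorm_translate hf) ε hε)
  filter_upwards [hφ.eventually (gt_mem_nhds hr)] with n hn
  refine eLpNorm_convolution_sub_le hf hfm (φ n) fun y hy => hr' ?_
  rw [dist_zero_right]
  exact hy.trans_lt hn

end Mollification

/-! ### Density of the range of `1 - L` -/

section EllipticDensity

open Filter Topology Set
open scoped RealInnerProductSpace ContDiff Convolution

variable {N : ℕ} {V χ : EuclideanSpace ℝ (Fin N) → ℝ}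

lemma pderiv_convolution {f η : EuclideanSpace ℝ (Fin N) → ℝ} (hf : LocallyIntegrable f volume)
    (hη : ContDiff ℝ 1 η) (hηs : HasCompactSupport η) (i : Fin N) :
    pderiv i (f ⋆[ContinuousLinearMap.lsmul ℝ ℝ, volume] η) =
      f ⋆[ContinuousLinearMap.lsmul ℝ ℝ, volume] pderiv i η := by
  ext x
  rw [pderiv, (hηs.hasFDerivAt_convolution_right _ hf hη x).fderiv,
    convolution_precompR_apply _ hf (hηs.fderiv ℝ) (hη.continuous_fderiv one_ne_zero)]
  rfl

lemma pderiv_comp_const_sub {f : EuclideanSpace ℝ (Fin N) → ℝ} {y x : EuclideanSpace ℝ (Fin N)}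
    (hf : DifferentiableAt ℝ f (y - x)) (i : Fin N) :
    pderiv i (fun x => f (y - x)) x = -pderiv i f (y - x) := by
  have h1 : HasFDerivAt (fun x => f (y - x))
      ((fderiv ℝ f (y - x)).comp (-ContinuousLinearMap.id ℝ _)) x :=
    hf.hasFDerivAt.comp x ((hasFDerivAt_id x).const_sub y)
  simp [pderiv, h1.fderiv]

lemma pderiv_add {f g : EuclideanSpace ℝ (Fin N) → ℝ} {x : EuclideanSpace ℝ (Fin N)}
    (hf : DifferentiableAt ℝ f x) (hg : DifferentiableAt ℝ g x) (i : Fin N) :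
    pderiv i (fun y => f y + g y) x = pderiv i f x + pderiv i g x := by
  simp [pderiv, fderiv_fun_add hf hg]

lemma exists_abs_le_of_hasCompactSupport {f : EuclideanSpace ℝ (Fin N) → ℝ} (hf : Continuous f)
    (hfs : HasCompactSupport f) : ∃ A, ∀ x, |f x| ≤ A :=
  hf.bounded_above_of_compact_support hfs

/-- With ρ = c e^{−V} and g = U/ρ, the flux ∂_i U + F_i equals ρ ∂_i g + e_i, where e_i = F_i − ∂_i
V · U measures how far F_i is from the true drift term. Testing the equation against χ²g and
completing squares absorbs all of ∇g, leaving the cutoff gradient and the error e_i. The left side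
comes from the zeroth-order term of 1 − L. -/
lemma caccioppoli_of_smooth (hV : ContDiff ℝ 1 V) {c : ℝ} (hc : 0 < c)
    {U : EuclideanSpace ℝ (Fin N) → ℝ} {F : Fin N → EuclideanSpace ℝ (Fin N) → ℝ}
    (hU : ContDiff ℝ ∞ U) (hF : ∀ i, ContDiff ℝ ∞ (F i)) (hχ : ContDiff ℝ ∞ χ)
    (hχs : HasCompactSupport χ)
    (heq : ∀ x ∈ tsupport χ, U x = ∑ i, pderiv i (fun y => pderiv i U y + F i y) x) :
    ∫ x, χ x ^ 2 / (c * Real.exp (-V x)) * U x ^ 2 ≤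
      ∑ i, ∫ x, (2 * (pderiv i χ x ^ 2 / (c * Real.exp (-V x)) * U x ^ 2) +
        1 / 2 * (χ x ^ 2 / (c * Real.exp (-V x)) * (F i x - pderiv i V x * U x) ^ 2)) := by
  set ρ : EuclideanSpace ℝ (Fin N) → ℝ := fun x => c * Real.exp (-V x) with hρ
  have hρ1 : ContDiff ℝ 1 ρ := contDiff_const.mul hV.neg.exp
  have hρpos : ∀ x, 0 < ρ x := fun x => mul_pos hc (Real.exp_pos _)
  have hρ0 : ∀ x, ρ x ≠ 0 := fun x => (hρpos x).ne'
  have hU1 : ContDiff ℝ 1 U := hU.of_le (by norm_num)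
  have hχ1 : ContDiff ℝ 1 χ := hχ.of_le (by norm_num)
  set g : EuclideanSpace ℝ (Fin N) → ℝ := fun x => U x / ρ x with hg
  have hg1 : ContDiff ℝ 1 g := hU1.div hρ1 hρ0
  set v : EuclideanSpace ℝ (Fin N) → ℝ := fun x => χ x * (χ x * g x) with hv
  have hv1 : ContDiff ℝ 1 v := hχ1.mul (hχ1.mul hg1)
  have hvs : HasCompactSupport v := hχs.mul_right
  have hUg : ∀ x, U x = g x * ρ x := fun x => by simp only [hg]; field_simp [hρ0 x]
  have hUi : ∀ i x, pderiv i U x = ρ x * pderiv i g x - pderiv i V x * U x := by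
    intro i x
    have h1 : U = fun y => g y * ρ y := funext hUg
    rw [h1, pderiv_mul (hg1.differentiable one_ne_zero x) (hρ1.differentiable one_ne_zero x),
      pderiv_exp_neg hV c x]
    ring
  have hvi : ∀ i x, pderiv i v x = χ x ^ 2 * pderiv i g x + 2 * χ x * pderiv i χ x * g x := by
    intro i x
    have h1 := hχ1.differentiable one_ne_zero x
    have h2 := hg1.differentiable one_ne_zero x
    have h3 : DifferentiableAt ℝ (fun y => χ y * g y) x := h1.mul h2
    rw [hv, pderiv_mul h1 h3, pderiv_mul h1 h2]
    ring
  have hG : ∀ i, ContDiff ℝ ∞ fun y => pderiv i U y + F i y := fun i =>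
    (contDiff_pderiv hU i).add (hF i)
  have hG1 : ∀ i, ContDiff ℝ 1 fun y => pderiv i U y + F i y := fun i =>
    (hG i).of_le (by norm_num)
  have hI1 : ∀ i, Integrable fun x => (pderiv i U x + F i x) * pderiv i v x := fun i =>
    ((hG i).continuous.mul (continuous_pderiv hv1 i)).integrable_of_hasCompactSupport
      (hvs.pderiv i).mul_left
  have hI2 : ∀ i, Integrable fun x => pderiv i (fun y => pderiv i U y + F i y) x * v x := fun i =>
    ((contDiff_pderiv (hG i) i).continuous.mul hv1.continuous).integrable_of_hasCompactSupport
      hvs.mul_left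
  have hmain : ∫ x, U x * v x = -∑ i, ∫ x, (pderiv i U x + F i x) * pderiv i v x := by
    have h1 : ∀ x, U x * v x = ∑ i, pderiv i (fun y => pderiv i U y + F i y) x * v x := by
      intro x
      by_cases hx : x ∈ tsupport χ
      · rw [← Finset.sum_mul, ← heq x hx]
      · have : v x = 0 := by simp [hv, image_eq_zero_of_notMem_tsupport hx]
        simp [this]
    rw [integral_congr_ae (ae_of_all _ h1), integral_finsetSum _ fun i _ => hI2 i,
      ← Finset.sum_neg_distrib]
    refine Finset.sum_congr rfl fun i _ => ?_
    rw [integral_mul_pderiv (f := fun y => pderiv i U y + F i y) (hG1 i) hv1 hvs i, neg_neg]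
  have hUv : ∀ x, χ x ^ 2 / ρ x * U x ^ 2 = U x * v x := fun x => by
    simp only [hv, hg]; ring
  rw [integral_congr_ae (ae_of_all _ hUv), hmain, ← Finset.sum_neg_distrib]
  refine Finset.sum_le_sum fun i _ => ?_
  rw [← integral_neg]
  have hχρ : Continuous fun x => χ x ^ 2 / ρ x := (hχ1.continuous.pow 2).div hρ1.continuous hρ0
  have hχρi : Continuous fun x => pderiv i χ x ^ 2 / ρ x :=
    ((continuous_pderiv hχ1 i).pow 2).div hρ1.continuous hρ0
  have hs1 : HasCompactSupport fun x => χ x ^ 2 / ρ x := by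
    simp only [sq, mul_div_assoc]
    exact hχs.mul_right
  have hs2 : HasCompactSupport fun x => pderiv i χ x ^ 2 / ρ x := by
    simp only [sq, mul_div_assoc]
    exact (hχs.pderiv i).mul_right
  have hI3 : Integrable fun x => 2 * (pderiv i χ x ^ 2 / ρ x * U x ^ 2) :=
    ((hχρi.mul (hU1.continuous.pow 2)).integrable_of_hasCompactSupport hs2.mul_right).const_mul 2
  have hI4 : Integrable fun x => 1 / 2 * (χ x ^ 2 / ρ x * (F i x - pderiv i V x * U x) ^ 2) :=
    ((hχρ.mul (((hF i).continuous.sub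
      ((continuous_pderiv hV i).mul hU1.continuous)).pow 2)).integrable_of_hasCompactSupport
        hs1.mul_right).const_mul _
  refine integral_mono (hI1 i).neg (hI3.add hI4) fun x => ?_
  show -_ ≤ _
  rw [hvi, hUi]
  set e := F i x - pderiv i V x * U x with he
  have h1 : ρ x * pderiv i g x - pderiv i V x * U x + F i x = ρ x * pderiv i g x + e := by
    rw [he]; ring
  rw [h1, hUg x]
  -- The constants 2 and 1/2 in the statement are those for which the difference of the two sides is
  -- a sum of two squares divided by ρ.
  have h2 : 2 * (pderiv i χ x ^ 2 / ρ x * (g x * ρ x) ^ 2) + 1 / 2 * (χ x ^ 2 / ρ x * e ^ 2) +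
      (ρ x * pderiv i g x + e) * (χ x ^ 2 * pderiv i g x + 2 * χ x * pderiv i χ x * g x) =
      ((χ x * (ρ x * pderiv i g x) + pderiv i χ x * (g x * ρ x) + χ x * e / 2) ^ 2 +
        (pderiv i χ x * (g x * ρ x) + χ x * e / 2) ^ 2) / ρ x := by
    field_simp [hρ0 x]
    ring
  have h3 : 0 ≤ ((χ x * (ρ x * pderiv i g x) + pderiv i χ x * (g x * ρ x) + χ x * e / 2) ^ 2 +
        (pderiv i χ x * (g x * ρ x) + χ x * e / 2) ^ 2) / ρ x :=
    div_nonneg (by positivity) (hρpos x).le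
  rw [← h2] at h3
  linarith

/-- Mollifying a very weak solution yields smooth approximate solutions. -/
lemma mollified_equation {w : EuclideanSpace ℝ (Fin N) → ℝ} {B : Set (EuclideanSpace ℝ (Fin N))}
    (hw : LocallyIntegrable w volume)
    (hF : ∀ i, LocallyIntegrable (fun x => w x * pderiv i V x) volume)
    (hweak : ∀ φ : EuclideanSpace ℝ (Fin N) → ℝ, ContDiff ℝ ∞ φ → HasCompactSupport φ →
      tsupport φ ⊆ B → ∫ x, (φ x - langevinGen V φ x) * w x = 0)
    {η : EuclideanSpace ℝ (Fin N) → ℝ} (hη : ContDiff ℝ ∞ η) (hηs : HasCompactSupport η)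
    {y : EuclideanSpace ℝ (Fin N)} (hy : ∀ x, y - x ∈ tsupport η → x ∈ B) :
    (w ⋆[ContinuousLinearMap.lsmul ℝ ℝ, volume] η) y =
      ∑ i, pderiv i (fun z => pderiv i (w ⋆[ContinuousLinearMap.lsmul ℝ ℝ, volume] η) z +
        ((fun x => w x * pderiv i V x) ⋆[ContinuousLinearMap.lsmul ℝ ℝ, volume] η) z) y := by
  have hη1 : ContDiff ℝ 1 η := hη.of_le (by norm_num)
  have hηi : ∀ i, ContDiff ℝ 1 (pderiv i η) := fun i => (contDiff_pderiv hη i).of_le (by norm_num)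
  -- Using the reflected translate of the mollifier as test function turns the weak equation into
  -- the mollified equation at the point y.
  set ψ : EuclideanSpace ℝ (Fin N) → ℝ := fun x => η (y - x) with hψ
  have hψc : ContDiff ℝ ∞ ψ := hη.comp (contDiff_const.sub contDiff_id)
  have hψs : HasCompactSupport ψ :=
    hηs.comp_homeomorph (Homeomorph.subLeft y)
  have hψB : tsupport ψ ⊆ B := by
    intro x hx
    refine hy x ?_
    have : tsupport ψ ⊆ (fun x => y - x) ⁻¹' tsupport η :=
      closure_minimal (fun z hz => subset_tsupport _ hz)
        ((isClosed_tsupport _).preimage (by fun_prop))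
    exact this hx
  have hI : ∀ (f ζ : EuclideanSpace ℝ (Fin N) → ℝ), LocallyIntegrable f volume → Continuous ζ →
      HasCompactSupport ζ → Integrable fun x => f x * ζ (y - x) := by
    intro f ζ hf hζ hζs
    exact hζs.convolutionExists_right (ContinuousLinearMap.lsmul ℝ ℝ) hf hζ y
  have hψi : ∀ i x, pderiv i ψ x = -pderiv i η (y - x) := fun i x =>
    pderiv_comp_const_sub (hη1.differentiable one_ne_zero _) i
  have hψii : ∀ i x, pderiv i (pderiv i ψ) x = pderiv i (pderiv i η) (y - x) := by
    intro i x
    have h1 : pderiv i ψ = fun x => -pderiv i η (y - x) := funext fun x => hψi i x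
    rw [h1]
    have h2 := pderiv_comp_const_sub (f := fun z => -pderiv i η z) (y := y) (x := x)
      ((hηi i).differentiable one_ne_zero _).neg i
    rw [h2]
    show -(fderiv ℝ (fun z => -pderiv i η z) (y - x)) _ = (fderiv ℝ (pderiv i η) (y - x)) _
    rw [fderiv_fun_neg]
    simp
  have h0 := hweak ψ hψc hψs hψB
  have h1 : ∀ x, (ψ x - langevinGen V ψ x) * w x = w x * η (y - x) -
      ∑ i, (w x * pderiv i (pderiv i η) (y - x) + w x * pderiv i V x * pderiv i η (y - x)) := by
    intro x
    simp only [langevinGen, hψi, hψii, sub_mul, Finset.sum_mul]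
    rw [mul_comm (ψ x)]
    congr 1
    exact Finset.sum_congr rfl fun i _ => by ring
  have hIi : ∀ i, Integrable fun x => w x * pderiv i (pderiv i η) (y - x) := fun i =>
    hI w _ hw (contDiff_pderiv (contDiff_pderiv hη i) i).continuous ((hηs.pderiv i).pderiv i)
  have hIVi : ∀ i, Integrable fun x => w x * pderiv i V x * pderiv i η (y - x) := fun i =>
    hI (fun x => w x * pderiv i V x) _ (hF i) (contDiff_pderiv hη i).continuous (hηs.pderiv i)
  have hIs : ∀ i, Integrable fun x => w x * pderiv i (pderiv i η) (y - x) +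
      w x * pderiv i V x * pderiv i η (y - x) := fun i => (hIi i).add (hIVi i)
  rw [integral_congr_ae (ae_of_all _ h1), integral_sub (hI w η hw hη.continuous hηs)
    (integrable_finsetSum _ fun i _ => hIs i), integral_finsetSum _ fun i _ => hIs i,
    sub_eq_zero] at h0
  refine h0.trans (Finset.sum_congr rfl fun i _ => ?_)
  rw [integral_add (hIi i) (hIVi i), pderiv_convolution hw hη1 hηs i]
  have hd1 : DifferentiableAt ℝ (w ⋆[ContinuousLinearMap.lsmul ℝ ℝ, volume] pderiv i η) y :=
    ((hηs.pderiv i).contDiff_convolution_right (n := 1) _ hw (hηi i)).differentiable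
      one_ne_zero y
  have hd2 : DifferentiableAt ℝ ((fun x => w x * pderiv i V x)
      ⋆[ContinuousLinearMap.lsmul ℝ ℝ, volume] η) y :=
    (hηs.contDiff_convolution_right (n := 1) _ (hF i) hη1).differentiable one_ne_zero y
  rw [pderiv_add hd1 hd2, pderiv_convolution hw (hηi i) (hηs.pderiv i) i, pderiv_convolution (hF i) hη1 hηs i]
  rfl

/-- The function w = gρ solves w = div(∇w + w∇V) in the distributional sense. Rather than elliptic
regularity, which would be delicate for V merely C¹, mollify both w and w ∂_i V, use the smooth
estimate, and let the width tend to 0. The commutator between mollification and multiplication by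
∂_i V vanishes in the limit. -/
lemma caccioppoli_of_weak (hV : ContDiff ℝ 1 V) {c : ℝ} (hc : 0 < c)
    {g : EuclideanSpace ℝ (Fin N) → ℝ} (hgm : Measurable g)
    (hg : Integrable fun x => g x ^ 2 * (c * Real.exp (-V x)))
    (hweak : ∀ φ : EuclideanSpace ℝ (Fin N) → ℝ, ContDiff ℝ ∞ φ → HasCompactSupport φ →
      ∫ x, (φ x - langevinGen V φ x) * g x * (c * Real.exp (-V x)) = 0)
    (hχ : ContDiff ℝ ∞ χ) (hχs : HasCompactSupport χ) :
    ∫ x, χ x ^ 2 * (g x ^ 2 * (c * Real.exp (-V x))) ≤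
      ∑ i, 2 * ∫ x, pderiv i χ x ^ 2 * (g x ^ 2 * (c * Real.exp (-V x))) := by
  set ρ : EuclideanSpace ℝ (Fin N) → ℝ := fun x => c * Real.exp (-V x) with hρ
  have hρ1 : ContDiff ℝ 1 ρ := contDiff_const.mul hV.neg.exp
  have hρpos : ∀ x, 0 < ρ x := fun x => mul_pos hc (Real.exp_pos _)
  have hρ0 : ∀ x, ρ x ≠ 0 := fun x => (hρpos x).ne'
  have hχ1 : ContDiff ℝ 1 χ := hχ.of_le (by norm_num)
  obtain ⟨R, hR⟩ := hχs.isCompact.isBounded.subset_closedBall 0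
  -- Truncating to a ball makes w globally square integrable. The cutoff lives in radius R and the
  -- mollifiers have radius at most 1, so the truncation is invisible to the equation on the support
  -- of χ.
  set B : Set (EuclideanSpace ℝ (Fin N)) := Metric.closedBall 0 (R + 2) with hB
  have hBc : IsCompact B := isCompact_closedBall _ _
  have hBm : MeasurableSet B := hBc.measurableSet
  set w : EuclideanSpace ℝ (Fin N) → ℝ := B.indicator fun x => g x * ρ x with hw
  have hwm : Measurable w := (hgm.mul hρ1.continuous.measurable).indicator hBm
  have hbound : ∀ f : EuclideanSpace ℝ (Fin N) → ℝ, Continuous f →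
      ∃ A, 0 ≤ A ∧ ∀ x ∈ B, |f x| ≤ A := by
    intro f hf
    obtain ⟨A, hA⟩ := hBc.exists_bound_of_continuousOn hf.continuousOn
    exact ⟨max A 0, le_max_right _ _, fun x hx => (hA x hx).trans (le_max_left _ _)⟩
  have hw2 : MemLp w 2 volume := by
    rw [memLp_two_iff_integrable_sq hwm.aestronglyMeasurable]
    obtain ⟨A, hA0, hA⟩ := hbound ρ hρ1.continuous
    refine (hg.const_mul A).mono' (hwm.pow_const 2).aestronglyMeasurable (ae_of_all _ fun x => ?_)
    have hgρ : 0 ≤ g x ^ 2 * ρ x := mul_nonneg (sq_nonneg _) (hρpos x).le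
    rw [Real.norm_eq_abs, abs_of_nonneg (sq_nonneg _)]
    by_cases hx : x ∈ B
    · have h1 : ρ x ≤ A := (le_abs_self _).trans (hA x hx)
      rw [hw, indicator_of_mem hx]
      calc (g x * ρ x) ^ 2 = ρ x * (g x ^ 2 * ρ x) := by ring
        _ ≤ A * (g x ^ 2 * ρ x) := by gcongr
    · rw [hw, indicator_of_notMem hx]
      simpa using mul_nonneg hA0 hgρ
  have hF2 : ∀ i, MemLp (fun x => w x * pderiv i V x) 2 volume := by
    intro i
    obtain ⟨A, -, hA⟩ := hbound _ (continuous_pderiv hV i)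
    refine MemLp.of_le_mul (c := A) hw2
      (hwm.mul (continuous_pderiv hV i).measurable).aestronglyMeasurable (ae_of_all _ fun x => ?_)
    by_cases hx : x ∈ B
    · rw [norm_mul, mul_comm]
      exact mul_le_mul_of_nonneg_right (hA x hx) (norm_nonneg _)
    · simp [hw, indicator_of_notMem hx]
  have hFm : ∀ i, Measurable fun x => w x * pderiv i V x := fun i =>
    hwm.mul (continuous_pderiv hV i).measurable
  let η : ℕ → ContDiffBump (0 : EuclideanSpace ℝ (Fin N)) := fun n =>
    ⟨1 / (2 * ((n : ℝ) + 1)), 1 / ((n : ℝ) + 1), by positivity, by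
      apply one_div_lt_one_div_of_lt <;> nlinarith [(n.cast_nonneg : (0 : ℝ) ≤ n)]⟩
  have hη : Tendsto (fun n => (η n).rOut) atTop (𝓝 0) := tendsto_one_div_add_atTop_nhds_zero_nat
  have hη1 : ∀ n, (η n).rOut ≤ 1 := fun n => by
    show 1 / ((n : ℝ) + 1) ≤ 1
    rw [div_le_one (by positivity)]
    linarith [(n.cast_nonneg : (0 : ℝ) ≤ n)]
  let U : ℕ → EuclideanSpace ℝ (Fin N) → ℝ := fun n =>
    w ⋆[ContinuousLinearMap.lsmul ℝ ℝ, volume] (η n).normed volume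
  let F : ℕ → Fin N → EuclideanSpace ℝ (Fin N) → ℝ := fun n i =>
    (fun x => w x * pderiv i V x) ⋆[ContinuousLinearMap.lsmul ℝ ℝ, volume] (η n).normed volume
  have hηc : ∀ n, ContDiff ℝ ∞ ((η n).normed (volume : Measure (EuclideanSpace ℝ (Fin N)))) :=
    fun n => (η n).contDiff_normed
  have hUc : ∀ n, ContDiff ℝ ∞ (U n) := fun n =>
    (η n).hasCompactSupport_normed.contDiff_convolution_right (n := (⊤ : ℕ∞)) _
      (hw2.locallyIntegrable (by norm_num)) (hηc n)
  have hFc : ∀ n i, ContDiff ℝ ∞ (F n i) := fun n i =>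
    (η n).hasCompactSupport_normed.contDiff_convolution_right (n := (⊤ : ℕ∞)) _
      ((hF2 i).locallyIntegrable (by norm_num)) (hηc n)
  have hstep : ∀ n, ∫ x, χ x ^ 2 / ρ x * U n x ^ 2 ≤
      ∑ i, ∫ x, (2 * (pderiv i χ x ^ 2 / ρ x * U n x ^ 2) +
        1 / 2 * (χ x ^ 2 / ρ x * (F n i x - pderiv i V x * U n x) ^ 2)) := by
    intro n
    refine caccioppoli_of_smooth hV hc (hUc n) (hFc n) hχ hχs ?_
    · intro y hy
      refine mollified_equation (B := B) (hw2.locallyIntegrable (by norm_num))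
        (fun i => (hF2 i).locallyIntegrable (by norm_num)) ?_ (hηc n)
        (η n).hasCompactSupport_normed ?_
      · intro φ hφ hφs hφB
        rw [← hweak φ hφ hφs]
        refine integral_congr_ae (ae_of_all _ fun x => ?_)
        by_cases hx : x ∈ B
        · simp only [hw, indicator_of_mem hx]; ring
        · have h1 : x ∉ tsupport φ := fun h => hx (hφB h)
          simp [langevinGen_eq_zero h1, image_eq_zero_of_notMem_tsupport h1]
      · intro x hx
        rw [(η n).tsupport_normed_eq, mem_closedBall_zero_iff] at hx
        have h1 := mem_closedBall_zero_iff.1 (hR hy)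
        rw [hB, mem_closedBall_zero_iff]
        have h2 : x = y - (y - x) := by abel
        rw [h2]
        linarith [norm_sub_le y (y - x), hη1 n]
  have hUmem : ∀ n, MemLp (U n) 2 volume := fun n => memLp_convolution hw2 hwm (η n)
  have hFmem : ∀ n i, MemLp (F n i) 2 volume := fun n i => memLp_convolution (hF2 i) (hFm i) (η n)
  have hUlim := tendsto_eLpNorm_convolution_sub hw2 hwm hη
  have hFlim := fun i => tendsto_eLpNorm_convolution_sub (hF2 i) (hFm i) hη
  have hχρ : Continuous fun x => χ x ^ 2 / ρ x := (hχ1.continuous.pow 2).div hρ1.continuous hρ0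
  have hs1 : HasCompactSupport fun x => χ x ^ 2 / ρ x := by
    simp only [sq, mul_div_assoc]
    exact hχs.mul_right
  have hχρi : ∀ i, Continuous fun x => pderiv i χ x ^ 2 / ρ x := fun i =>
    ((continuous_pderiv hχ1 i).pow 2).div hρ1.continuous hρ0
  have hs2 : ∀ i, HasCompactSupport fun x => pderiv i χ x ^ 2 / ρ x := by
    intro i
    simp only [sq, mul_div_assoc]
    exact (hχs.pderiv i).mul_right
  have hlim : ∀ a : EuclideanSpace ℝ (Fin N) → ℝ, Continuous a → HasCompactSupport a →
      Tendsto (fun n => ∫ x, a x * U n x ^ 2) atTop (𝓝 (∫ x, a x * w x ^ 2)) := by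
    intro a ha has
    obtain ⟨A, hA⟩ := exists_abs_le_of_hasCompactSupport ha has
    exact tendsto_integral_mul_sq hw2 hUmem hUlim ha.aestronglyMeasurable hA
  have hlim0 : ∀ (a f : EuclideanSpace ℝ (Fin N) → ℝ) (G : ℕ → EuclideanSpace ℝ (Fin N) → ℝ),
      Continuous a → HasCompactSupport a → MemLp f 2 volume → (∀ n, MemLp (G n) 2 volume) →
      Tendsto (fun n => eLpNorm (G n - f) 2 volume) atTop (𝓝 0) →
      Tendsto (fun n => ∫ x, a x * (G n x - f x) ^ 2) atTop (𝓝 0) := by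
    intro a f G ha has hf hG hGf
    obtain ⟨A, hA⟩ := exists_abs_le_of_hasCompactSupport ha has
    have := tendsto_integral_mul_sq (f := 0) (F := fun n => G n - f) (a := a) MemLp.zero'
      (fun n => (hG n).sub hf) (by simpa using hGf) ha.aestronglyMeasurable hA
    simpa using this
  have hI : ∀ (a f : EuclideanSpace ℝ (Fin N) → ℝ), Continuous a → HasCompactSupport a →
      MemLp f 2 volume → Integrable fun x => a x * f x ^ 2 := by
    intro a f ha has hf
    obtain ⟨A, hA⟩ := exists_abs_le_of_hasCompactSupport ha has
    exact hf.integrable_sq.bdd_mul ha.aestronglyMeasurable (ae_of_all _ hA)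
  have hE : ∀ i, Tendsto (fun n => ∫ x, χ x ^ 2 / ρ x * (F n i x - pderiv i V x * U n x) ^ 2)
      atTop (𝓝 0) := by
    intro i
    have hb : Continuous fun x => χ x ^ 2 / ρ x * pderiv i V x ^ 2 :=
      hχρ.mul ((continuous_pderiv hV i).pow 2)
    have hbs : HasCompactSupport fun x => χ x ^ 2 / ρ x * pderiv i V x ^ 2 := hs1.mul_right
    have h1 := hlim0 _ _ (fun n => F n i) hχρ hs1 (hF2 i) (fun n => hFmem n i) (hFlim i)
    have h2 := hlim0 _ _ U hb hbs hw2 hUmem hUlim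
    -- Split the commutator as (F_n − w ∂_i V) − ∂_i V (U_n − w); each part tends to 0 in weighted
    -- L².
    have h3 : Tendsto (fun n => 2 * (∫ x, χ x ^ 2 / ρ x * (F n i x - w x * pderiv i V x) ^ 2) +
        2 * ∫ x, χ x ^ 2 / ρ x * pderiv i V x ^ 2 * (U n x - w x) ^ 2) atTop (𝓝 0) := by
      simpa using (h1.const_mul 2).add (h2.const_mul 2)
    refine squeeze_zero (fun n => integral_nonneg fun x => ?_) (fun n => ?_) h3
    · have := (hρpos x).le
      positivity
    · have hi1 := hI _ (fun x => F n i x - w x * pderiv i V x) hχρ hs1 ((hFmem n i).sub (hF2 i))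
      have hi2 := hI _ (fun x => U n x - w x) hb hbs ((hUmem n).sub hw2)
      rw [← integral_const_mul, ← integral_const_mul, ← integral_add (hi1.const_mul 2)
        (hi2.const_mul 2)]
      refine integral_mono_of_nonneg (ae_of_all _ fun x => ?_)
        ((hi1.const_mul 2).add (hi2.const_mul 2)) (ae_of_all _ fun x => ?_)
      · have := (hρpos x).le
        show 0 ≤ χ x ^ 2 / ρ x * (F n i x - pderiv i V x * U n x) ^ 2
        positivity
      · have h4 : 0 ≤ χ x ^ 2 / ρ x := by
          have := (hρpos x).le
          positivity
        have h5 : (F n i x - pderiv i V x * U n x) ^ 2 ≤ 2 * (F n i x - w x * pderiv i V x) ^ 2 +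
            2 * (pderiv i V x ^ 2 * (U n x - w x) ^ 2) := by
          nlinarith [sq_nonneg ((F n i x - w x * pderiv i V x) + pderiv i V x * (U n x - w x))]
        show χ x ^ 2 / ρ x * (F n i x - pderiv i V x * U n x) ^ 2 ≤
          2 * (χ x ^ 2 / ρ x * (F n i x - w x * pderiv i V x) ^ 2) +
          2 * (χ x ^ 2 / ρ x * pderiv i V x ^ 2 * (U n x - w x) ^ 2)
        nlinarith [mul_le_mul_of_nonneg_left h5 h4]
  have hwχ : ∀ a : EuclideanSpace ℝ (Fin N) → ℝ, tsupport a ⊆ tsupport χ →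
      ∫ x, a x ^ 2 / ρ x * w x ^ 2 = ∫ x, a x ^ 2 * (g x ^ 2 * ρ x) := by
    intro a ha
    refine integral_congr_ae (ae_of_all _ fun x => ?_)
    by_cases hx : x ∈ tsupport a
    · have : x ∈ B := by
        have h1 := mem_closedBall_zero_iff.1 (hR (ha hx))
        rw [hB, mem_closedBall_zero_iff]; linarith
      simp only [hw, indicator_of_mem this]
      field_simp [hρ0 x]
    · simp [image_eq_zero_of_notMem_tsupport hx]
  rw [← hwχ χ subset_rfl]
  rw [Finset.sum_congr rfl fun i _ => by rw [← hwχ (pderiv i χ) (tsupport_pderiv_subset i χ)]]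
  have hrhs : Tendsto (fun n => ∑ i, (2 * (∫ x, pderiv i χ x ^ 2 / ρ x * U n x ^ 2) +
        1 / 2 * ∫ x, χ x ^ 2 / ρ x * (F n i x - pderiv i V x * U n x) ^ 2)) atTop
      (𝓝 (∑ i, 2 * ∫ x, pderiv i χ x ^ 2 / ρ x * w x ^ 2)) := by
    refine tendsto_finsetSum _ fun i _ => ?_
    have := ((hlim _ (hχρi i) (hs2 i)).const_mul 2).add ((hE i).const_mul (1 / 2))
    simpa using this
  refine le_of_tendsto_of_tendsto' (hlim _ hχρ hs1) hrhs fun n => (hstep n).trans_eq ?_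
  refine Finset.sum_congr rfl fun i _ => ?_
  rw [← integral_const_mul, ← integral_const_mul, ← integral_add]
  · exact (hI _ _ (hχρi i) (hs2 i) (hUmem n)).const_mul 2
  · exact ((hχρ.mul (((hFc n i).continuous.sub ((continuous_pderiv hV i).mul
      (hUc n).continuous)).pow 2)).integrable_of_hasCompactSupport hs1.mul_right).const_mul _

/-- A function in `L²(exp (-V))` that annihilates the range of `1 - L` on test functions
vanishes. -/
theorem ae_eq_zero_of_integral_sub_langevinGen (hV : ContDiff ℝ 1 V) {c : ℝ} (hc : 0 < c)
    {g : EuclideanSpace ℝ (Fin N) → ℝ} (hgm : Measurable g)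
    (hg : Integrable fun x => g x ^ 2 * (c * Real.exp (-V x)))
    (hweak : ∀ φ : EuclideanSpace ℝ (Fin N) → ℝ, ContDiff ℝ ∞ φ → HasCompactSupport φ →
      ∫ x, (φ x - langevinGen V φ x) * g x * (c * Real.exp (-V x)) = 0) :
    g =ᵐ[volume] 0 := by
  have hρpos : ∀ x, 0 < c * Real.exp (-V x) := fun x => mul_pos hc (Real.exp_pos _)
  have hg0 : ∀ x, 0 ≤ g x ^ 2 * (c * Real.exp (-V x)) := fun x =>
    mul_nonneg (sq_nonneg _) (hρpos x).le
  let χ : ContDiffBump (0 : EuclideanSpace ℝ (Fin N)) := ⟨1, 2, one_pos, one_lt_two⟩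
  have hχ : ContDiff ℝ ∞ χ := χ.contDiff
  have hχs : HasCompactSupport χ := χ.hasCompactSupport
  have hA : ∀ i, ∃ A, ∀ x, |pderiv i χ x| ≤ A := fun i =>
    exists_abs_le_of_hasCompactSupport (contDiff_pderiv hχ i).continuous (hχs.pderiv i)
  choose A hA using hA
  let r : ℕ → ℝ := fun n => 1 / ((n : ℝ) + 1)
  have hr0 : ∀ n, 0 < r n := fun n => by simp only [r]; positivity
  have hr : Tendsto r atTop (𝓝 0) := tendsto_one_div_add_atTop_nhds_zero_nat
  -- Dilated cutoffs have gradient O(r_n). In the Caccioppoli inequality the right side therefore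
  -- tends to 0 while the left side tends to the full weighted norm of g; no growth condition on V
  -- enters.
  let χn : ℕ → EuclideanSpace ℝ (Fin N) → ℝ := fun n x => χ (r n • x)
  have hχn : ∀ n, ContDiff ℝ ∞ (χn n) := fun n => hχ.comp (contDiff_const_smul (r n))
  have hχns : ∀ n, HasCompactSupport (χn n) := fun n => hχs.comp_smul (hr0 n).ne'
  have hχni : ∀ n i x, pderiv i (χn n) x = r n * pderiv i χ (r n • x) := by
    intro n i x
    have h1 : HasFDerivAt (χn n)
        ((fderiv ℝ χ (r n • x)).comp (r n • ContinuousLinearMap.id ℝ _)) x :=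
      (hχ.differentiable (by norm_num) _).hasFDerivAt.comp x ((hasFDerivAt_id x).const_smul (r n))
    simp [pderiv, h1.fderiv]
  set I := ∫ x, g x ^ 2 * (c * Real.exp (-V x)) with hI
  have hstep : ∀ n, ∫ x, χn n x ^ 2 * (g x ^ 2 * (c * Real.exp (-V x))) ≤
      ∑ i, 2 * ((r n * A i) ^ 2 * I) := by
    intro n
    refine (caccioppoli_of_weak hV hc hgm hg hweak (hχn n) (hχns n)).trans ?_
    refine Finset.sum_le_sum fun i _ => ?_
    gcongr
    rw [hI, ← integral_const_mul]
    refine integral_mono_of_nonneg (ae_of_all _ fun x => mul_nonneg (sq_nonneg _) (hg0 x))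
      (hg.const_mul _) (ae_of_all _ fun x => ?_)
    refine mul_le_mul_of_nonneg_right ?_ (hg0 x)
    rw [hχni, ← sq_abs, abs_mul, abs_of_pos (hr0 n)]
    have := hA i (r n • x)
    have := (hr0 n).le
    gcongr
  have hlhs : Tendsto (fun n => ∫ x, χn n x ^ 2 * (g x ^ 2 * (c * Real.exp (-V x)))) atTop
      (𝓝 I) := by
    refine tendsto_integral_of_dominated_convergence
      (fun x => g x ^ 2 * (c * Real.exp (-V x))) (fun n => ?_) hg (fun n => ?_) ?_
    · exact ((hχn n).continuous.pow 2).aestronglyMeasurable.mul hg.1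
    · refine ae_of_all _ fun x => ?_
      rw [norm_mul, Real.norm_of_nonneg (hg0 x), Real.norm_of_nonneg (sq_nonneg _)]
      refine mul_le_of_le_one_left (hg0 x) (pow_le_one₀ χ.nonneg χ.le_one)
    · refine ae_of_all _ fun x => ?_
      have h1 : Tendsto (fun n => r n • x) atTop (𝓝 0) := by simpa using hr.smul_const x
      have h2 : ∀ᶠ n in atTop, r n • x ∈ Metric.ball (0 : EuclideanSpace ℝ (Fin N)) 1 :=
        h1.eventually (Metric.ball_mem_nhds _ one_pos)
      refine tendsto_const_nhds.congr' ?_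
      filter_upwards [h2] with n hn
      have : χn n x = 1 := χ.one_of_mem_closedBall (Metric.ball_subset_closedBall hn)
      rw [this, one_pow, one_mul]
  have hrhs : Tendsto (fun n => ∑ i, 2 * ((r n * A i) ^ 2 * I)) atTop (𝓝 0) := by
    have : Tendsto (fun n => ∑ i, 2 * ((r n * A i) ^ 2 * I)) atTop
        (𝓝 (∑ i, 2 * ((0 * A i) ^ 2 * I))) :=
      tendsto_finsetSum _ fun i _ => (((hr.mul_const (A i)).pow 2).mul_const I).const_mul 2
    simpa using this
  have hI0 : I = 0 := le_antisymm (le_of_tendsto_of_tendsto' hlhs hrhs hstep)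
    (integral_nonneg hg0)
  filter_upwards [(integral_eq_zero_iff_of_nonneg hg0 hg).1 hI0] with x hx
  have h1 : g x ^ 2 * (c * Real.exp (-V x)) = 0 := hx
  rcases mul_eq_zero.1 h1 with h | h
  · exact pow_eq_zero_iff two_ne_zero |>.1 h
  · exact absurd h (hρpos x).ne'

end EllipticDensity

/-! ### Brownian motion: moments and a maximal inequality -/

section Brownian

open Filter Topology Set
open scoped RealInnerProductSpace

variable {N : ℕ} {Ω : Type*} {mΩ : MeasurableSpace Ω} {ℱ : Filtration ℝ≥0 mΩ} {P : Measure Ω}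
  {B : ℝ≥0 → Ω → EuclideanSpace ℝ (Fin N)}

/-- The absolute moments of the standard Gaussian distribution. -/
noncomputable def gaussianAbsMoment (k : ℕ) : ℝ := ∫ x, |x| ^ k ∂gaussianReal 0 1

lemma gaussianAbsMoment_nonneg (k : ℕ) : 0 ≤ gaussianAbsMoment k :=
  integral_nonneg fun _ => by positivity

lemma integral_abs_pow_gaussianReal (k : ℕ) (h : ℝ≥0) :
    ∫ x, |x| ^ k ∂gaussianReal 0 h = √h ^ k * gaussianAbsMoment k := by
  have h1 : (gaussianReal 0 1).map (fun x => √(h : ℝ) * x) = gaussianReal 0 h := by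
    rw [gaussianReal_map_const_mul]
    congr 1
    · simp
    · ext; simp
  rw [← h1, integral_map (by fun_prop) (by fun_prop), gaussianAbsMoment, ← integral_const_mul]
  refine integral_congr_ae (ae_of_all _ fun x => ?_)
  simp only [abs_mul, mul_pow, abs_of_nonneg (Real.sqrt_nonneg _)]

lemma integrable_abs_pow_gaussianReal (k : ℕ) (h : ℝ≥0) :
    Integrable (fun x : ℝ => |x| ^ k) (gaussianReal 0 h) := by
  have := (memLp_id_gaussianReal (μ := 0) (v := h) k).integrable_norm_pow'
  simpa using this

lemma IsStandardBrownian.integrable_abs_pow (hB : IsStandardBrownian ℱ P B) (k : ℕ) (t : ℝ≥0)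
    (i : Fin N) : Integrable (fun ω => |B t ω i| ^ k) P := by
  have h1 := (hB.coord i).hasLaw_eval t
  have h2 := integrable_abs_pow_gaussianReal k t
  rw [← h1.map_eq] at h2
  exact h2.comp_aemeasurable h1.aemeasurable

lemma IsStandardBrownian.integral_abs_pow (hB : IsStandardBrownian ℱ P B) (k : ℕ) (t : ℝ≥0)
    (i : Fin N) : ∫ ω, |B t ω i| ^ k ∂P = √t ^ k * gaussianAbsMoment k := by
  rw [← integral_abs_pow_gaussianReal, ← ((hB.coord i).hasLaw_eval t).map_eq,
    integral_map ((hB.coord i).hasLaw_eval t).aemeasurable (by fun_prop)]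

lemma IsStandardBrownian.measurable_coord (hB : IsStandardBrownian ℱ P B) (t : ℝ≥0) (i : Fin N) :
    Measurable[ℱ t] fun ω => B t ω i :=
  (by fun_prop : Measurable fun x : EuclideanSpace ℝ (Fin N) => x i).comp (hB.adapted t)

lemma IsStandardBrownian.memLp (hB : IsStandardBrownian ℱ P B) (t : ℝ≥0) (i : Fin N) :
    MemLp (fun ω => B t ω i) 2 P :=
  (memLp_two_iff_integrable_sq
    ((hB.coord i).hasLaw_eval t).aemeasurable.aestronglyMeasurable).2 <| by
      simpa using hB.integrable_abs_pow 2 t i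

lemma IsStandardBrownian.integral_coord (hB : IsStandardBrownian ℱ P B) (t : ℝ≥0) (i : Fin N) :
    ∫ ω, B t ω i ∂P = 0 :=
  (hB.coord i).integral_eval t

lemma IsStandardBrownian.integral_mul [IsProbabilityMeasure P] (hB : IsStandardBrownian ℱ P B)
    (t : ℝ≥0) (i j : Fin N) :
    ∫ ω, B t ω i * B t ω j ∂P = if i = j then (t : ℝ) else 0 := by
  split_ifs with hij
  · subst hij
    have h1 := (hB.coord i).covariance_fun_eval t t
    rw [covariance_eq_sub (hB.memLp t i) (hB.memLp t i), hB.integral_coord] at h1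
    simpa using h1
  · have h1 : IndepFun (fun ω => B t ω i) (fun ω => B t ω j) P :=
      (hB.indep_coord.indepFun hij).comp (measurable_pi_apply t) (measurable_pi_apply t)
    have h2 := h1.integral_fun_mul_eq_mul_integral (hB.memLp t i).1 (hB.memLp t j).1
    rw [h2, hB.integral_coord, zero_mul]

lemma IsStandardBrownian.condExp_coord [IsProbabilityMeasure P] (hB : IsStandardBrownian ℱ P B)
    {s t : ℝ≥0} (hst : s ≤ t) (i : Fin N) :
    P[fun ω => B t ω i | ℱ s] =ᵐ[P] fun ω => B s ω i := by
  have hint : ∀ t, Integrable (fun ω => B t ω i) P := fun t => (hB.coord i).integrable_eval t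
  have h1 : P[fun ω => B t ω i - B s ω i | ℱ s] =ᵐ[P] fun _ => ∫ ω, (B t ω i - B s ω i) ∂P := by
    have hm : Measurable fun ω => B t ω - B s ω :=
      ((hB.adapted t).mono (ℱ.le t) le_rfl).sub ((hB.adapted s).mono (ℱ.le s) le_rfl)
    refine condExp_indep_eq (m₁ := MeasurableSpace.comap (fun ω => B t ω - B s ω) inferInstance)
      hm.comap_le (ℱ.le s) ?_ (hB.indep_increments s t hst).symm
    have h2 : Measurable[MeasurableSpace.comap (fun ω => B t ω - B s ω) inferInstance]
        fun ω => B t ω i - B s ω i :=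
      (by fun_prop : Measurable fun x : EuclideanSpace ℝ (Fin N) => x i).comp
        (comap_measurable fun ω => B t ω - B s ω)
    exact h2.stronglyMeasurable
  have h0 : ∫ ω, (B t ω i - B s ω i) ∂P = 0 := by
    rw [integral_sub (hint t) (hint s), hB.integral_coord, hB.integral_coord, sub_zero]
  have h2 : P[fun ω => B s ω i | ℱ s] = fun ω => B s ω i :=
    condExp_of_stronglyMeasurable (ℱ.le s) (hB.measurable_coord s i).stronglyMeasurable (hint s)
  have h3 := condExp_add ((hint t).sub (hint s)) (hint s) (ℱ s)
  have h4 : (((fun ω => B t ω i) - fun ω => B s ω i) + fun ω => B s ω i) = fun ω => B t ω i := by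
    ext ω; simp
  rw [h4] at h3
  have h5 : ((fun ω => B t ω i) - fun ω => B s ω i) = fun ω => B t ω i - B s ω i := rfl
  rw [h5] at h3
  filter_upwards [h1, h3] with ω hω1 hω3
  rw [hω3, Pi.add_apply, hω1, h0, h2, zero_add]

lemma IsStandardBrownian.submartingale [IsProbabilityMeasure P] (hB : IsStandardBrownian ℱ P B)
    (i : Fin N) : Submartingale (fun t ω => B t ω i ^ 4) ℱ P := by
  have hint : ∀ t, Integrable (fun ω => B t ω i) P := fun t => (hB.coord i).integrable_eval t
  have hint4 : ∀ t, Integrable (fun ω => B t ω i ^ 4) P := fun t => by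
    have := hB.integrable_abs_pow 4 t i
    simpa [Even.pow_abs (by decide : Even 4)] using this
  refine ⟨fun t => ((hB.measurable_coord t i).pow_const 4).stronglyMeasurable,
    fun s t hst => ?_, hint4⟩
  have h1 := ConvexOn.map_condExp_le_univ (μ := P) (f := fun ω => B t ω i)
    (φ := fun x : ℝ => x ^ 4) (ℱ.le s)
    (Even.convexOn_pow (by decide)) (by fun_prop : Continuous fun x : ℝ => x ^ 4).lowerSemicontinuous
    (hint t) (hint4 t)
  filter_upwards [h1, hB.condExp_coord hst i] with ω h2 h3
  simp only [Function.comp_apply, h3] at h2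
  exact h2

/-- Doob's maximal inequality on dyadic grids, extended to all times by path continuity. The fourth
power gives a bound of order h², which remains negligible after division by h in the generator
computation. -/
lemma IsStandardBrownian.measure_exists_lt_le [IsProbabilityMeasure P]
    (hB : IsStandardBrownian ℱ P B) (i : Fin N) {c : ℝ} (hc : 0 < c) (h : ℝ≥0) :
    P {ω | ∃ r ≤ h, c < |B r ω i|} ≤
      ENNReal.ofReal ((h : ℝ) ^ 2 * gaussianAbsMoment 4 / c ^ 4) := by
  -- The minimum freezes the grid at time h, so that it defines a filtration indexed by all of ℕ.
  let τ : ℕ → ℕ → ℝ≥0 := fun n k => (min k (2 ^ n) : ℕ) / 2 ^ n * h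
  have hτmono : ∀ n, Monotone (τ n) := fun n k l hkl => by
    simp only [τ]; gcongr
  let A : ℕ → Set Ω := fun n => {ω | ∃ k ≤ 2 ^ n, c ^ 4 ≤ B (τ n k) ω i ^ 4}
  have hAmono : Monotone A := by
    refine monotone_nat_of_le_succ fun n => ?_
    rintro ω ⟨k, hk, hkc⟩
    refine ⟨2 * k, by rw [pow_succ]; omega, ?_⟩
    have : τ (n + 1) (2 * k) = τ n k := by
      simp only [τ]
      rw [min_eq_left hk, min_eq_left (by rw [pow_succ]; omega)]
      congr 1
      push_cast
      rw [pow_succ, mul_comm (2 : ℝ≥0), mul_div_mul_right _ _ two_ne_zero]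
    rw [this]; exact hkc
  have hAle : ∀ n, P (A n) ≤ ENNReal.ofReal ((h : ℝ) ^ 2 * gaussianAbsMoment 4 / c ^ 4) := by
    intro n
    let 𝒢 : Filtration ℕ mΩ := ⟨fun k => ℱ (τ n k), fun k l hkl => ℱ.mono (hτmono n hkl),
      fun k => ℱ.le _⟩
    have hsub : Submartingale (fun k ω => B (τ n k) ω i ^ 4) 𝒢 P :=
      ⟨fun k => (hB.submartingale i).1 _, fun k l hkl => (hB.submartingale i).2.1 _ _ (hτmono n hkl),
        fun k => (hB.submartingale i).2.2 _⟩
    have h1 := maximal_ineq hsub (fun k ω => by positivity) (ε := (c ^ 4).toNNReal) (2 ^ n)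
    have hset : {ω | (((c ^ 4).toNNReal : ℝ≥0) : ℝ) ≤ (Finset.range (2 ^ n + 1)).sup'
        Finset.nonempty_range_add_one fun k => B (τ n k) ω i ^ 4} = A n := by
      ext ω
      simp only [mem_ofPred_eq, Finset.le_sup'_iff, Finset.mem_range, A,
        Real.coe_toNNReal _ (by positivity : (0 : ℝ) ≤ c ^ 4), Nat.lt_succ_iff]
    rw [hset] at h1
    have hτ : τ n (2 ^ n) = h := by simp [τ]
    rw [hτ] at h1
    have h2 : ∫ ω in A n, B h ω i ^ 4 ∂P ≤ (h : ℝ) ^ 2 * gaussianAbsMoment 4 := by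
      have h3 : (h : ℝ) ^ 2 = √h ^ 4 := by
        rw [show (4 : ℕ) = 2 * 2 from rfl, pow_mul, Real.sq_sqrt h.coe_nonneg]
      rw [h3, ← hB.integral_abs_pow 4 h i]
      simp only [Even.pow_abs (by decide : Even 4)]
      exact setIntegral_le_integral ((hB.submartingale i).2.2 h) (ae_of_all _ fun ω => by positivity)
    have h4 : ENNReal.ofReal (c ^ 4) * P (A n) ≤
        ENNReal.ofReal ((h : ℝ) ^ 2 * gaussianAbsMoment 4) :=
      h1.trans (ENNReal.ofReal_le_ofReal h2)
    rw [ENNReal.ofReal_div_of_pos (by positivity), ENNReal.le_div_iff_mul_le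
      (Or.inl (by simp; positivity)) (Or.inl ENNReal.ofReal_ne_top), mul_comm]
    exact h4
  have hsubset : {ω | ∃ r ≤ h, c < |B r ω i|} ≤ᵐ[P] ⋃ n, A n := by
    filter_upwards [(hB.coord i).cont] with ω hω
    show (∃ r ≤ h, c < |B r ω i|) → ω ∈ ⋃ n, A n
    rintro ⟨r, hr, hrc⟩
    -- Dyadic times approximate r, and the strict inequality c < |B r| survives at a nearby grid
    -- point.
    have hlim : Tendsto (fun n => τ n ⌊(r : ℝ) / h * 2 ^ n⌋₊) atTop (𝓝 r) := by
      rcases eq_or_ne h 0 with rfl | hh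
      · have : r = 0 := le_antisymm hr zero_le
        simp [τ, this]
      have h2 : Tendsto (fun n : ℕ => ((⌊(r : ℝ) / h * 2 ^ n⌋₊ : ℝ)) / 2 ^ n) atTop
          (𝓝 ((r : ℝ) / h)) :=
        (tendsto_nat_floor_mul_div_atTop (R := ℝ) (a := (r : ℝ) / h) (by positivity)).comp
          (tendsto_pow_atTop_atTop_of_one_lt (one_lt_two : (1 : ℝ) < 2))
      have h3 := h2.mul_const (h : ℝ)
      rw [div_mul_cancel₀ _ (NNReal.coe_ne_zero.2 hh)] at h3
      refine NNReal.tendsto_coe.1 (h3.congr fun n => ?_)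
      simp only [τ]
      rw [min_eq_left]
      · push_cast; rfl
      refine Nat.floor_le_of_le ?_
      have : (r : ℝ) / h ≤ 1 := div_le_one_of_le₀ hr h.coe_nonneg
      calc (r : ℝ) / h * 2 ^ n ≤ 1 * 2 ^ n := by gcongr
        _ = ((2 ^ n : ℕ) : ℝ) := by simp
    have h4 := ((hω.tendsto r).comp hlim).abs.eventually (lt_mem_nhds hrc)
    obtain ⟨n, hn⟩ := h4.exists
    refine mem_iUnion.2 ⟨n, min ⌊(r : ℝ) / h * 2 ^ n⌋₊ (2 ^ n), min_le_right _ _, ?_⟩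
    have h5 : τ n (min ⌊(r : ℝ) / h * 2 ^ n⌋₊ (2 ^ n)) = τ n ⌊(r : ℝ) / h * 2 ^ n⌋₊ := by
      simp only [τ, min_assoc, min_self]
    rw [h5, ← Even.pow_abs (by decide : Even 4) (B _ ω i)]
    exact pow_le_pow_left₀ hc.le (le_of_lt hn) 4
  refine (measure_mono_ae hsubset).trans ?_
  rw [hAmono.measure_iUnion]
  exact iSup_le hAle

lemma EuclideanSpace.norm_le_sum_abs (v : EuclideanSpace ℝ (Fin N)) : ‖v‖ ≤ ∑ i, |v i| := by
  conv_lhs => rw [← (EuclideanSpace.basisFun (Fin N) ℝ).sum_repr v]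
  refine (norm_sum_le _ _).trans (Finset.sum_le_sum fun i _ => ?_)
  simp [norm_smul]

lemma IsStandardBrownian.measure_exists_lt_norm_le [IsProbabilityMeasure P]
    (hB : IsStandardBrownian ℱ P B) {c : ℝ} (hc : 0 < c) (h : ℝ≥0) :
    P {ω | ∃ r ≤ h, c < ‖B r ω‖} ≤
      ENNReal.ofReal (N * ((h : ℝ) ^ 2 * gaussianAbsMoment 4 / (c / (N + 1)) ^ 4)) := by
  -- Dividing by N + 1 instead of N also covers dimension 0.
  have hc' : 0 < c / (N + 1) := by positivity
  have hsub : {ω | ∃ r ≤ h, c < ‖B r ω‖} ⊆ ⋃ i, {ω | ∃ r ≤ h, c / (N + 1) < |B r ω i|} := by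
    rintro ω ⟨r, hr, hrc⟩
    simp only [mem_iUnion, mem_ofPred_eq]
    by_contra! hcon
    have h1 : ∑ i, |B r ω i| ≤ ∑ _i : Fin N, c / (N + 1) :=
      Finset.sum_le_sum fun i _ => hcon i r hr
    rw [Finset.sum_const, Finset.card_univ, Fintype.card_fin, nsmul_eq_mul] at h1
    have h2 : (N : ℝ) * (c / (N + 1)) ≤ c := by
      rw [mul_div_assoc', div_le_iff₀ (by positivity)]
      nlinarith
    linarith [EuclideanSpace.norm_le_sum_abs (B r ω)]
  have h0 : 0 ≤ (h : ℝ) ^ 2 * gaussianAbsMoment 4 / (c / (N + 1)) ^ 4 := by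
    have := gaussianAbsMoment_nonneg 4
    positivity
  calc P {ω | ∃ r ≤ h, c < ‖B r ω‖} ≤ ∑ i, P {ω | ∃ r ≤ h, c / (N + 1) < |B r ω i|} :=
        (measure_mono hsub).trans (measure_iUnion_fintype_le _ _)
    _ ≤ ∑ _i : Fin N, ENNReal.ofReal ((h : ℝ) ^ 2 * gaussianAbsMoment 4 / (c / (N + 1)) ^ 4) :=
        Finset.sum_le_sum fun i _ => hB.measure_exists_lt_le i hc' h
    _ = _ := by
        rw [Finset.sum_const, Finset.card_univ, Fintype.card_fin, nsmul_eq_mul,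
          ENNReal.ofReal_mul (by positivity), ENNReal.ofReal_natCast]

end Brownian

/-! ### Short-time expansion of the Langevin semigroup -/

section ShortTime

open Filter Topology Set
open scoped RealInnerProductSpace

variable {N : ℕ} {φ V : EuclideanSpace ℝ (Fin N) → ℝ}

lemma hasDerivAt_comp_segment (hφ : ContDiff ℝ (⊤ : ℕ∞) φ) (x v : EuclideanSpace ℝ (Fin N))
    (s : ℝ) : HasDerivAt (fun s : ℝ => φ (x + s • v)) (∑ i, v i * pderiv i φ (x + s • v)) s := by
  rw [← fderiv_apply_eq_sum]
  have h1 : HasDerivAt (fun s : ℝ => x + s • v) v s := by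
    simpa using ((hasDerivAt_id s).smul_const v).const_add x
  exact (hφ.differentiable (by norm_num) _).hasFDerivAt.comp_hasDerivAt s h1

lemma abs_coord_le_norm (v : EuclideanSpace ℝ (Fin N)) (i : Fin N) : |v i| ≤ ‖v‖ :=
  PiLp.norm_apply_le v i

lemma exists_lipschitz_bound (hφ : ContDiff ℝ (⊤ : ℕ∞) φ) (hφs : HasCompactSupport φ) :
    ∃ K, 0 ≤ K ∧ ∀ x y, |φ x - φ y| ≤ K * ‖x - y‖ := by
  obtain ⟨K, hK⟩ := hφ.lipschitzWith_of_hasCompactSupport hφs (by norm_num)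
  exact ⟨K, K.2, fun x y => hK.norm_sub_le x y⟩

lemma exists_taylor_bound_one (hφ : ContDiff ℝ (⊤ : ℕ∞) φ) (hφs : HasCompactSupport φ) :
    ∃ K, 0 ≤ K ∧ ∀ x v, |φ (x + v) - φ x - ∑ i, v i * pderiv i φ x| ≤ K * ‖v‖ ^ 2 := by
  choose L hL0 hL using fun i => exists_lipschitz_bound (contDiff_pderiv hφ i) (hφs.pderiv i)
  refine ⟨∑ i, L i, Finset.sum_nonneg fun i _ => hL0 i, fun x v => ?_⟩
  have hd : ∀ s : ℝ, HasDerivAt (fun s : ℝ => φ (x + s • v) - s * ∑ i, v i * pderiv i φ x)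
      (∑ i, v i * pderiv i φ (x + s • v) - ∑ i, v i * pderiv i φ x) s := fun s =>
    (hasDerivAt_comp_segment hφ x v s).sub (by simpa using (hasDerivAt_id s).mul_const _)
  have h1 := norm_image_sub_le_of_norm_deriv_le_segment_01' (C := (∑ i, L i) * ‖v‖ ^ 2)
    (fun s _ => (hd s).hasDerivWithinAt) (fun s hs => ?_)
  · simp only [one_smul, one_mul, zero_smul, add_zero, zero_mul, sub_zero, Real.norm_eq_abs] at h1
    convert h1 using 2
    ring
  · rw [← Finset.sum_sub_distrib, Finset.sum_mul]
    refine (norm_sum_le _ _).trans (Finset.sum_le_sum fun i _ => ?_)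
    rw [← mul_sub, norm_mul, Real.norm_eq_abs, Real.norm_eq_abs]
    have h2 := hL i (x + s • v) x
    rw [add_sub_cancel_left, norm_smul, Real.norm_of_nonneg hs.1] at h2
    have h3 : L i * (s * ‖v‖) ≤ L i * ‖v‖ :=
      mul_le_mul_of_nonneg_left (mul_le_of_le_one_left (norm_nonneg _) hs.2.le) (hL0 i)
    calc |v i| * |pderiv i φ (x + s • v) - pderiv i φ x| ≤ ‖v‖ * (L i * ‖v‖) :=
          mul_le_mul (abs_coord_le_norm v i) (h2.trans h3) (abs_nonneg _) (norm_nonneg _)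
      _ = L i * ‖v‖ ^ 2 := by ring

/-- Along the segment, the derivative of the second-order remainder is a combination of first-order
remainders of the partial derivatives, to which `exists_taylor_bound_one` applies. The constant is
uniform in x because φ has compact support. -/
lemma exists_taylor_bound_two (hφ : ContDiff ℝ (⊤ : ℕ∞) φ) (hφs : HasCompactSupport φ) :
    ∃ K, 0 ≤ K ∧ ∀ x v, |φ (x + v) - φ x - ∑ i, v i * pderiv i φ x -
      1 / 2 * ∑ i, ∑ j, v i * v j * pderiv j (pderiv i φ) x| ≤ K * ‖v‖ ^ 3 := by
  choose L hL0 hL using fun i => exists_taylor_bound_one (contDiff_pderiv hφ i) (hφs.pderiv i)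
  refine ⟨∑ i, L i, Finset.sum_nonneg fun i _ => hL0 i, fun x v => ?_⟩
  have hd : ∀ s : ℝ, HasDerivAt (fun s : ℝ => φ (x + s • v) - s * ∑ i, v i * pderiv i φ x -
      s ^ 2 * (1 / 2 * ∑ i, ∑ j, v i * v j * pderiv j (pderiv i φ) x))
      (∑ i, v i * pderiv i φ (x + s • v) - ∑ i, v i * pderiv i φ x -
        2 * s * (1 / 2 * ∑ i, ∑ j, v i * v j * pderiv j (pderiv i φ) x)) s := fun s =>
    ((hasDerivAt_comp_segment hφ x v s).sub (by simpa using (hasDerivAt_id s).mul_const _)).sub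
      (by simpa using (hasDerivAt_pow 2 s).mul_const _)
  have h1 := norm_image_sub_le_of_norm_deriv_le_segment_01' (C := (∑ i, L i) * ‖v‖ ^ 3)
    (fun s _ => (hd s).hasDerivWithinAt) (fun s hs => ?_)
  · simp only [one_smul, one_mul, one_pow, zero_smul, add_zero, zero_mul, sub_zero,
      Real.norm_eq_abs, ne_eq, OfNat.ofNat_ne_zero, not_false_eq_true, zero_pow] at h1
    convert h1 using 2
    ring
  · have h2 : ∑ i, v i * pderiv i φ (x + s • v) - ∑ i, v i * pderiv i φ x -
        2 * s * (1 / 2 * ∑ i, ∑ j, v i * v j * pderiv j (pderiv i φ) x) =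
        ∑ i, v i * (pderiv i φ (x + s • v) - pderiv i φ x -
          ∑ j, (s • v) j * pderiv j (pderiv i φ) x) := by
      simp only [mul_sub, Finset.sum_sub_distrib, Finset.mul_sum, PiLp.smul_apply, smul_eq_mul]
      congr 1
      refine Finset.sum_congr rfl fun i _ => Finset.sum_congr rfl fun j _ => by ring
    rw [h2, Finset.sum_mul]
    refine (norm_sum_le _ _).trans (Finset.sum_le_sum fun i _ => ?_)
    rw [norm_mul, Real.norm_eq_abs, Real.norm_eq_abs]
    have h3 := hL i x (s • v)
    rw [norm_smul, Real.norm_of_nonneg hs.1] at h3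
    have h4 : L i * (s * ‖v‖) ^ 2 ≤ L i * ‖v‖ ^ 2 :=
      mul_le_mul_of_nonneg_left (pow_le_pow_left₀ (mul_nonneg hs.1 (norm_nonneg _))
        (mul_le_of_le_one_left (norm_nonneg _) hs.2.le) 2) (hL0 i)
    calc _ ≤ ‖v‖ * (L i * ‖v‖ ^ 2) :=
          mul_le_mul (abs_coord_le_norm v i) (h3.trans h4) (abs_nonneg _) (norm_nonneg _)
      _ = L i * ‖v‖ ^ 3 := by ring

lemma norm_add_smul_pow_three_le (b w : EuclideanSpace ℝ (Fin N)) {h β : ℝ} (h0 : 0 ≤ h)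
    (hb : ‖b‖ ≤ β) :
    ‖h • b + √2 • w‖ ^ 3 ≤ 4 * (h * β) ^ 3 + 16 * ((N : ℝ) ^ 2 * ∑ i, |w i| ^ 3) := by
  have h1 : ‖h • b + √2 • w‖ ≤ h * β + √2 * ‖w‖ := by
    refine (norm_add_le _ _).trans ?_
    rw [norm_smul, norm_smul, Real.norm_of_nonneg h0, Real.norm_of_nonneg (Real.sqrt_nonneg 2)]
    gcongr
  have h2 : ‖w‖ ^ 3 ≤ (N : ℝ) ^ 2 * ∑ i, |w i| ^ 3 := by
    refine (pow_le_pow_left₀ (norm_nonneg _) (EuclideanSpace.norm_le_sum_abs w) 3).trans ?_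
    simpa using pow_sum_le_card_mul_sum_pow (s := Finset.univ) (f := fun i => |w i|)
      (fun i _ => abs_nonneg _) 2
  have hβ : 0 ≤ h * β := mul_nonneg h0 ((norm_nonneg _).trans hb)
  have hw : 0 ≤ √2 * ‖w‖ := by positivity
  have h3 : (h * β + √2 * ‖w‖) ^ 3 ≤ 4 * ((h * β) ^ 3 + (√2 * ‖w‖) ^ 3) := by
    nlinarith [mul_nonneg (add_nonneg hβ hw) (sq_nonneg (h * β - √2 * ‖w‖))]
  have h4 : (√2 * ‖w‖) ^ 3 ≤ 4 * ‖w‖ ^ 3 := by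
    rw [mul_pow]
    gcongr
    have h5 : √2 ^ 2 = 2 := Real.sq_sqrt (by norm_num)
    have h6 : √2 ≤ 2 := by rw [Real.sqrt_le_left (by norm_num)]; norm_num
    calc √2 ^ 3 = √2 ^ 2 * √2 := by ring
      _ ≤ 4 := by rw [h5]; linarith
  calc ‖h • b + √2 • w‖ ^ 3 ≤ (h * β + √2 * ‖w‖) ^ 3 := by gcongr
    _ ≤ _ := by linarith

lemma integral_affine {Ω : Type*} {mΩ : MeasurableSpace Ω} {P : Measure Ω} [IsProbabilityMeasure P]
    {X Y Z : Ω → ℝ} (hX : Integrable X P) (hY : Integrable Y P) (hZ : Integrable Z P)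
    (a b c d : ℝ) : ∫ ω, (a + b * X ω + c * Y ω + d * Z ω) ∂P =
      a + b * ∫ ω, X ω ∂P + c * ∫ ω, Y ω ∂P + d * ∫ ω, Z ω ∂P := by
  have h1 : Integrable (fun ω => a + b * X ω) P := (integrable_const a).add (hX.const_mul b)
  have h2 : Integrable (fun ω => a + b * X ω + c * Y ω) P := h1.add (hY.const_mul c)
  rw [integral_add h2 (hZ.const_mul d), integral_add h1 (hY.const_mul c),
    integral_add (integrable_const a) (hX.const_mul b), integral_const_mul b,
    integral_const_mul c, integral_const_mul d]
  simp

/-- Expansion of the expectation of a test function along a Brownian motion with drift. -/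
lemma exists_brownian_expansion (hφ : ContDiff ℝ (⊤ : ℕ∞) φ) (hφs : HasCompactSupport φ) (β : ℝ) :
    ∃ K, 0 ≤ K ∧ ∀ {Ω : Type} {mΩ : MeasurableSpace Ω} {ℱ : Filtration ℝ≥0 mΩ} {P : Measure Ω}
      [IsProbabilityMeasure P] {B : ℝ≥0 → Ω → EuclideanSpace ℝ (Fin N)},
      IsStandardBrownian ℱ P B → ∀ (x b : EuclideanSpace ℝ (Fin N)), ‖b‖ ≤ β → ∀ h : ℝ≥0, h ≤ 1 →
      |∫ ω, φ (x + ((h : ℝ) • b + √2 • B h ω)) ∂P - φ x -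
        h * ∑ i, (pderiv i (pderiv i φ) x + b i * pderiv i φ x)| ≤ K * √h ^ 3 := by
  obtain ⟨K, hK0, hK⟩ := exists_taylor_bound_two hφ hφs
  choose A hA using fun i j => exists_abs_le_of_hasCompactSupport
    (contDiff_pderiv (contDiff_pderiv hφ i) j).continuous ((hφs.pderiv i).pderiv j)
  have hA0 : ∀ i j, 0 ≤ A i j := fun i j => (abs_nonneg _).trans (hA i j 0)
  have hM := gaussianAbsMoment_nonneg 3
  set β' := max β 0 with hβ'
  have hβ0 : 0 ≤ β' := le_max_right _ _
  -- The first summand bounds the Taylor remainder through the third moment of the displacement, of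
  -- order h^{3/2}; the second bounds the drift–drift part ½h² Σ b_i b_j ∂_j∂_i φ. For h ≤ 1 both
  -- are at most a multiple of h^{3/2}.
  refine ⟨K * (4 * β' ^ 3 + 16 * ((N : ℝ) ^ 2 * ∑ _i : Fin N, gaussianAbsMoment 3)) +
    1 / 2 * (∑ i, ∑ j, β' * β' * A i j), ?_, ?_⟩
  · have : 0 ≤ ∑ i, ∑ j, β' * β' * A i j := Finset.sum_nonneg fun i _ => Finset.sum_nonneg
      fun j _ => mul_nonneg (mul_nonneg hβ0 hβ0) (hA0 i j)
    have : 0 ≤ ∑ _i : Fin N, gaussianAbsMoment 3 := Finset.sum_nonneg fun i _ => hM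
    positivity
  intro Ω mΩ ℱ P _ B hB x b hb h hh
  replace hb : ‖b‖ ≤ β' := hb.trans (le_max_left _ _)
  set v : Ω → EuclideanSpace ℝ (Fin N) := fun ω => (h : ℝ) • b + √2 • B h ω with hv
  have hvi : ∀ ω i, v ω i = h * b i + √2 * B h ω i := fun ω i => by simp [hv]
  have hBm : Measurable (B h) := (hB.adapted h).mono (ℱ.le h) le_rfl
  have hvm : Measurable v := by simp only [hv]; fun_prop
  have hBi : ∀ i, Integrable (fun ω => B h ω i) P := fun i => (hB.coord i).integrable_eval h
  have hBij : ∀ i j, Integrable (fun ω => B h ω i * B h ω j) P := fun i j =>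
    (hB.memLp h i).integrable_mul (hB.memLp h j)
  have hI1 : ∀ i, Integrable (fun ω => v ω i) P := fun i => by
    simp only [hvi]
    exact (integrable_const _).add ((hBi i).const_mul _)
  have hE1 : ∀ i, ∫ ω, v ω i ∂P = h * b i := fun i => by
    simp only [hvi]
    rw [integral_add (integrable_const _) ((hBi i).const_mul _), integral_const_mul √2,
      hB.integral_coord]
    simp
  have hvij : ∀ ω i j, v ω i * v ω j = h * b i * (h * b j) + (h * b i * √2) * B h ω j +
      (h * b j * √2) * B h ω i + 2 * (B h ω i * B h ω j) := fun ω i j => by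
    rw [hvi, hvi]
    have : √(2 : ℝ) * √2 = 2 := Real.mul_self_sqrt (by norm_num)
    linear_combination (B h ω i * B h ω j) * this
  have hI2 : ∀ i j, Integrable (fun ω => v ω i * v ω j) P := fun i j => by
    simp only [hvij]
    exact (((integrable_const _).add ((hBi j).const_mul _)).add ((hBi i).const_mul _)).add
      ((hBij i j).const_mul _)
  have hE2 : ∀ i j, ∫ ω, v ω i * v ω j ∂P = h * b i * (h * b j) +
      2 * (if i = j then (h : ℝ) else 0) := fun i j => by
    simp only [hvij]
    rw [integral_affine (hBi j) (hBi i) (hBij i j), hB.integral_coord, hB.integral_coord,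
      hB.integral_mul]
    ring
  obtain ⟨S, hS⟩ := exists_abs_le_of_hasCompactSupport hφ.continuous hφs
  have hIφ : Integrable (fun ω => φ (x + v ω)) P :=
    Integrable.of_bound (hφ.continuous.measurable.comp (by fun_prop)).aestronglyMeasurable S
      (ae_of_all _ fun ω => hS _)
  have hIs1 : Integrable (fun ω => ∑ i, v ω i * pderiv i φ x) P :=
    integrable_finsetSum _ fun i _ => (hI1 i).mul_const _
  have hIs2 : Integrable (fun ω => ∑ i, ∑ j, v ω i * v ω j * pderiv j (pderiv i φ) x) P :=
    integrable_finsetSum _ fun i _ => integrable_finsetSum _ fun j _ => (hI2 i j).mul_const _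
  have hint : ∫ ω, (φ (x + v ω) - φ x - ∑ i, v ω i * pderiv i φ x -
      1 / 2 * ∑ i, ∑ j, v ω i * v ω j * pderiv j (pderiv i φ) x) ∂P =
      ∫ ω, φ (x + v ω) ∂P - φ x - h * ∑ i, (pderiv i (pderiv i φ) x + b i * pderiv i φ x) -
      1 / 2 * ∑ i, ∑ j, (h : ℝ) * b i * (h * b j) * pderiv j (pderiv i φ) x := by
    have h0 : ∀ ω, φ (x + v ω) - φ x - ∑ i, v ω i * pderiv i φ x -
        1 / 2 * ∑ i, ∑ j, v ω i * v ω j * pderiv j (pderiv i φ) x =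
        -φ x + 1 * φ (x + v ω) + (-1) * ∑ i, v ω i * pderiv i φ x +
        (-1 / 2) * ∑ i, ∑ j, v ω i * v ω j * pderiv j (pderiv i φ) x := fun ω => by ring
    rw [integral_congr_ae (ae_of_all _ h0), integral_affine hIφ hIs1 hIs2, integral_finsetSum _ fun i _ => (hI1 i).mul_const _,
      integral_finsetSum _ fun i _ => integrable_finsetSum _ fun j _ => (hI2 i j).mul_const _]
    simp_rw [fun i => integral_finsetSum (μ := P) Finset.univ (fun (j : Fin N) _ =>
      (hI2 i j).mul_const (pderiv j (pderiv i φ) x)), integral_mul_const, hE1, hE2]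
    have h1 : ∀ i, ∑ j, ((h : ℝ) * b i * (h * b j) + 2 * (if i = j then (h : ℝ) else 0)) *
        pderiv j (pderiv i φ) x = ∑ j, (h : ℝ) * b i * (h * b j) * pderiv j (pderiv i φ) x +
        2 * h * pderiv i (pderiv i φ) x := by
      intro i
      simp only [add_mul, Finset.sum_add_distrib]
      congr 1
      rw [Finset.sum_eq_single i]
      · simp
      · intro j _ hj
        simp [hj.symm]
      · simp
    simp_rw [h1]
    simp only [Finset.sum_add_distrib]
    rw [← Finset.mul_sum]
    simp only [mul_assoc]
    rw [← Finset.mul_sum]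
    ring
  have hs0 : (0 : ℝ) ≤ √h := Real.sqrt_nonneg _
  have hs1 : √(h : ℝ) ≤ 1 := by
    rw [Real.sqrt_le_left (by norm_num)]; simpa using hh
  have hss : (h : ℝ) = √h ^ 2 := (Real.sq_sqrt h.coe_nonneg).symm
  have hbound : |∫ ω, (φ (x + v ω) - φ x - ∑ i, v ω i * pderiv i φ x -
      1 / 2 * ∑ i, ∑ j, v ω i * v ω j * pderiv j (pderiv i φ) x) ∂P| ≤
      K * (4 * β' ^ 3 + 16 * ((N : ℝ) ^ 2 * ∑ _i : Fin N, gaussianAbsMoment 3)) * √h ^ 3 := by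
    have hIb : Integrable (fun ω => K * (4 * (h * β') ^ 3 + 16 * ((N : ℝ) ^ 2 *
        ∑ i, |B h ω i| ^ 3))) P :=
      ((integrable_const _).add (((integrable_finsetSum _ fun i _ =>
        hB.integrable_abs_pow 3 h i).const_mul _).const_mul _)).const_mul _
    rw [← Real.norm_eq_abs]
    refine (norm_integral_le_of_norm_le hIb (ae_of_all _ fun ω => ?_)).trans ?_
    · exact (hK x (v ω)).trans (mul_le_mul_of_nonneg_left
        (norm_add_smul_pow_three_le b (B h ω) h.coe_nonneg hb) hK0)
    · rw [integral_const_mul K, integral_add (integrable_const _) (((integrable_finsetSum _ fun i _ =>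
        hB.integrable_abs_pow 3 h i).const_mul _).const_mul _), integral_const_mul (16 : ℝ),
        integral_const_mul ((N : ℝ) ^ 2), integral_finsetSum _ fun i _ => hB.integrable_abs_pow 3 h i]
      simp_rw [hB.integral_abs_pow 3 h]
      rw [← Finset.mul_sum, integral_const, probReal_univ, one_smul, mul_assoc]
      refine mul_le_mul_of_nonneg_left ?_ hK0
      have h3 : ((h : ℝ) * β') ^ 3 ≤ β' ^ 3 * √h ^ 3 := by
        rw [mul_pow, mul_comm]
        refine mul_le_mul_of_nonneg_left (pow_le_pow_left₀ h.coe_nonneg ?_ 3) (by positivity)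
        calc (h : ℝ) = √h * √h := by rw [← sq]; exact hss
          _ ≤ √h := mul_le_of_le_one_left hs0 hs1
      nlinarith
  have hrest : |1 / 2 * ∑ i, ∑ j, (h : ℝ) * b i * (h * b j) * pderiv j (pderiv i φ) x| ≤
      1 / 2 * (∑ i, ∑ j, β' * β' * A i j) * √h ^ 3 := by
    rw [abs_mul, abs_of_pos (by norm_num : (0 : ℝ) < 1 / 2), mul_assoc]
    refine mul_le_mul_of_nonneg_left ?_ (by norm_num)
    rw [Finset.sum_mul]
    refine (Finset.abs_sum_le_sum_abs _ _).trans (Finset.sum_le_sum fun i _ => ?_)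
    rw [Finset.sum_mul]
    refine (Finset.abs_sum_le_sum_abs _ _).trans (Finset.sum_le_sum fun j _ => ?_)
    have h4 : |b i| ≤ β' := (abs_coord_le_norm b i).trans hb
    have h5 : |b j| ≤ β' := (abs_coord_le_norm b j).trans hb
    have h6 : (h : ℝ) * h ≤ √h ^ 3 := by
      calc (h : ℝ) * h = √h ^ 3 * √h := by nth_rewrite 1 2 [hss]; ring
        _ ≤ √h ^ 3 := mul_le_of_le_one_right (by positivity) hs1
    calc |(h : ℝ) * b i * (h * b j) * pderiv j (pderiv i φ) x|
        = (|b i| * |b j| * |pderiv j (pderiv i φ) x|) * (h * h) := by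
          simp only [abs_mul, abs_of_nonneg h.coe_nonneg]; ring
      _ ≤ (β' * β' * A i j) * √h ^ 3 := by
          have := hA i j x
          have := hA0 i j
          gcongr
  rw [hint] at hbound
  have := abs_add_le (∫ ω, φ (x + v ω) ∂P - φ x -
    h * ∑ i, (pderiv i (pderiv i φ) x + b i * pderiv i φ x) -
      1 / 2 * ∑ i, ∑ j, (h : ℝ) * b i * (h * b j) * pderiv j (pderiv i φ) x)
    (1 / 2 * ∑ i, ∑ j, (h : ℝ) * b i * (h * b j) * pderiv j (pderiv i φ) x)
  rw [sub_add_cancel] at this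
  rw [add_mul]
  linarith

end ShortTime

/-! ### The Langevin semigroup at short times -/

section ShortTimeLangevin

open Filter Topology Set

variable {N : ℕ} {φ V : EuclideanSpace ℝ (Fin N) → ℝ}

/-! ### Pathwise comparison with one Euler step. -/

section Path

variable {z β : ℝ≥0 → EuclideanSpace ℝ (Fin N)}
  {F : EuclideanSpace ℝ (Fin N) → EuclideanSpace ℝ (Fin N)} {x : EuclideanSpace ℝ (Fin N)} {D : ℝ}
  {h : ℝ≥0}

/-- First-exit argument: up to the first time s at which the path reaches distance 1 from x, the
drift is bounded by D, so the displacement at s is at most 1/4 + 1/2 < 1, a contradiction. This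
localises the drift without any growth assumption. -/
lemma norm_sub_le_one_of_integral_eq (hz : Continuous z)
    (hD : ∀ y, ‖y - x‖ ≤ 1 → ‖F y‖ ≤ D)
    (heq : ∀ t : ℝ≥0, z t = x - (∫ s in (0 : ℝ)..t, F (z s.toNNReal)) + β t)
    (hβ : ∀ t ≤ h, ‖β t‖ ≤ 1 / 2) (hDh : D * h ≤ 1 / 4) {t : ℝ≥0} (ht : t ≤ h) :
    ‖z t - x‖ ≤ 1 := by
  by_contra! hlt
  have hD0 : 0 ≤ D := (norm_nonneg _).trans (hD x (by simp))
  have hcl : IsClosed {s | 1 ≤ ‖z s - x‖} :=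
    isClosed_le continuous_const (hz.sub continuous_const).norm
  obtain ⟨s, ⟨⟨-, hst⟩, hs1⟩, hmin⟩ := (isCompact_Icc.inter_right hcl :
    IsCompact (Icc (0 : ℝ≥0) t ∩ {s | 1 ≤ ‖z s - x‖})).exists_isLeast
      ⟨t, ⟨by simp, hlt.le⟩⟩
  -- Minimality of s controls times before s only; the endpoint is discarded as a null set.
  have hbd : ∀ᵐ r : ℝ, r ∈ uIoc (0 : ℝ) s → ‖F (z r.toNNReal)‖ ≤ D := by
    filter_upwards [(measure_singleton (μ := volume) (s : ℝ) : volume {(s : ℝ)} = 0) |>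
      compl_mem_ae_iff.2] with r hr hrs
    rw [uIoc_of_le s.coe_nonneg] at hrs
    refine hD _ ?_
    by_contra! h1
    have h2 : r.toNNReal ≤ s := Real.toNNReal_le_iff_le_coe.2 hrs.2
    have h3 := hmin ⟨⟨zero_le, h2.trans hst⟩, h1.le⟩
    have h4 : (s : ℝ) ≤ r := (Real.le_toNNReal_iff_coe_le hrs.1.le).1 h3
    exact hr (le_antisymm hrs.2 h4)
  have h1 := intervalIntegral.norm_integral_le_of_norm_le_const_ae hbd
  rw [sub_zero, abs_of_nonneg s.coe_nonneg] at h1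
  have h2 : D * s ≤ 1 / 4 := (mul_le_mul_of_nonneg_left
    (by exact_mod_cast hst.trans ht) hD0).trans hDh
  have h3 : ‖z s - x‖ ≤ 1 / 4 + 1 / 2 := by
    rw [heq s]
    calc ‖x - (∫ r in (0 : ℝ)..s, F (z r.toNNReal)) + β s - x‖
        = ‖-(∫ r in (0 : ℝ)..s, F (z r.toNNReal)) + β s‖ := by congr 1; abel
      _ ≤ _ := (norm_add_le _ _).trans (add_le_add (by rw [norm_neg]; linarith)
          (hβ s (hst.trans ht)))
  have h5 : 1 ≤ ‖z s - x‖ := hs1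
  linarith

lemma sub_euler_eq_integral (hz : Continuous z) (hF : Continuous F)
    (heq : ∀ t : ℝ≥0, z t = x - (∫ s in (0 : ℝ)..t, F (z s.toNNReal)) + β t) :
    z h - (x + ((h : ℝ) • (-F x) + β h)) = ∫ s in (0 : ℝ)..h, (F x - F (z s.toNNReal)) := by
  have hi : IntervalIntegrable (fun s : ℝ => F (z s.toNNReal)) volume 0 h :=
    (hF.comp (hz.comp continuous_real_toNNReal)).intervalIntegrable _ _
  rw [intervalIntegral.integral_sub intervalIntegrable_const hi, heq h]
  simp only [intervalIntegral.integral_const, sub_zero, smul_neg]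
  abel

lemma norm_sub_euler_le (hz : Continuous z) (hF : Continuous F)
    (hD : ∀ y, ‖y - x‖ ≤ 1 → ‖F y‖ ≤ D)
    (heq : ∀ t : ℝ≥0, z t = x - (∫ s in (0 : ℝ)..t, F (z s.toNNReal)) + β t)
    (hβ : ∀ t ≤ h, ‖β t‖ ≤ 1 / 2) (hDh : D * h ≤ 1 / 4) :
    ‖z h - (x + ((h : ℝ) • (-F x) + β h))‖ ≤ 2 * D * h := by
  rw [sub_euler_eq_integral hz hF heq]
  have h1 := intervalIntegral.norm_integral_le_of_norm_le_const (a := 0) (b := (h : ℝ)) (C := 2 * D)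
    (f := fun s : ℝ => F x - F (z s.toNNReal)) (fun s hs => ?_)
  · rwa [sub_zero, abs_of_nonneg h.coe_nonneg] at h1
  · rw [uIoc_of_le h.coe_nonneg] at hs
    have h2 := norm_sub_le_one_of_integral_eq hz hD heq hβ hDh
      (Real.toNNReal_le_iff_le_coe.2 hs.2 : s.toNNReal ≤ h)
    calc _ ≤ ‖F x‖ + ‖F (z s.toNNReal)‖ := norm_sub_le _ _
      _ ≤ D + D := add_le_add (hD x (by simp)) (hD _ h2)
      _ = 2 * D := by ring

/-- The continuous drift gives an o(h) error without a rate, by differentiating the integral at 0.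
The uniform bound 2Dh of `norm_sub_euler_le` supplies the domination needed to take expectations. -/
lemma tendsto_norm_sub_euler_div (hz : Continuous z) (hF : Continuous F) (hz0 : z 0 = x)
    (heq : ∀ t : ℝ≥0, z t = x - (∫ s in (0 : ℝ)..t, F (z s.toNNReal)) + β t) :
    Tendsto (fun h : ℝ≥0 => ‖z h - (x + ((h : ℝ) • (-F x) + β h))‖ / h) (𝓝[>] 0) (𝓝 0) := by
  have hc : Continuous fun s : ℝ => F x - F (z s.toNNReal) :=
    continuous_const.sub (hF.comp (hz.comp continuous_real_toNNReal))
  have h1 := (hc.integral_hasStrictDerivAt 0 0).hasDerivAt.tendsto_slope_zero_right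
  simp only [zero_add, intervalIntegral.integral_same, sub_zero, Real.toNNReal_zero, hz0,
    sub_self] at h1
  have h2 : Tendsto (fun h : ℝ≥0 => (h : ℝ)) (𝓝[>] 0) (𝓝[>] 0) := by
    refine tendsto_nhdsWithin_iff.2 ⟨?_, ?_⟩
    · exact (NNReal.continuous_coe.tendsto' 0 0 rfl).mono_left nhdsWithin_le_nhds
    · filter_upwards [self_mem_nhdsWithin] with h hh using NNReal.coe_pos.2 hh
  have h3 := (h1.comp h2).norm
  rw [norm_zero] at h3
  refine h3.congr fun h => ?_
  rw [sub_euler_eq_integral hz hF heq, Function.comp_apply, norm_smul, norm_inv,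
    Real.norm_of_nonneg h.coe_nonneg, div_eq_inv_mul]

end Path

namespace IsLangevinSolution

variable {Ω : Type*} {mΩ : MeasurableSpace Ω} {ℱ : Filtration ℝ≥0 mΩ} {P : Measure Ω}
  {B Z : ℝ≥0 → Ω → EuclideanSpace ℝ (Fin N)} {x : EuclideanSpace ℝ (Fin N)}

lemma measurable (S : IsLangevinSolution V ℱ P B Z) (t : ℝ≥0) : Measurable (Z t) :=
  (S.adapted t).mono (ℱ.le t) le_rfl

lemma measurable_brownian (S : IsLangevinSolution V ℱ P B Z) (t : ℝ≥0) : Measurable (B t) :=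
  (S.brownian.adapted t).mono (ℱ.le t) le_rfl

lemma ae_equation (S : IsLangevinSolution V ℱ P B Z) (h0 : ∀ᵐ ω ∂P, Z 0 ω = x) :
    ∀ᵐ ω ∂P, Z 0 ω = x ∧ ∀ t : ℝ≥0,
      Z t ω = x - (∫ s in (0 : ℝ)..t, gradient V (Z s.toNNReal ω)) + √2 • B t ω := by
  filter_upwards [S.equation, h0] with ω h1 h2
  exact ⟨h2, fun t => h2 ▸ h1 t⟩

/-- While the Brownian path stays within 1/4 up to time h, the Euler comparison applies, since √2/4
≤ 1/2, and the Lipschitz bound gives the minimum. On the complement, of probability O(h²), the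
difference is at most 2A. -/
lemma abs_integral_sub_le [IsProbabilityMeasure P] (S : IsLangevinSolution V ℱ P B Z)
    (h0 : ∀ᵐ ω ∂P, Z 0 ω = x) (hV : ContDiff ℝ 1 V) (hφc : Continuous φ) {Λ A D : ℝ}
    (hΛ0 : 0 ≤ Λ) (hΛ : ∀ x y, |φ x - φ y| ≤ Λ * ‖x - y‖) (hA : ∀ x, |φ x| ≤ A)
    (hD : ∀ y, ‖y - x‖ ≤ 1 → ‖gradient V y‖ ≤ D) {h : ℝ≥0} (hDh : D * h ≤ 1 / 4) :
    |∫ ω, φ (Z h ω) ∂P - ∫ ω, φ (x + ((h : ℝ) • (-gradient V x) + √2 • B h ω)) ∂P| ≤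
      ∫ ω, min (Λ * ‖Z h ω - (x + ((h : ℝ) • (-gradient V x) + √2 • B h ω))‖) (Λ * (2 * D * h)) ∂P
      + 2 * A * (N * ((h : ℝ) ^ 2 * gaussianAbsMoment 4 / (1 / 4 / (N + 1)) ^ 4)) := by
  have hZ := S.measurable h
  have hB := S.measurable_brownian h
  have hA0 : 0 ≤ A := (abs_nonneg _).trans (hA 0)
  have hD0 : 0 ≤ D := (norm_nonneg _).trans (hD x (by simp))
  -- The exceptional event involves uncountably many times, so it is replaced by a measurable hull
  -- of the same measure.
  set G := toMeasurable P {ω | ∃ r ≤ h, 1 / 4 < ‖B r ω‖} with hG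
  have hGm : MeasurableSet G := measurableSet_toMeasurable _ _
  have hGP : P.real G ≤ N * ((h : ℝ) ^ 2 * gaussianAbsMoment 4 / (1 / 4 / (N + 1)) ^ 4) := by
    have h1 := S.brownian.measure_exists_lt_norm_le (by norm_num : (0 : ℝ) < 1 / 4) h
    rw [← measure_toMeasurable] at h1
    refine ENNReal.toReal_le_of_le_ofReal ?_ h1
    have := gaussianAbsMoment_nonneg 4
    positivity
  have hI1 : Integrable (fun ω => φ (Z h ω)) P :=
    Integrable.of_bound (hφc.measurable.comp hZ).aestronglyMeasurable A (ae_of_all _ fun ω => hA _)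
  have hI2 : Integrable (fun ω => φ (x + ((h : ℝ) • (-gradient V x) + √2 • B h ω))) P :=
    Integrable.of_bound (hφc.measurable.comp (by fun_prop)).aestronglyMeasurable A
      (ae_of_all _ fun ω => hA _)
  have hI3 : Integrable (fun ω => min (Λ * ‖Z h ω - (x + ((h : ℝ) • (-gradient V x) +
      √2 • B h ω))‖) (Λ * (2 * D * h))) P := by
    refine Integrable.of_bound (Measurable.aestronglyMeasurable (by fun_prop)) (Λ * (2 * D * h))
      (ae_of_all _ fun ω => ?_)
    rw [Real.norm_of_nonneg (by positivity)]
    exact min_le_right _ _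
  have hI4 : Integrable (G.indicator fun _ => 2 * A) P := (integrable_const _).indicator hGm
  rw [← integral_sub hI1 hI2, ← Real.norm_eq_abs]
  refine (norm_integral_le_of_norm_le (hI3.add hI4) ?_).trans ?_
  · filter_upwards [S.ae_equation h0] with ω hω
    rw [Pi.add_apply, Real.norm_eq_abs]
    by_cases hωG : ω ∈ G
    · rw [indicator_of_mem hωG]
      have h1 := (abs_sub (φ (Z h ω)) (φ (x + ((h : ℝ) • (-gradient V x) + √2 • B h ω)))).trans
        (add_le_add (hA _) (hA _))
      have h2 : 0 ≤ min (Λ * ‖Z h ω - (x + ((h : ℝ) • (-gradient V x) +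
        √2 • B h ω))‖) (Λ * (2 * D * h)) := by positivity
      linarith
    · rw [indicator_of_notMem hωG, add_zero]
      refine le_min (hΛ _ _) ((hΛ _ _).trans (mul_le_mul_of_nonneg_left ?_ hΛ0))
      refine norm_sub_euler_le (z := fun t => Z t ω) (β := fun t => √2 • B t ω)
        (S.continuous_paths ω) (continuous_gradient hV) hD hω.2 (fun t ht => ?_) hDh
      have h1 : ¬ ∃ r ≤ h, 1 / 4 < ‖B r ω‖ := fun hc => hωG (subset_toMeasurable _ _ hc)
      push Not at h1
      rw [norm_smul, Real.norm_of_nonneg (Real.sqrt_nonneg 2)]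
      have h6 : √2 ≤ 2 := by rw [Real.sqrt_le_left (by norm_num)]; norm_num
      calc √2 * ‖B t ω‖ ≤ 2 * (1 / 4) := mul_le_mul h6 (h1 t ht) (norm_nonneg _) (by norm_num)
        _ = 1 / 2 := by norm_num
  · rw [integral_add' hI3 hI4, integral_indicator_const _ hGm, smul_eq_mul, mul_comm (P.real G)]
    gcongr

end IsLangevinSolution

lemma exists_norm_gradient_le (hV : ContDiff ℝ 1 V) (R : ℝ) :
    ∃ D, 0 ≤ D ∧ ∀ y, ‖y‖ ≤ R → ‖gradient V y‖ ≤ D := by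
  obtain ⟨D, hD⟩ := (isCompact_closedBall (0 : EuclideanSpace ℝ (Fin N)) R).exists_bound_of_continuousOn
    (continuous_gradient hV).continuousOn
  exact ⟨max D 0, le_max_right _ _, fun y hy => (hD y (by simpa using hy)).trans (le_max_left _ _)⟩

lemma langevinGen_eq_sum (x : EuclideanSpace ℝ (Fin N)) : langevinGen V φ x =
    ∑ i, (pderiv i (pderiv i φ) x + (-gradient V x) i * pderiv i φ x) := by
  refine Finset.sum_congr rfl fun i _ => ?_
  rw [PiLp.neg_apply, gradient_apply]
  ring

lemma tendsto_inv_mul_of_abs_le {u : ℝ≥0 → ℝ} {K : ℝ} (h : ∀ᶠ t in 𝓝[>] (0 : ℝ≥0), |u t| ≤ K * √t ^ 3) :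
    Tendsto (fun t : ℝ≥0 => (t : ℝ)⁻¹ * u t) (𝓝[>] 0) (𝓝 0) := by
  have h1 : Tendsto (fun t : ℝ≥0 => K * √(t : ℝ)) (𝓝[>] 0) (𝓝 0) :=
    ((by fun_prop : Continuous fun t : ℝ≥0 => K * √(t : ℝ)).tendsto' 0 0 (by simp)).mono_left
      nhdsWithin_le_nhds
  refine squeeze_zero_norm' ?_ h1
  filter_upwards [h, self_mem_nhdsWithin] with t ht ht0
  have ht0' : (0 : ℝ) < t := NNReal.coe_pos.2 ht0
  rw [norm_mul, norm_inv, Real.norm_eq_abs, Real.norm_eq_abs, abs_of_pos ht0', inv_mul_le_iff₀ ht0']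
  refine ht.trans_eq ?_
  have : √(t : ℝ) ^ 2 = t := Real.sq_sqrt ht0'.le
  linear_combination K * √(t : ℝ) * this

namespace IsLangevinDiffusion

variable {π : Measure (EuclideanSpace ℝ (Fin N))}
  {κ : ℝ≥0 → Kernel (EuclideanSpace ℝ (Fin N)) (EuclideanSpace ℝ (Fin N))}

/-- The transition operator moves a test function by `O(t)`, uniformly on balls. -/
lemma exists_abs_integral_sub_le (hκ : IsLangevinDiffusion V π κ) (hV : ContDiff ℝ 1 V)
    (hφ : ContDiff ℝ (⊤ : ℕ∞) φ) (hφs : HasCompactSupport φ) (R : ℝ) :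
    ∃ C, 0 ≤ C ∧ ∀ᶠ h : ℝ≥0 in 𝓝[>] 0, ∀ x, ‖x‖ ≤ R → |∫ y, φ y ∂κ h x - φ x| ≤ C * h := by
  obtain ⟨D, hD0, hD⟩ := exists_norm_gradient_le hV (R + 1)
  obtain ⟨Λ, hΛ0, hΛ⟩ := exists_lipschitz_bound hφ hφs
  obtain ⟨A, hA⟩ := exists_abs_le_of_hasCompactSupport hφ.continuous hφs
  obtain ⟨K, hK0, hK⟩ := exists_brownian_expansion hφ hφs D
  obtain ⟨G, hG⟩ := exists_abs_le_of_hasCompactSupport (continuous_langevinGen hV hφ)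
    (hasCompactSupport_langevinGen hφs)
  have hA0 : 0 ≤ A := (abs_nonneg _).trans (hA 0)
  have hG0 : 0 ≤ G := (abs_nonneg _).trans (hG 0)
  set Q : ℝ := N * (gaussianAbsMoment 4 / (1 / 4 / (N + 1)) ^ 4) with hQ
  have hQ0 : 0 ≤ Q := by
    have := gaussianAbsMoment_nonneg 4
    positivity
  refine ⟨Λ * (2 * D) + 2 * A * Q + K + G, by positivity, ?_⟩
  have hsmall : ∀ᶠ h : ℝ≥0 in 𝓝[>] 0, D * h < 1 / 4 :=
    nhdsWithin_le_nhds ((by fun_prop : Continuous fun h : ℝ≥0 => D * (h : ℝ)).tendsto' 0 0 (by simp)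
      |>.eventually_lt_const (by norm_num))
  have hone : ∀ᶠ h : ℝ≥0 in 𝓝[>] 0, h ≤ 1 :=
    nhdsWithin_le_nhds (eventually_le_nhds (by norm_num))
  filter_upwards [hsmall, hone] with h hDh h1 x hx
  obtain ⟨Ω, mΩ, ℱ, P, B, Z, hP, S, hZ0, hlaw⟩ := hκ.solution x
  have hint : ∫ y, φ y ∂κ h x = ∫ ω, φ (Z h ω) ∂P := by
    rw [← hlaw h, integral_map (S.measurable h).aemeasurable hφ.continuous.aestronglyMeasurable]
  have hDx : ∀ y, ‖y - x‖ ≤ 1 → ‖gradient V y‖ ≤ D := fun y hy => hD y (by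
    have := norm_add_le (y - x) x
    rw [sub_add_cancel] at this
    linarith)
  have e1 := S.abs_integral_sub_le hZ0 hV hφ.continuous hΛ0 hΛ hA hDx hDh.le
  have e2 := hK S.brownian x (-gradient V x) (by rw [norm_neg]; exact hDx x (by simp)) h h1
  rw [← langevinGen_eq_sum] at e2
  have e3 : ∫ ω, min (Λ * ‖Z h ω - (x + ((h : ℝ) • (-gradient V x) + √2 • B h ω))‖)
      (Λ * (2 * D * h)) ∂P ≤ Λ * (2 * D * h) := by
    refine (integral_mono_of_nonneg (ae_of_all _ fun ω => ?_) (integrable_const (Λ * (2 * D * h)))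
      (ae_of_all _ fun ω => min_le_right _ _)).trans_eq (by simp)
    simp only [Pi.zero_apply]
    positivity
  have hh0 : (0 : ℝ) ≤ h := h.coe_nonneg
  have hh1 : (h : ℝ) ≤ 1 := by exact_mod_cast h1
  have e4 : √(h : ℝ) ^ 3 ≤ h := by
    have h5 : √(h : ℝ) ≤ 1 := by rw [Real.sqrt_le_left (by norm_num)]; simpa using hh1
    calc √(h : ℝ) ^ 3 = √(h : ℝ) ^ 2 * √h := by ring
      _ = h * √h := by rw [Real.sq_sqrt hh0]
      _ ≤ h := mul_le_of_le_one_right hh0 h5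
  have e5 : N * ((h : ℝ) ^ 2 * gaussianAbsMoment 4 / (1 / 4 / (N + 1)) ^ 4) ≤ Q * h := by
    have : N * ((h : ℝ) ^ 2 * gaussianAbsMoment 4 / (1 / 4 / (N + 1)) ^ 4) = Q * h * h := by
      rw [hQ]; ring
    rw [this]
    exact mul_le_of_le_one_right (by positivity) hh1
  rw [hint]
  calc |∫ ω, φ (Z h ω) ∂P - φ x| = |(∫ ω, φ (Z h ω) ∂P -
        ∫ ω, φ (x + ((h : ℝ) • (-gradient V x) + √2 • B h ω)) ∂P) +
        (∫ ω, φ (x + ((h : ℝ) • (-gradient V x) + √2 • B h ω)) ∂P - φ x - h * langevinGen V φ x) +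
        h * langevinGen V φ x| := by congr 1; ring
    _ ≤ (Λ * (2 * D * h) + 2 * A * (Q * h)) + K * h + h * G := by
      refine (abs_add_three _ _ _).trans (add_le_add (add_le_add (e1.trans ?_) (e2.trans ?_)) ?_)
      · gcongr
      · gcongr
      · rw [abs_mul, abs_of_nonneg hh0]
        exact mul_le_mul_of_nonneg_left (hG x) hh0
    _ = _ := by ring

/-- The generator of the diffusion on test functions, pointwise. -/
lemma tendsto_integral_sub (hκ : IsLangevinDiffusion V π κ) (hV : ContDiff ℝ 1 V)
    (hφ : ContDiff ℝ (⊤ : ℕ∞) φ) (hφs : HasCompactSupport φ) (x : EuclideanSpace ℝ (Fin N)) :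
    Tendsto (fun h : ℝ≥0 => (h : ℝ)⁻¹ * (∫ y, φ y ∂κ h x - φ x)) (𝓝[>] 0)
      (𝓝 (langevinGen V φ x)) := by
  obtain ⟨D, hD0, hD⟩ := exists_norm_gradient_le hV (‖x‖ + 1)
  obtain ⟨Λ, hΛ0, hΛ⟩ := exists_lipschitz_bound hφ hφs
  obtain ⟨A, hA⟩ := exists_abs_le_of_hasCompactSupport hφ.continuous hφs
  obtain ⟨K, hK0, hK⟩ := exists_brownian_expansion hφ hφs D
  have hA0 : 0 ≤ A := (abs_nonneg _).trans (hA 0)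
  set Q : ℝ := N * (gaussianAbsMoment 4 / (1 / 4 / (N + 1)) ^ 4) with hQ
  have hsmall : ∀ᶠ h : ℝ≥0 in 𝓝[>] 0, D * h < 1 / 4 :=
    nhdsWithin_le_nhds ((by fun_prop : Continuous fun h : ℝ≥0 => D * (h : ℝ)).tendsto' 0 0 (by simp)
      |>.eventually_lt_const (by norm_num))
  have hone : ∀ᶠ h : ℝ≥0 in 𝓝[>] 0, h ≤ 1 :=
    nhdsWithin_le_nhds (eventually_le_nhds (by norm_num))
  obtain ⟨Ω, mΩ, ℱ, P, B, Z, hP, S, hZ0, hlaw⟩ := hκ.solution x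
  have hint : ∀ h, ∫ y, φ y ∂κ h x = ∫ ω, φ (Z h ω) ∂P := fun h => by
    rw [← hlaw h, integral_map (S.measurable h).aemeasurable hφ.continuous.aestronglyMeasurable]
  have hDx : ∀ y, ‖y - x‖ ≤ 1 → ‖gradient V y‖ ≤ D := fun y hy => hD y (by
    have := norm_add_le (y - x) x
    rw [sub_add_cancel] at this
    linarith)
  set W : ℝ≥0 → Ω → EuclideanSpace ℝ (Fin N) := fun h ω =>
    x + ((h : ℝ) • (-gradient V x) + √2 • B h ω) with hW
  have hgauss : Tendsto (fun h : ℝ≥0 => (h : ℝ)⁻¹ * (∫ ω, φ (W h ω) ∂P - φ x -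
      h * langevinGen V φ x)) (𝓝[>] 0) (𝓝 0) := by
    refine tendsto_inv_mul_of_abs_le (K := K) ?_
    filter_upwards [hone] with h h1
    rw [langevinGen_eq_sum]
    exact hK S.brownian x (-gradient V x) (by rw [norm_neg]; exact hDx x (by simp)) h h1
  -- The minimum keeps the integrand bounded even on paths where the Euler estimate fails, so the
  -- pathwise limit passes through the expectation.
  have hmin : Tendsto (fun h : ℝ≥0 => ∫ ω, min (Λ * (‖Z h ω - W h ω‖ / h)) (Λ * (2 * D)) ∂P)
      (𝓝[>] 0) (𝓝 (∫ _ω, 0 ∂P)) := by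
    refine tendsto_integral_filter_of_dominated_convergence (fun _ => Λ * (2 * D)) ?_ ?_
      (integrable_const _) ?_
    · refine Eventually.of_forall fun h => Measurable.aestronglyMeasurable ?_
      have := S.measurable h
      have := S.measurable_brownian h
      fun_prop
    · refine Eventually.of_forall fun h => ae_of_all _ fun ω => ?_
      rw [Real.norm_of_nonneg (by positivity)]
      exact min_le_right _ _
    · filter_upwards [S.ae_equation hZ0] with ω hω
      have h1 := tendsto_norm_sub_euler_div (z := fun t => Z t ω) (β := fun t => √2 • B t ω)
        (S.continuous_paths ω) (continuous_gradient hV) hω.1 hω.2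
      have h2 := (h1.const_mul Λ).min (tendsto_const_nhds (x := Λ * (2 * D)))
      rwa [mul_zero, min_eq_left (by positivity)] at h2
  rw [integral_zero] at hmin
  have herr : Tendsto (fun h : ℝ≥0 => (h : ℝ)⁻¹ * (∫ ω, φ (Z h ω) ∂P - ∫ ω, φ (W h ω) ∂P))
      (𝓝[>] 0) (𝓝 0) := by
    have h1 : Tendsto (fun h : ℝ≥0 => 2 * A * Q * h) (𝓝[>] 0) (𝓝 0) :=
      ((by fun_prop : Continuous fun h : ℝ≥0 => 2 * A * Q * (h : ℝ)).tendsto' 0 0 (by simp)).mono_left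
        nhdsWithin_le_nhds
    have h2 := hmin.add h1
    rw [add_zero] at h2
    refine squeeze_zero_norm' ?_ h2
    filter_upwards [hsmall, self_mem_nhdsWithin] with h hDh h0
    have h0' : (0 : ℝ) < h := NNReal.coe_pos.2 h0
    have e1 := S.abs_integral_sub_le hZ0 hV hφ.continuous hΛ0 hΛ hA hDx hDh.le
    rw [norm_mul, norm_inv, Real.norm_eq_abs, Real.norm_eq_abs, abs_of_pos h0',
      inv_mul_le_iff₀ h0', mul_add, ← integral_const_mul (h : ℝ)]
    refine e1.trans_eq ?_
    congr 1
    · refine integral_congr_ae (ae_of_all _ fun ω => ?_)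
      simp only []
      rw [mul_min_of_nonneg _ _ h0'.le]
      congr 1
      · simp only [hW]
        field_simp
      · ring
    · rw [hQ]; ring
  have hsum := (herr.add hgauss).add (tendsto_const_nhds (x := langevinGen V φ x))
  rw [add_zero, zero_add] at hsum
  refine hsum.congr' ?_
  filter_upwards [self_mem_nhdsWithin] with h h0
  have h0' : (0 : ℝ) < h := NNReal.coe_pos.2 h0
  rw [hint]
  field_simp
  ring

lemma apply_zero (hκ : IsLangevinDiffusion V π κ) : κ 0 = Kernel.id := by
  ext1 x
  obtain ⟨Ω, mΩ, ℱ, P, B, Z, hP, S, hZ0, hlaw⟩ := hκ.solution x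
  rw [← hlaw 0, Measure.map_congr (g := fun _ => x) hZ0, Measure.map_const, measure_univ, one_smul,
    Kernel.id_apply]

lemma continuous_integral (hκ : IsLangevinDiffusion V π κ) {f : EuclideanSpace ℝ (Fin N) → ℝ}
    (hf : Continuous f) {A : ℝ} (hA : ∀ x, |f x| ≤ A) (x : EuclideanSpace ℝ (Fin N)) :
    Continuous fun t => ∫ y, f y ∂κ t x := by
  obtain ⟨Ω, mΩ, ℱ, P, B, Z, hP, S, hZ0, hlaw⟩ := hκ.solution x
  have hint : ∀ h, ∫ y, f y ∂κ h x = ∫ ω, f (Z h ω) ∂P := fun h => by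
    rw [← hlaw h, integral_map (S.measurable h).aemeasurable hf.aestronglyMeasurable]
  simp_rw [hint]
  exact continuous_of_dominated (bound := fun _ => A)
    (fun t => (hf.measurable.comp (S.measurable t)).aestronglyMeasurable)
    (fun t => ae_of_all _ fun ω => hA _) (integrable_const _)
    (ae_of_all _ fun ω => hf.comp (S.continuous_paths ω))

end IsLangevinDiffusion

end ShortTimeLangevin

/-! ### Strong generator of a stationary Markov semigroup -/

section StrongGenerator

open Filter Topology Set

variable {X : Type*} {mX : MeasurableSpace X} {π : Measure X}

lemma MeasureTheory.Measure.integral_comp_measure {Y : Type*} {mY : MeasurableSpace Y}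
    {μ : Measure X} {κ : Kernel X Y} [SFinite μ] [IsSFiniteKernel κ] {f : Y → ℝ}
    (hf : Integrable f (κ ∘ₘ μ)) :
    ∫ y, f y ∂(κ ∘ₘ μ) = ∫ x, ∫ y, f y ∂κ x ∂μ := by
  rw [Measure.comp_eq_comp_const_apply] at hf ⊢
  rw [Kernel.integral_comp hf, Kernel.const_apply]

lemma ProbabilityTheory.Kernel.Invariant.integral_integral [SFinite π] {κ : Kernel X X}
    [IsSFiniteKernel κ] (hκ : κ.Invariant π)
    {f : X → ℝ} (hf : Integrable f π) : ∫ x, ∫ y, f y ∂κ x ∂π = ∫ x, f x ∂π := by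
  have h : Integrable f (κ ∘ₘ π) := by rwa [hκ.def]
  rw [← Measure.integral_comp_measure h, hκ.def]

lemma ProbabilityTheory.Kernel.Invariant.integrable_integral {κ : Kernel X X}
    (hκ : κ.Invariant π) {f : X → ℝ} (hf : Integrable f π) :
    Integrable (fun x => ∫ y, f y ∂κ x) π := by
  have h : Integrable f (κ ∘ₘ π) := by rwa [hκ.def]
  refine ((Measure.integrable_comp_iff h.1).1 h).2.mono' (hκ.aestronglyMeasurable_integral hf.1)
    (ae_of_all _ fun x => norm_integral_le_integral_norm _)

lemma ProbabilityTheory.Kernel.Invariant.integral_abs_integral_le [SFinite π] {κ : Kernel X X}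
    [IsSFiniteKernel κ] (hκ : κ.Invariant π) {f : X → ℝ} (hf : Integrable f π) :
    ∫ x, |∫ y, f y ∂κ x| ∂π ≤ ∫ x, |f x| ∂π := by
  rw [← hκ.integral_integral hf.abs]
  exact integral_mono (hκ.integrable_integral hf).abs (hκ.integrable_integral hf.abs)
    fun x => abs_integral_le_integral_abs

lemma integrable_of_measurable_of_abs_le [IsFiniteMeasure π] {f : X → ℝ} (hf : Measurable f) {A : ℝ}
    (hA : ∀ x, |f x| ≤ A) : Integrable f π :=
  Integrable.of_bound hf.aestronglyMeasurable A (ae_of_all _ hA)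

variable [IsProbabilityMeasure π] {κ : ℝ≥0 → Kernel X X} {φ ψ : X → ℝ} {A G : ℝ}

lemma abs_integral_kernel_le {κ : Kernel X X} [IsMarkovKernel κ] (hA : ∀ x, |φ x| ≤ A) (x : X) :
    |∫ y, φ y ∂κ x| ≤ A := by
  have := norm_integral_le_of_norm_le_const (μ := κ x) (f := φ) (ae_of_all _ hA)
  simpa using this

lemma integral_kernel_add (hM : ∀ t, IsMarkovKernel (κ t)) (hsg : ∀ s t, κ (s + t) = κ t ∘ₖ κ s)
    (hφ : Measurable φ) (hA : ∀ x, |φ x| ≤ A) (s t : ℝ≥0) (x : X) :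
    ∫ y, φ y ∂κ (s + t) x = ∫ z, ∫ y, φ y ∂κ t z ∂κ s x := by
  rw [hsg, Kernel.integral_comp]
  rw [← hsg]
  exact integrable_of_measurable_of_abs_le hφ hA

/-- The error of the difference quotient at time t is P_t applied to the error at time 0, and P_t
contracts L¹(π). The L¹ limit at 0 therefore propagates to every t. -/
lemma hasDerivWithinAt_setIntegral_kernel (hM : ∀ t, IsMarkovKernel (κ t))
    (hsg : ∀ s t, κ (s + t) = κ t ∘ₖ κ s) (hinv : ∀ t, (κ t).Invariant π)
    (hφ : Measurable φ) (hA : ∀ x, |φ x| ≤ A) (hψ : Measurable ψ) (hG : ∀ x, |ψ x| ≤ G)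
    (hL1 : Tendsto (fun h : ℝ≥0 => ∫ x, |(h : ℝ)⁻¹ * (∫ y, φ y ∂κ h x - φ x) - ψ x| ∂π)
      (𝓝[>] 0) (𝓝 0)) (s : Set X) {t : ℝ} (ht : 0 ≤ t) :
    HasDerivWithinAt (fun t : ℝ => ∫ x in s, ∫ y, φ y ∂κ t.toNNReal x ∂π)
      (∫ x in s, ∫ y, ψ y ∂κ t.toNNReal x ∂π) (Ici t) t := by
  have hφi : Integrable φ π := integrable_of_measurable_of_abs_le hφ hA
  have hψi : Integrable ψ π := integrable_of_measurable_of_abs_le hψ hG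
  rw [← hasDerivWithinAt_Ioi_iff_Ici, hasDerivWithinAt_iff_tendsto_slope' (by simp)]
  have hsub : Tendsto (fun r : ℝ => (r - t).toNNReal) (𝓝[>] t) (𝓝[>] 0) := by
    refine tendsto_nhdsWithin_iff.2 ⟨?_, ?_⟩
    · exact ((by fun_prop : Continuous fun r : ℝ => (r - t).toNNReal).tendsto' t 0
        (by simp)).mono_left nhdsWithin_le_nhds
    · filter_upwards [self_mem_nhdsWithin] with r hr
      simpa using hr
  rw [tendsto_iff_norm_sub_tendsto_zero]
  refine squeeze_zero' (Eventually.of_forall fun r => norm_nonneg _) ?_ (hL1.comp hsub)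
  filter_upwards [self_mem_nhdsWithin] with r hr
  set h : ℝ≥0 := (r - t).toNNReal with hh
  have hhr : (h : ℝ) = r - t := Real.coe_toNNReal _ (sub_nonneg.2 (le_of_lt hr))
  have hrt : r.toNNReal = t.toNNReal + h := by
    rw [hh, ← Real.toNNReal_add ht (sub_nonneg.2 (le_of_lt hr))]
    congr 1
    ring
  have hQi : Integrable (fun x => ∫ y, φ y ∂κ h x) π := (hinv h).integrable_integral hφi
  have hD : Integrable (fun x => (h : ℝ)⁻¹ * (∫ y, φ y ∂κ h x - φ x) - ψ x) π :=
    ((hQi.sub hφi).const_mul _).sub hψi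
  have hae : ∀ᵐ x ∂π, (h : ℝ)⁻¹ * (∫ y, φ y ∂κ r.toNNReal x - ∫ y, φ y ∂κ t.toNNReal x) -
      ∫ y, ψ y ∂κ t.toNNReal x =
      ∫ z, ((h : ℝ)⁻¹ * (∫ y, φ y ∂κ h z - φ z) - ψ z) ∂κ t.toNNReal x := by
    filter_upwards [(hinv t.toNNReal).integrable_kernel hQi,
      (hinv t.toNNReal).integrable_kernel hφi, (hinv t.toNNReal).integrable_kernel hψi]
      with x h1 h2 h3
    have h4 : Integrable (fun z => (h : ℝ)⁻¹ * (∫ y, φ y ∂κ h z - φ z)) (κ t.toNNReal x) :=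
      (h1.sub h2).const_mul _
    rw [integral_sub h4 h3, integral_const_mul (h : ℝ)⁻¹, integral_sub h1 h2, hrt,
      integral_kernel_add hM hsg hφ hA]
  have e1 : slope (fun t : ℝ => ∫ x in s, ∫ y, φ y ∂κ t.toNNReal x ∂π) t r -
      ∫ x in s, ∫ y, ψ y ∂κ t.toNNReal x ∂π =
      ∫ x in s, ∫ z, ((h : ℝ)⁻¹ * (∫ y, φ y ∂κ h z - φ z) - ψ z) ∂κ t.toNNReal x ∂π := by
    rw [← integral_congr_ae (ae_restrict_of_ae hae)]
    have h1 := ((hinv r.toNNReal).integrable_integral hφi).integrableOn (s := s)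
    have h2 := ((hinv t.toNNReal).integrable_integral hφi).integrableOn (s := s)
    have h3 := ((hinv t.toNNReal).integrable_integral hψi).integrableOn (s := s)
    have h4 : IntegrableOn (fun x => (h : ℝ)⁻¹ * (∫ y, φ y ∂κ r.toNNReal x -
      ∫ y, φ y ∂κ t.toNNReal x)) s π := (h1.sub h2).const_mul _
    rw [integral_sub h4 h3, integral_const_mul (h : ℝ)⁻¹, integral_sub h1 h2, slope_def_module, hhr,
      smul_eq_mul]
  rw [e1]
  refine (norm_integral_le_integral_norm _).trans ?_
  simp only [Real.norm_eq_abs, Function.comp_apply]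
  exact (setIntegral_le_integral ((hinv t.toNNReal).integrable_integral hD).abs
    (ae_of_all _ fun x => abs_nonneg _)).trans ((hinv t.toNNReal).integral_abs_integral_le hD)

/-- For each measurable s, the map t ↦ ∫_s P_t φ dπ has right derivative at most G·π(s) in absolute
value. The mean value inequality and the arbitrariness of s turn this into an almost-everywhere
bound. -/
lemma ae_abs_integral_kernel_sub_le (hM : ∀ t, IsMarkovKernel (κ t))
    (hsg : ∀ s t, κ (s + t) = κ t ∘ₖ κ s) (hinv : ∀ t, (κ t).Invariant π)
    (h0 : κ 0 = Kernel.id)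
    (hφ : Measurable φ) (hA : ∀ x, |φ x| ≤ A) (hψ : Measurable ψ) (hG : ∀ x, |ψ x| ≤ G)
    (hcont : ∀ x, Continuous fun t => ∫ y, φ y ∂κ t x)
    (hL1 : Tendsto (fun h : ℝ≥0 => ∫ x, |(h : ℝ)⁻¹ * (∫ y, φ y ∂κ h x - φ x) - ψ x| ∂π)
      (𝓝[>] 0) (𝓝 0)) (t : ℝ≥0) :
    ∀ᵐ x ∂π, |∫ y, φ y ∂κ t x - φ x| ≤ G * t := by
  have hφi : Integrable φ π := integrable_of_measurable_of_abs_le hφ hA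
  have hψi : Integrable ψ π := integrable_of_measurable_of_abs_le hψ hG
  have hQi : Integrable (fun x => ∫ y, φ y ∂κ t x) π := (hinv t).integrable_integral hφi
  have key : ∀ s, MeasurableSet s → |∫ x in s, (∫ y, φ y ∂κ t x - φ x) ∂π| ≤
      ∫ _x in s, G * t ∂π := by
    intro s hs
    have hco : ContinuousOn (fun t : ℝ => ∫ x in s, ∫ y, φ y ∂κ t.toNNReal x ∂π) (Icc 0 t) := by
      refine (continuous_of_dominated (bound := fun _ => A) (fun t => ?_)
        (fun t => ae_of_all _ fun x => ?_) (integrable_const _) (ae_of_all _ fun x => ?_)).continuousOn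
      · exact ((hinv _).integrable_integral hφi).1.restrict
      · exact abs_integral_kernel_le hA x
      · exact (hcont x).comp continuous_real_toNNReal
    have hb : ∀ r ∈ Ico (0 : ℝ) t, ‖∫ x in s, ∫ y, ψ y ∂κ r.toNNReal x ∂π‖ ≤ G * π.real s := by
      intro r _
      refine norm_setIntegral_le_of_norm_le_const (measure_lt_top _ _) fun x _ => ?_
      exact abs_integral_kernel_le hG x
    have h1 := norm_image_sub_le_of_norm_deriv_right_le_segment hco
      (fun r hr => hasDerivWithinAt_setIntegral_kernel hM hsg hinv hφ hA hψ hG hL1 s hr.1) hb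
      t ⟨t.coe_nonneg, le_rfl⟩
    rw [integral_sub hQi.integrableOn hφi.integrableOn, setIntegral_const, smul_eq_mul]
    simp only [Real.toNNReal_coe, Real.toNNReal_zero, h0, Kernel.id_apply, Real.norm_eq_abs,
      integral_dirac' _ _ hφ.stronglyMeasurable, sub_zero] at h1
    linarith
  have h1 : ∀ᵐ x ∂π, ∫ y, φ y ∂κ t x - φ x ≤ G * t :=
    ae_le_of_forall_setIntegral_le (hQi.sub hφi) (integrable_const _)
      fun s hs _ => (le_abs_self _).trans (key s hs)
  have h2 : ∀ᵐ x ∂π, -(∫ y, φ y ∂κ t x - φ x) ≤ G * t :=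
    ae_le_of_forall_setIntegral_le (hQi.sub hφi).neg (integrable_const _)
      fun s hs _ => by
        rw [integral_neg]
        exact (neg_le_abs _).trans (key s hs)
  filter_upwards [h1, h2] with x h3 h4 using abs_le.2 ⟨by linarith, h3⟩

/-- For a bounded generator image, `L¹` convergence of the difference quotients upgrades to
`L²` convergence. -/
lemma tendsto_integral_kernel_sub_sq (hM : ∀ t, IsMarkovKernel (κ t))
    (hsg : ∀ s t, κ (s + t) = κ t ∘ₖ κ s) (hinv : ∀ t, (κ t).Invariant π)
    (h0 : κ 0 = Kernel.id)
    (hφ : Measurable φ) (hA : ∀ x, |φ x| ≤ A) (hψ : Measurable ψ) (hG : ∀ x, |ψ x| ≤ G)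
    (hcont : ∀ x, Continuous fun t => ∫ y, φ y ∂κ t x)
    (hL1 : Tendsto (fun h : ℝ≥0 => ∫ x, |(h : ℝ)⁻¹ * (∫ y, φ y ∂κ h x - φ x) - ψ x| ∂π)
      (𝓝[>] 0) (𝓝 0)) :
    Tendsto (fun h : ℝ≥0 => ∫ x, ((h : ℝ)⁻¹ * (∫ y, φ y ∂κ h x - φ x) - ψ x) ^ 2 ∂π)
      (𝓝[>] 0) (𝓝 0) := by
  have h1 := hL1.const_mul (2 * G)
  rw [mul_zero] at h1
  refine squeeze_zero' (Eventually.of_forall fun h => integral_nonneg fun x => sq_nonneg _) ?_ h1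
  filter_upwards [self_mem_nhdsWithin] with h hh
  have hh0 : (0 : ℝ) < h := NNReal.coe_pos.2 hh
  have hφi : Integrable φ π := integrable_of_measurable_of_abs_le hφ hA
  have hD : Integrable (fun x => (h : ℝ)⁻¹ * (∫ y, φ y ∂κ h x - φ x) - ψ x) π :=
    ((((hinv h).integrable_integral hφi).sub hφi).const_mul _).sub
      (integrable_of_measurable_of_abs_le hψ hG)
  rw [← integral_const_mul (2 * G)]
  refine integral_mono_of_nonneg (ae_of_all _ fun x => sq_nonneg _) (hD.abs.const_mul _) ?_
  filter_upwards [ae_abs_integral_kernel_sub_le hM hsg hinv h0 hφ hA hψ hG hcont hL1 h] with x hx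
  -- An error bounded by 2G has square at most 2G times its absolute value, so L¹ convergence
  -- suffices.
  have h2 : |(h : ℝ)⁻¹ * (∫ y, φ y ∂κ h x - φ x) - ψ x| ≤ 2 * G := by
    refine (abs_sub _ _).trans ?_
    have : |(h : ℝ)⁻¹ * (∫ y, φ y ∂κ h x - φ x)| ≤ G := by
      rw [abs_mul, abs_inv, abs_of_pos hh0, inv_mul_le_iff₀ hh0, mul_comm]
      exact hx
    linarith [hG x]
  rw [← sq_abs, sq]
  exact mul_le_mul_of_nonneg_right h2 (abs_nonneg _)

end StrongGenerator

/-! ### The Langevin semigroup on `L²(π)` -/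

section LangevinSemigroup

open Filter Topology Set
open scoped RealInnerProductSpace

variable {N : ℕ} {φ ψ V : EuclideanSpace ℝ (Fin N) → ℝ} {π : Measure (EuclideanSpace ℝ (Fin N))}

lemma exists_pos_integral_tilted_eq [IsProbabilityMeasure π]
    (hπ : π = (volume : Measure (EuclideanSpace ℝ (Fin N))).tilted (fun x => -V x)) :
    ∃ c, 0 < c ∧ (∀ f : EuclideanSpace ℝ (Fin N) → ℝ,
      ∫ x, f x ∂π = ∫ x, f x * (c * Real.exp (-V x))) ∧
      ∀ f : EuclideanSpace ℝ (Fin N) → ℝ, Integrable f π →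
        Integrable fun x => f x * (c * Real.exp (-V x)) := by
  have hi : Integrable (fun x : EuclideanSpace ℝ (Fin N) => Real.exp (-V x)) := by
    by_contra h
    refine IsProbabilityMeasure.ne_zero π ?_
    rw [hπ, tilted_of_not_integrable h]
  refine ⟨(∫ x, Real.exp (-V x))⁻¹, inv_pos.2 (integral_exp_pos hi), fun f => ?_, fun f hf => ?_⟩
  · rw [hπ, integral_tilted]
    refine integral_congr_ae (ae_of_all _ fun x => ?_)
    simp only [smul_eq_mul, div_eq_mul_inv]
    ring
  · rw [hπ, integrable_tilted_iff hi] at hf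
    refine (hf.const_mul (∫ x, Real.exp (-V x))⁻¹).congr (ae_of_all _ fun x => ?_)
    simp only [smul_eq_mul]
    ring

lemma integral_langevinGen_mul_tilted [IsProbabilityMeasure π] (hV : ContDiff ℝ 1 V)
    (hπ : π = (volume : Measure (EuclideanSpace ℝ (Fin N))).tilted (fun x => -V x))
    (hφ : ContDiff ℝ (⊤ : ℕ∞) φ) (hφs : HasCompactSupport φ) (hψ : ContDiff ℝ 1 ψ) :
    ∫ x, langevinGen V φ x * ψ x ∂π = -∫ x, ∑ i, pderiv i φ x * pderiv i ψ x ∂π := by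
  obtain ⟨c, -, hc, -⟩ := exists_pos_integral_tilted_eq hπ
  rw [hc, hc]
  exact integral_langevinGen_mul hV hφ hφs hψ c

lemma integral_langevinGen_tilted [IsProbabilityMeasure π] (hV : ContDiff ℝ 1 V)
    (hπ : π = (volume : Measure (EuclideanSpace ℝ (Fin N))).tilted (fun x => -V x))
    (hφ : ContDiff ℝ (⊤ : ℕ∞) φ) (hφs : HasCompactSupport φ) :
    ∫ x, langevinGen V φ x ∂π = 0 := by
  have h := integral_langevinGen_mul_tilted hV hπ hφ hφs (contDiff_const (c := (1 : ℝ)))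
  simpa [pderiv] using h

lemma langevinGen_add (hφ : ContDiff ℝ (⊤ : ℕ∞) φ) (hψ : ContDiff ℝ (⊤ : ℕ∞) ψ) :
    langevinGen V (fun x => φ x + ψ x) = fun x => langevinGen V φ x + langevinGen V ψ x := by
  have h1 : ∀ i, pderiv i (fun x => φ x + ψ x) = fun x => pderiv i φ x + pderiv i ψ x := fun i =>
    funext fun x => pderiv_add (hφ.differentiable (by simp) x) (hψ.differentiable (by simp) x) i
  have h2 : ∀ i, pderiv i (fun x => pderiv i φ x + pderiv i ψ x) =
      fun x => pderiv i (pderiv i φ) x + pderiv i (pderiv i ψ) x := fun i =>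
    funext fun x => pderiv_add ((contDiff_pderiv hφ i).differentiable (by simp) x)
      ((contDiff_pderiv hψ i).differentiable (by simp) x) i
  funext x
  simp only [langevinGen, h1, h2, ← Finset.sum_add_distrib]
  exact Finset.sum_congr rfl fun i _ => by ring

lemma langevinGen_const_mul (c : ℝ) (hφ : ContDiff ℝ (⊤ : ℕ∞) φ) :
    langevinGen V (fun x => c * φ x) = fun x => c * langevinGen V φ x := by
  have h0 : ∀ (f : EuclideanSpace ℝ (Fin N) → ℝ), ContDiff ℝ (⊤ : ℕ∞) f → ∀ i,
      pderiv i (fun x => c * f x) = fun x => c * pderiv i f x := fun f hf i => funext fun x => by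
    rw [pderiv, fderiv_const_mul (hf.differentiable (by simp) x), smul_apply, smul_eq_mul, pderiv]
  funext x
  simp only [langevinGen, h0 φ hφ, h0 _ (contDiff_pderiv hφ _), Finset.mul_sum]
  exact Finset.sum_congr rfl fun i _ => by ring

/-! ### From pointwise to L² convergence of the difference quotients. -/

namespace IsLangevinDiffusion

variable {κ : ℝ≥0 → Kernel (EuclideanSpace ℝ (Fin N)) (EuclideanSpace ℝ (Fin N))}
  [IsProbabilityMeasure π]

lemma tendsto_setIntegral_abs (hκ : IsLangevinDiffusion V π κ) (hV : ContDiff ℝ 1 V)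
    (hφ : ContDiff ℝ (⊤ : ℕ∞) φ) (hφs : HasCompactSupport φ) (R : ℝ) :
    Tendsto (fun h : ℝ≥0 => ∫ x in Metric.closedBall 0 R,
      |(h : ℝ)⁻¹ * (∫ y, φ y ∂κ h x - φ x) - langevinGen V φ x| ∂π) (𝓝[>] 0) (𝓝 0) := by
  obtain ⟨C, hC0, hC⟩ := hκ.exists_abs_integral_sub_le hV hφ hφs R
  obtain ⟨G, hG⟩ := exists_abs_le_of_hasCompactSupport (continuous_langevinGen hV hφ)
    (hasCompactSupport_langevinGen hφs)
  have hm : ∀ h, Measurable fun x => ∫ y, φ y ∂κ h x := fun h => by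
    have := hκ.markov h
    exact hφ.continuous.stronglyMeasurable.integral_kernel.measurable
  have hL := (continuous_langevinGen hV hφ).measurable
  have hφm := hφ.continuous.measurable
  have h1 : Tendsto (fun h : ℝ≥0 => ∫ x in Metric.closedBall 0 R,
      |(h : ℝ)⁻¹ * (∫ y, φ y ∂κ h x - φ x) - langevinGen V φ x| ∂π) (𝓝[>] 0)
      (𝓝 (∫ _x in Metric.closedBall (0 : EuclideanSpace ℝ (Fin N)) R, 0 ∂π)) := by
    refine tendsto_integral_filter_of_dominated_convergence (fun _ => C + G) ?_ ?_
      (integrable_const _) (ae_of_all _ fun x => ?_)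
    · refine Eventually.of_forall fun h => Measurable.aestronglyMeasurable ?_
      have := hm h
      fun_prop
    · filter_upwards [hC, self_mem_nhdsWithin] with h hh h0
      have h0' : (0 : ℝ) < h := NNReal.coe_pos.2 h0
      refine (ae_restrict_iff' Metric.isClosed_closedBall.measurableSet).2 (ae_of_all _ fun x hx => ?_)
      rw [Real.norm_eq_abs, abs_abs]
      refine (abs_sub _ _).trans (add_le_add ?_ (hG x))
      rw [abs_mul, abs_inv, abs_of_pos h0', inv_mul_le_iff₀ h0', mul_comm (h : ℝ)]
      exact hh x (by simpa using hx)
    · have h2 := ((hκ.tendsto_integral_sub hV hφ hφs x).sub_const (langevinGen V φ x)).abs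
      simpa using h2
  simpa using h1

/-- Inside a ball K this is local dominated convergence. Outside, φ and Lφ vanish, and |P_h φ| ≤
A·P_h χ for a cutoff χ equal to 1 on the support of φ. Stationarity and ∫ Lχ dπ = 0 make the total
integral of (P_h χ − χ)/h − Lχ zero, so its part outside K is minus its part inside, which tends to
0. No tail estimate for the diffusion is needed. -/
lemma tendsto_integral_abs (hκ : IsLangevinDiffusion V π κ) (hV : ContDiff ℝ 1 V)
    (hπ : π = (volume : Measure (EuclideanSpace ℝ (Fin N))).tilted (fun x => -V x))
    (hφ : ContDiff ℝ (⊤ : ℕ∞) φ) (hφs : HasCompactSupport φ) :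
    Tendsto (fun h : ℝ≥0 => ∫ x,
      |(h : ℝ)⁻¹ * (∫ y, φ y ∂κ h x - φ x) - langevinGen V φ x| ∂π) (𝓝[>] 0) (𝓝 0) := by
  have hM := hκ.markov
  obtain ⟨A, hA⟩ := exists_abs_le_of_hasCompactSupport hφ.continuous hφs
  have hA0 : 0 ≤ A := (abs_nonneg _).trans (hA 0)
  obtain ⟨G, hG⟩ := exists_abs_le_of_hasCompactSupport (continuous_langevinGen hV hφ)
    (hasCompactSupport_langevinGen hφs)
  obtain ⟨r, hr0, hr⟩ := hφs.isCompact.isBounded.subset_closedBall_lt 0 0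
  let b : ContDiffBump (0 : EuclideanSpace ℝ (Fin N)) := ⟨r, r + 1, hr0, by linarith⟩
  set χ : EuclideanSpace ℝ (Fin N) → ℝ := fun x => b x with hχ
  have hχd : ContDiff ℝ (⊤ : ℕ∞) χ := b.contDiff
  have hχs : HasCompactSupport χ := b.hasCompactSupport
  have hχ0 : ∀ x, 0 ≤ χ x := fun x => b.nonneg
  have hχ1 : ∀ x, |χ x| ≤ 1 := fun x => by rw [abs_of_nonneg (hχ0 x)]; exact b.le_one
  obtain ⟨GX, hGX⟩ := exists_abs_le_of_hasCompactSupport (continuous_langevinGen hV hχd)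
    (hasCompactSupport_langevinGen hχs)
  have hφχ : ∀ x, |φ x| ≤ A * χ x := by
    intro x
    by_cases hx : x ∈ tsupport φ
    · have h1 : χ x = 1 := b.one_of_mem_closedBall (hr hx)
      rw [h1, mul_one]
      exact hA x
    · rw [image_eq_zero_of_notMem_tsupport hx, abs_zero]
      exact mul_nonneg hA0 (hχ0 x)
  set K := Metric.closedBall (0 : EuclideanSpace ℝ (Fin N)) (r + 1) with hK
  have hKm : MeasurableSet K := Metric.isClosed_closedBall.measurableSet
  have hout : ∀ x, x ∉ K → x ∉ tsupport φ := fun x hx hx' =>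
    hx (Metric.closedBall_subset_closedBall (by linarith) (hr hx'))
  have hχout : ∀ x, x ∉ K → x ∉ tsupport χ := fun x hx hx' => hx (by
    rw [hχ, b.tsupport_eq] at hx'
    exact hx')
  have hφi : Integrable φ π := integrable_of_measurable_of_abs_le hφ.continuous.measurable hA
  have hχi : Integrable χ π := integrable_of_measurable_of_abs_le hχd.continuous.measurable hχ1
  have hLi : Integrable (langevinGen V φ) π :=
    integrable_of_measurable_of_abs_le (continuous_langevinGen hV hφ).measurable hG
  have hLχi : Integrable (langevinGen V χ) π :=
    integrable_of_measurable_of_abs_le (continuous_langevinGen hV hχd).measurable hGX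
  have hDi : ∀ h : ℝ≥0, Integrable (fun x => (h : ℝ)⁻¹ * (∫ y, φ y ∂κ h x - φ x) -
      langevinGen V φ x) π := fun h =>
    ((((hκ.stationary h).integrable_integral hφi).sub hφi).const_mul _).sub hLi
  have hDχi : ∀ h : ℝ≥0, Integrable (fun x => (h : ℝ)⁻¹ * (∫ y, χ y ∂κ h x - χ x) -
      langevinGen V χ x) π := fun h =>
    ((((hκ.stationary h).integrable_integral hχi).sub hχi).const_mul _).sub hLχi
  have hlim := (hκ.tendsto_setIntegral_abs hV hφ hφs (r + 1)).add
    ((hκ.tendsto_setIntegral_abs hV hχd hχs (r + 1)).const_mul A)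
  rw [mul_zero, add_zero] at hlim
  refine squeeze_zero' (Eventually.of_forall fun h => integral_nonneg fun x => abs_nonneg _) ?_ hlim
  filter_upwards [self_mem_nhdsWithin] with h h0
  have h0' : (0 : ℝ) < h := NNReal.coe_pos.2 h0
  rw [← integral_add_compl hKm (hDi h).abs]
  refine add_le_add le_rfl ?_
  have e1 : ∫ x in Kᶜ, |(h : ℝ)⁻¹ * (∫ y, φ y ∂κ h x - φ x) - langevinGen V φ x| ∂π ≤
      ∫ x in Kᶜ, A * ((h : ℝ)⁻¹ * (∫ y, χ y ∂κ h x - χ x) - langevinGen V χ x) ∂π := by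
    refine setIntegral_mono_on (hDi h).abs.integrableOn ((hDχi h).const_mul A).integrableOn
      hKm.compl fun x hx => ?_
    rw [langevinGen_eq_zero (hout x hx), image_eq_zero_of_notMem_tsupport (hout x hx),
      langevinGen_eq_zero (hχout x hx), image_eq_zero_of_notMem_tsupport (hχout x hx), sub_zero,
      sub_zero, sub_zero, sub_zero, abs_mul, abs_of_pos (inv_pos.2 h0'), mul_left_comm]
    refine mul_le_mul_of_nonneg_left ?_ (inv_pos.2 h0').le
    rw [← integral_const_mul A]
    refine norm_integral_le_of_norm_le (f := φ) ((integrable_of_measurable_of_abs_le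
      hχd.continuous.measurable hχ1).const_mul A) (ae_of_all _ fun y => hφχ y)
  have e2 : ∫ x, ((h : ℝ)⁻¹ * (∫ y, χ y ∂κ h x - χ x) - langevinGen V χ x) ∂π = 0 := by
    have hi1 := (hκ.stationary h).integrable_integral hχi
    have hi2 : Integrable (fun x => (h : ℝ)⁻¹ * (∫ y, χ y ∂κ h x - χ x)) π :=
      (hi1.sub hχi).const_mul _
    rw [integral_sub hi2 hLχi, integral_const_mul (h : ℝ)⁻¹, integral_sub hi1 hχi,
      (hκ.stationary h).integral_integral hχi, integral_langevinGen_tilted hV hπ hχd hχs]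
    simp
  rw [← integral_add_compl hKm (hDχi h)] at e2
  rw [integral_const_mul A] at e1
  refine e1.trans (mul_le_mul_of_nonneg_left ?_ hA0)
  have e3 := abs_integral_le_integral_abs (μ := π.restrict K)
    (f := fun x => (h : ℝ)⁻¹ * (∫ y, χ y ∂κ h x - χ x) - langevinGen V χ x)
  have e4 := neg_abs_le (∫ x in K, ((h : ℝ)⁻¹ * (∫ y, χ y ∂κ h x - χ x) - langevinGen V χ x) ∂π)
  linarith

lemma tendsto_integral_sq (hκ : IsLangevinDiffusion V π κ) (hV : ContDiff ℝ 1 V)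
    (hπ : π = (volume : Measure (EuclideanSpace ℝ (Fin N))).tilted (fun x => -V x))
    (hφ : ContDiff ℝ (⊤ : ℕ∞) φ) (hφs : HasCompactSupport φ) :
    Tendsto (fun h : ℝ≥0 => ∫ x,
      ((h : ℝ)⁻¹ * (∫ y, φ y ∂κ h x - φ x) - langevinGen V φ x) ^ 2 ∂π) (𝓝[>] 0) (𝓝 0) := by
  obtain ⟨A, hA⟩ := exists_abs_le_of_hasCompactSupport hφ.continuous hφs
  obtain ⟨G, hG⟩ := exists_abs_le_of_hasCompactSupport (continuous_langevinGen hV hφ)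
    (hasCompactSupport_langevinGen hφs)
  exact tendsto_integral_kernel_sub_sq hκ.markov hκ.semigroup hκ.stationary hκ.apply_zero
    hφ.continuous.measurable hA (continuous_langevinGen hV hφ).measurable hG
    (hκ.continuous_integral hφ.continuous hA) (hκ.tendsto_integral_abs hV hπ hφ hφs)

/-- The transition operator of the diffusion on `L²(π)`. -/
noncomputable def op (hκ : IsLangevinDiffusion V π κ) (t : ℝ≥0) : Lp ℝ 2 π →L[ℝ] Lp ℝ 2 π :=
  haveI := hκ.markov t
  markovOp (hκ.stationary t)

lemma coeFn_op (hκ : IsLangevinDiffusion V π κ) (t : ℝ≥0) (f : Lp ℝ 2 π) :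
    hκ.op t f =ᵐ[π] fun x => ∫ y, f y ∂κ t x :=
  haveI := hκ.markov t
  coeFn_markovOp (hκ.stationary t) f

end IsLangevinDiffusion

/-! ### Symmetry, energy and density properties of the generator in L²(π). -/

/-- The graph of the Langevin generator on test functions, in `L²(π)`. -/
def langevinGraph (V : EuclideanSpace ℝ (Fin N) → ℝ) (π : Measure (EuclideanSpace ℝ (Fin N))) :
    Set (Lp ℝ 2 π × Lp ℝ 2 π) :=
  {z | ∃ φ : EuclideanSpace ℝ (Fin N) → ℝ, ContDiff ℝ (⊤ : ℕ∞) φ ∧ HasCompactSupport φ ∧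
    z.1 =ᵐ[π] φ ∧ z.2 =ᵐ[π] langevinGen V φ}

lemma norm_sq_eq_integral (f : Lp ℝ 2 π) : ‖f‖ ^ 2 = ∫ x, f x ^ 2 ∂π := by
  rw [← real_inner_self_eq_norm_sq, L2.inner_def]
  simp [sq]

lemma inner_eq_integral (f g : Lp ℝ 2 π) : ⟪f, g⟫ = ∫ x, f x * g x ∂π := by
  rw [L2.inner_def]
  simp [mul_comm]

lemma memLp_of_continuous_of_hasCompactSupport [IsFiniteMeasure π]
    {f : EuclideanSpace ℝ (Fin N) → ℝ}
    (hf : Continuous f) (hfs : HasCompactSupport f) : MemLp f 2 π := by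
  obtain ⟨A, hA⟩ := exists_abs_le_of_hasCompactSupport hf hfs
  exact MemLp.of_bound hf.aestronglyMeasurable A (ae_of_all _ hA)

lemma langevinGraph_inner_symm [IsProbabilityMeasure π] (hV : ContDiff ℝ 1 V)
    (hπ : π = (volume : Measure (EuclideanSpace ℝ (Fin N))).tilted (fun x => -V x))
    {z w : Lp ℝ 2 π × Lp ℝ 2 π} (hz : z ∈ langevinGraph V π) (hw : w ∈ langevinGraph V π) :
    ⟪z.2, w.1⟫ = ⟪z.1, w.2⟫ := by
  obtain ⟨φ, hφ, hφs, hz1, hz2⟩ := hz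
  obtain ⟨ψ, hψ, hψs, hw1, hw2⟩ := hw
  rw [inner_eq_integral, inner_eq_integral]
  have e1 : ∫ x, z.2 x * w.1 x ∂π = ∫ x, langevinGen V φ x * ψ x ∂π :=
    integral_congr_ae (hz2.mul hw1)
  have e2 : ∫ x, z.1 x * w.2 x ∂π = ∫ x, langevinGen V ψ x * φ x ∂π := by
    simp_rw [mul_comm (z.1 _)]
    exact integral_congr_ae (hw2.mul hz1)
  rw [e1, e2, integral_langevinGen_mul_tilted hV hπ hφ hφs (hψ.of_le (by simp)),
    integral_langevinGen_mul_tilted hV hπ hψ hψs (hφ.of_le (by simp))]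
  simp_rw [mul_comm]

lemma langevinGraph_inner_self [IsProbabilityMeasure π] (hV : ContDiff ℝ 1 V)
    (hπ : π = (volume : Measure (EuclideanSpace ℝ (Fin N))).tilted (fun x => -V x))
    {z : Lp ℝ 2 π × Lp ℝ 2 π} (hφ : ContDiff ℝ (⊤ : ℕ∞) φ) (hφs : HasCompactSupport φ)
    (hz1 : z.1 =ᵐ[π] φ) (hz2 : z.2 =ᵐ[π] langevinGen V φ) :
    -⟪z.2, z.1⟫ = ∫ x, ‖gradient φ x‖ ^ 2 ∂π := by
  have h : ∫ x, z.2 x * z.1 x ∂π = ∫ x, langevinGen V φ x * φ x ∂π :=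
    integral_congr_ae (hz2.mul hz1)
  rw [inner_eq_integral, h, integral_langevinGen_mul_tilted hV hπ hφ hφs (hφ.of_le (by simp)), neg_neg]
  simp_rw [norm_gradient_sq, sq]

lemma exists_mem_langevinGraph [IsFiniteMeasure π] (hV : ContDiff ℝ 1 V)
    (hφ : ContDiff ℝ (⊤ : ℕ∞) φ) (hφs : HasCompactSupport φ) :
    ∃ z ∈ langevinGraph V π, z.1 =ᵐ[π] φ ∧ z.2 =ᵐ[π] langevinGen V φ :=
  have h1 := (memLp_of_continuous_of_hasCompactSupport hφ.continuous hφs (π := π)).coeFn_toLp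
  have h2 := (memLp_of_continuous_of_hasCompactSupport (continuous_langevinGen hV hφ)
    (hasCompactSupport_langevinGen hφs) (π := π)).coeFn_toLp
  ⟨(_, _), ⟨φ, hφ, hφs, h1, h2⟩, h1, h2⟩

lemma dense_langevinGraph_fst [IsFiniteMeasure π] (hV : ContDiff ℝ 1 V) :
    Dense (Prod.fst '' langevinGraph V π) := by
  refine (Lp.dense_hasCompactSupport_contDiff (F := ℝ) (μ := π) (p := 2) (by norm_num)).mono ?_
  rintro f ⟨φ, hf, hφs, hφ⟩
  obtain ⟨z, hz, h1, -⟩ := exists_mem_langevinGraph (π := π) hV hφ hφs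
  exact ⟨z, hz, Lp.ext (h1.trans hf.symm)⟩

/-- The range of `1 - L` on test functions, as a subspace of `L²(π)`. -/
noncomputable def langevinRange (hV : ContDiff ℝ 1 V) (π : Measure (EuclideanSpace ℝ (Fin N)))
    [IsFiniteMeasure π] : Submodule ℝ (Lp ℝ 2 π) where
  carrier := (fun z : Lp ℝ 2 π × Lp ℝ 2 π => z.1 - z.2) '' langevinGraph V π
  zero_mem' := by
    obtain ⟨z, hz, h1, h2⟩ := exists_mem_langevinGraph (π := π) hV
      (contDiff_const (c := (0 : ℝ))) HasCompactSupport.zero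
    refine ⟨z, hz, Lp.ext ?_⟩
    filter_upwards [h1, h2, Lp.coeFn_sub z.1 z.2, Lp.coeFn_zero ℝ 2 π] with x e1 e2 e3 e4
    rw [e3, e4, Pi.sub_apply, e1, e2, langevinGen_eq_zero (by simp [tsupport])]
    simp
  add_mem' := by
    rintro _ _ ⟨z, ⟨φ, hφ, hφs, hz1, hz2⟩, rfl⟩ ⟨w, ⟨ψ, hψ, hψs, hw1, hw2⟩, rfl⟩
    refine ⟨z + w, ⟨fun x => φ x + ψ x, hφ.add hψ, hφs.add hψs, ?_, ?_⟩, ?_⟩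
    · filter_upwards [hz1, hw1, Lp.coeFn_add z.1 w.1] with x e1 e2 e3
      rw [Prod.fst_add, e3, Pi.add_apply, e1, e2]
    · filter_upwards [hz2, hw2, Lp.coeFn_add z.2 w.2] with x e1 e2 e3
      rw [Prod.snd_add, e3, Pi.add_apply, e1, e2, langevinGen_add hφ hψ]
    · simp only [Prod.fst_add, Prod.snd_add]
      abel
  smul_mem' := by
    rintro c _ ⟨z, ⟨φ, hφ, hφs, hz1, hz2⟩, rfl⟩
    refine ⟨c • z, ⟨fun x => c * φ x, contDiff_const.mul hφ, hφs.mul_left, ?_, ?_⟩, ?_⟩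
    · filter_upwards [hz1, Lp.coeFn_smul c z.1] with x e1 e2
      rw [Prod.smul_fst, e2, Pi.smul_apply, e1, smul_eq_mul]
    · filter_upwards [hz2, Lp.coeFn_smul c z.2] with x e1 e2
      rw [Prod.smul_snd, e2, Pi.smul_apply, e1, smul_eq_mul, langevinGen_const_mul c hφ]
    · simp only [Prod.smul_fst, Prod.smul_snd, smul_sub]

lemma dense_langevinRange [IsProbabilityMeasure π] (hV : ContDiff ℝ 1 V)
    (hπ : π = (volume : Measure (EuclideanSpace ℝ (Fin N))).tilted (fun x => -V x)) :
    Dense ((fun z : Lp ℝ 2 π × Lp ℝ 2 π => z.1 - z.2) '' langevinGraph V π) := by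
  -- As the range is a subspace, density means that its orthogonal complement is zero; an orthogonal
  -- g is a weak solution of the equation treated by `ae_eq_zero_of_integral_sub_langevinGen`.
  change Dense (langevinRange hV π : Set (Lp ℝ 2 π))
  rw [Submodule.dense_iff_topologicalClosure_eq_top, Submodule.topologicalClosure_eq_top_iff,
    Submodule.eq_bot_iff]
  intro g hg
  obtain ⟨c, hc0, hc, hci⟩ := exists_pos_integral_tilted_eq hπ
  have h1 : (g : EuclideanSpace ℝ (Fin N) → ℝ) =ᵐ[volume] 0 := by
    refine ae_eq_zero_of_integral_sub_langevinGen hV hc0 (Lp.stronglyMeasurable g).measurable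
      (hci _ (Lp.memLp g).integrable_sq) fun φ hφ hφs => ?_
    obtain ⟨z, hz, h1, h2⟩ := exists_mem_langevinGraph (π := π) hV hφ hφs
    have h3 : ⟪z.1 - z.2, g⟫ = 0 := (Submodule.mem_orthogonal _ _).1 hg _ ⟨z, hz, rfl⟩
    rw [← hc, ← h3, inner_eq_integral]
    refine integral_congr_ae ?_
    filter_upwards [h1, h2, Lp.coeFn_sub z.1 z.2] with x e1 e2 e3
    rw [e3, Pi.sub_apply, e1, e2]
  refine Lp.ext ?_
  have h2 : (g : EuclideanSpace ℝ (Fin N) → ℝ) =ᵐ[π] 0 := by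
    have h3 : π ≪ volume := by rw [hπ]; exact tilted_absolutelyContinuous _ _
    exact h3.ae_eq h1
  exact h2.trans (Lp.coeFn_zero ℝ 2 π).symm

namespace IsLangevinDiffusion

variable {κ : ℝ≥0 → Kernel (EuclideanSpace ℝ (Fin N)) (EuclideanSpace ℝ (Fin N))}
  [IsProbabilityMeasure π]

lemma contractionSemigroup (hκ : IsLangevinDiffusion V π κ) (hV : ContDiff ℝ 1 V)
    (hπ : π = (volume : Measure (EuclideanSpace ℝ (Fin N))).tilted (fun x => -V x)) :
    ContractionSemigroup (fun t : ℝ => hκ.op t.toNNReal) (langevinGraph V π) where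
  zero := by
    have := hκ.markov 0
    rw [Real.toNNReal_zero]
    exact markovOp_id (hκ.stationary 0) hκ.apply_zero
  add s t hs ht x := by
    have := hκ.markov
    refine markovOp_comp (hκ.stationary t.toNNReal) (hκ.stationary s.toNNReal) _ ?_ x
    rw [Real.toNNReal_add hs ht, hκ.semigroup]
  contraction t _ x := by
    have := hκ.markov t.toNNReal
    exact norm_markovOp_apply_le (hκ.stationary t.toNNReal) x
  deriv z hz := by
    obtain ⟨φ, hφ, hφs, h1, h2⟩ := hz
    have hto : Tendsto Real.toNNReal (𝓝[>] 0) (𝓝[>] 0) := by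
      refine tendsto_nhdsWithin_iff.2 ⟨?_, ?_⟩
      · exact (continuous_real_toNNReal.tendsto' 0 0 (by simp)).mono_left nhdsWithin_le_nhds
      · filter_upwards [self_mem_nhdsWithin] with r hr
        simpa using hr
    have h3 := ((hκ.tendsto_integral_sq hV hπ hφ hφs).comp hto).sqrt
    rw [Real.sqrt_zero] at h3
    rw [tendsto_iff_norm_sub_tendsto_zero]
    refine h3.congr' ?_
    filter_upwards [self_mem_nhdsWithin] with h hh
    rw [Function.comp_apply, Real.coe_toNNReal _ (le_of_lt hh)]
    refine (Real.sqrt_eq_iff_mul_self_eq (integral_nonneg fun x => sq_nonneg _)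
      (norm_nonneg _)).2 ?_
    rw [← sq, norm_sq_eq_integral]
    refine integral_congr_ae ?_
    filter_upwards [h1, h2, hκ.coeFn_op h.toNNReal z.1, (hκ.stationary h.toNNReal).ae_ae h1,
      Lp.coeFn_sub (h⁻¹ • (hκ.op h.toNNReal z.1 - z.1)) z.2,
      Lp.coeFn_smul h⁻¹ (hκ.op h.toNNReal z.1 - z.1), Lp.coeFn_sub (hκ.op h.toNNReal z.1) z.1]
      with x e1 e2 e3 e4 e5 e6 e7
    rw [e5, Pi.sub_apply, e6, Pi.smul_apply, e7, Pi.sub_apply, e1, e2, e3, integral_congr_ae e4,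
      smul_eq_mul]
  dense_domain := dense_langevinGraph_fst hV
  dense_range := dense_langevinRange hV hπ
  symm _ hz _ hw := langevinGraph_inner_symm hV hπ hz hw

end IsLangevinDiffusion

end LangevinSemigroup

/-! ### Densities and the chi-square divergence -/

section Densities

open Filter Topology Set
open scoped RealInnerProductSpace

variable {X : Type*} {mX : MeasurableSpace X} {μ π : Measure X}

lemma exists_bounded_density [IsFiniteMeasure μ] [IsFiniteMeasure π] {c : ℝ} (hc : 0 < c)
    (h : ENNReal.ofReal c • μ ≤ π) :
    ∃ g : X → ℝ, Measurable g ∧ (∀ x, 0 ≤ g x) ∧ (∀ x, g x ≤ 1 / c) ∧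
      ∀ f : X → ℝ, ∫ x, f x * g x ∂π = ∫ x, f x ∂μ := by
  have hc' : ENNReal.ofReal c ≠ 0 := by simpa using hc
  have hle : ∀ s, μ s ≤ ENNReal.ofReal (1 / c) * π s := by
    intro s
    have h1 : ENNReal.ofReal c * μ s ≤ π s := h s
    rw [one_div, ENNReal.ofReal_inv_of_pos hc, mul_comm, ← div_eq_mul_inv,
      ENNReal.le_div_iff_mul_le (Or.inl hc') (Or.inl ENNReal.ofReal_ne_top), mul_comm]
    exact h1
  have hac : μ ≪ π := by
    refine Measure.AbsolutelyContinuous.mk fun s _ hs => ?_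
    have := hle s
    rwa [hs, mul_zero, nonpos_iff_eq_zero] at this
  have hae : ∀ᵐ x ∂π, μ.rnDeriv π x ≤ ENNReal.ofReal (1 / c) := by
    refine ae_le_of_forall_setLIntegral_le_of_sigmaFinite (Measure.measurable_rnDeriv μ π)
      fun s _ _ => ?_
    rw [setLIntegral_const]
    exact (Measure.setLIntegral_rnDeriv_le s).trans (hle s)
  -- The truncation makes the bound hold everywhere and not just almost everywhere; the semigroup
  -- image of the density is then bounded at every point, under any initial law.
  refine ⟨fun x => min (μ.rnDeriv π x).toReal (1 / c), by fun_prop, fun x => by positivity,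
    fun x => min_le_right _ _, fun f => ?_⟩
  rw [← integral_rnDeriv_smul hac]
  refine integral_congr_ae ?_
  filter_upwards [hae] with x hx
  have h1 : (μ.rnDeriv π x).toReal ≤ 1 / c := ENNReal.toReal_le_of_le_ofReal (by positivity) hx
  rw [min_eq_left h1, smul_eq_mul, mul_comm]

lemma toReal_rnDeriv_ae_eq_of_setIntegral_eq [IsFiniteMeasure μ] [IsFiniteMeasure π] (hac : μ ≪ π)
    {f : X → ℝ} (hf : Integrable f π)
    (h : ∀ s, MeasurableSet s → ∫ x in s, f x ∂π = μ.real s) :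
    (fun x => (μ.rnDeriv π x).toReal) =ᵐ[π] f := by
  refine Integrable.ae_eq_of_forall_setIntegral_eq _ _ Measure.integrable_toReal_rnDeriv hf
    fun s hs _ => ?_
  rw [Measure.setIntegral_toReal_rnDeriv hac, h s hs]

lemma chiSqDiv_eq_of_ae_eq (hac : μ ≪ π) {f : X → ℝ}
    (h : (fun x => (μ.rnDeriv π x).toReal) =ᵐ[π] f) (hf : Integrable (fun x => (f x - 1) ^ 2) π) :
    chiSqDiv μ π = ENNReal.ofReal (∫ x, (f x - 1) ^ 2 ∂π) := by
  rw [chiSqDiv, if_pos hac, ofReal_integral_eq_lintegral_ofReal hf (ae_of_all _ fun x => sq_nonneg _)]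
  refine lintegral_congr_ae ?_
  filter_upwards [h] with x hx
  rw [hx]

lemma absolutelyContinuous_of_chiSqDiv_ne_top (h : chiSqDiv μ π ≠ ∞) : μ ≪ π := by
  by_contra hac
  exact h (if_neg hac)

lemma memLp_rnDeriv_sub_one (h : chiSqDiv μ π ≠ ∞) :
    MemLp (fun x => (μ.rnDeriv π x).toReal - 1) 2 π := by
  have hac := absolutelyContinuous_of_chiSqDiv_ne_top h
  have hm : AEStronglyMeasurable (fun x => (μ.rnDeriv π x).toReal - 1) π :=
    Measurable.aestronglyMeasurable (by fun_prop)
  refine (memLp_two_iff_integrable_sq hm).2 ⟨by fun_prop, ?_⟩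
  rw [chiSqDiv, if_pos hac] at h
  rw [hasFiniteIntegral_iff_ofReal (ae_of_all _ fun x => sq_nonneg _)]
  exact lt_top_iff_ne_top.2 h

lemma integral_rnDeriv_sub_one_sq_le {M : ℝ} (hM : 0 ≤ M) (h : chiSqDiv μ π ≤ ENNReal.ofReal M) :
    ∫ x, ((μ.rnDeriv π x).toReal - 1) ^ 2 ∂π ≤ M := by
  have hne : chiSqDiv μ π ≠ ∞ := ne_top_of_le_ne_top ENNReal.ofReal_ne_top h
  rw [chiSqDiv_eq_of_ae_eq (absolutelyContinuous_of_chiSqDiv_ne_top hne) (ae_eq_refl _)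
    (memLp_rnDeriv_sub_one hne).integrable_sq] at h
  exact (ENNReal.ofReal_le_ofReal_iff hM).1 h

lemma isProbabilityMeasure_uniformMixture {m : ℕ} (hm : m ≠ 0) {ν : Fin m → Measure X}
    (hν : ∀ j, IsProbabilityMeasure (ν j)) : IsProbabilityMeasure (uniformMixture ν) := by
  constructor
  rw [uniformMixture, Measure.smul_apply, Measure.finsetSum_apply]
  simp only [measure_univ, Finset.sum_const, Finset.card_univ, Fintype.card_fin, smul_eq_mul,
    nsmul_eq_mul, mul_one]
  exact ENNReal.inv_mul_cancel (by simpa using hm) (by simp)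

lemma integral_uniformMixture {m : ℕ} {ν : Fin m → Measure X} {f : X → ℝ}
    (hf : ∀ j, Integrable f (ν j)) :
    ∫ x, f x ∂uniformMixture ν = (m : ℝ)⁻¹ * ∑ j, ∫ x, f x ∂ν j := by
  rw [uniformMixture, integral_smul_measure, integral_finsetSum_measure fun j _ => hf j]
  simp

/-- Convexity of the chi-square divergence, for uniform mixtures. -/
lemma chiSqDiv_uniformMixture_le [IsProbabilityMeasure π] {m : ℕ} (hm : m ≠ 0)
    {ν : Fin m → Measure X} (hν : ∀ j, IsProbabilityMeasure (ν j)) {M : ℝ} (hM : 0 ≤ M)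
    (h : ∀ j, chiSqDiv (ν j) π ≤ ENNReal.ofReal M) :
    chiSqDiv (uniformMixture ν) π ≤ ENNReal.ofReal M := by
  have hne : ∀ j, chiSqDiv (ν j) π ≠ ∞ := fun j => ne_top_of_le_ne_top ENNReal.ofReal_ne_top (h j)
  have hac : ∀ j, ν j ≪ π := fun j => absolutelyContinuous_of_chiSqDiv_ne_top (hne j)
  have hprob := isProbabilityMeasure_uniformMixture hm hν
  have hm0 : (0 : ℝ) < m := by exact_mod_cast Nat.pos_of_ne_zero hm
  have hacm : uniformMixture ν ≪ π := by
    refine Measure.AbsolutelyContinuous.mk fun s _ hs => ?_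
    rw [uniformMixture, Measure.smul_apply, Measure.finsetSum_apply]
    simp [fun j => hac j hs]
  have hi : ∀ j, Integrable (fun x => ((ν j).rnDeriv π x).toReal) π :=
    fun j => Measure.integrable_toReal_rnDeriv
  have hd : (fun x => ((uniformMixture ν).rnDeriv π x).toReal) =ᵐ[π]
      fun x => (m : ℝ)⁻¹ * ∑ j, ((ν j).rnDeriv π x).toReal := by
    refine toReal_rnDeriv_ae_eq_of_setIntegral_eq hacm
      ((integrable_finsetSum _ fun j _ => hi j).const_mul _) fun s hs => ?_
    rw [integral_const_mul (m : ℝ)⁻¹, integral_finsetSum _ fun j _ => (hi j).integrableOn]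
    simp_rw [fun j => Measure.setIntegral_toReal_rnDeriv (hac j) s]
    rw [uniformMixture, measureReal_def, Measure.smul_apply, Measure.finsetSum_apply, smul_eq_mul,
      ENNReal.toReal_mul, ENNReal.toReal_sum fun j _ => measure_ne_top _ _]
    simp [measureReal_def]
  have hL : ∀ j, MemLp (fun x => ((ν j).rnDeriv π x).toReal - 1) 2 π := fun j =>
    memLp_rnDeriv_sub_one (hne j)
  have hpt : ∀ x, ((m : ℝ)⁻¹ * ∑ j, ((ν j).rnDeriv π x).toReal - 1) ^ 2 ≤
      (m : ℝ)⁻¹ * ∑ j, (((ν j).rnDeriv π x).toReal - 1) ^ 2 := by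
    intro x
    have h1 := sq_sum_le_card_mul_sum_sq (s := Finset.univ)
      (f := fun j => ((ν j).rnDeriv π x).toReal - 1)
    rw [Finset.card_univ, Fintype.card_fin, Finset.sum_sub_distrib] at h1
    simp only [Finset.sum_const, Finset.card_univ, Fintype.card_fin, nsmul_eq_mul, mul_one] at h1
    have h2 : ((m : ℝ)⁻¹ * ∑ j, ((ν j).rnDeriv π x).toReal - 1) =
        (m : ℝ)⁻¹ * (∑ j, ((ν j).rnDeriv π x).toReal - m) := by
      field_simp
    rw [h2, mul_pow, sq, mul_assoc]
    refine mul_le_mul_of_nonneg_left ?_ (by positivity)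
    rw [inv_mul_le_iff₀ hm0]
    exact h1
  have hsum : Integrable (fun x => (m : ℝ)⁻¹ * ∑ j, (((ν j).rnDeriv π x).toReal - 1) ^ 2) π :=
    (integrable_finsetSum _ fun j _ => (hL j).integrable_sq).const_mul _
  have hsq : Integrable (fun x => ((m : ℝ)⁻¹ * ∑ j, ((ν j).rnDeriv π x).toReal - 1) ^ 2) π := by
    refine hsum.mono' (Measurable.aestronglyMeasurable (by fun_prop)) (ae_of_all _ fun x => ?_)
    rw [Real.norm_of_nonneg (sq_nonneg _)]
    exact hpt x
  rw [chiSqDiv_eq_of_ae_eq hacm hd hsq]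
  refine ENNReal.ofReal_le_ofReal ((integral_mono hsq hsum hpt).trans ?_)
  rw [integral_const_mul (m : ℝ)⁻¹, integral_finsetSum _ fun j _ => (hL j).integrable_sq,
    inv_mul_le_iff₀ hm0]
  refine (Finset.sum_le_sum fun j _ => integral_rnDeriv_sub_one_sq_le hM (h j)).trans_eq ?_
  simp

end Densities

/-! ### Decay of the chi-square divergence along the Langevin diffusion of a mixture -/

section ChiSqDecay

open Filter Topology Set
open scoped RealInnerProductSpace

variable {N : ℕ} {V : EuclideanSpace ℝ (Fin N) → ℝ} {π : Measure (EuclideanSpace ℝ (Fin N))}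

lemma integral_mixture {X : Type*} {mX : MeasurableSpace X} {π : Measure X} {K : ℕ} {p : Fin K → ℝ}
    {πc : Fin K → Measure X} (hp : ∀ i, 0 ≤ p i) (hmix : π = ∑ i, ENNReal.ofReal (p i) • πc i)
    {f : X → ℝ} (hf : ∀ i, Integrable f (πc i)) :
    ∫ x, f x ∂π = ∑ i, p i * ∫ x, f x ∂πc i := by
  rw [hmix, integral_finsetSum_measure fun i _ => (hf i).smul_measure ENNReal.ofReal_ne_top]
  refine Finset.sum_congr rfl fun i _ => ?_
  rw [integral_smul_measure, ENNReal.toReal_ofReal (hp i), smul_eq_mul]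

/-- The Poincaré inequality of the components, as an energy estimate for the mixture. -/
lemma mixture_energy_le [IsProbabilityMeasure π] (hV : ContDiff ℝ 1 V)
    (hπ : π = (volume : Measure (EuclideanSpace ℝ (Fin N))).tilted (fun x => -V x))
    {K : ℕ} {p : Fin K → ℝ} {πc : Fin K → Measure (EuclideanSpace ℝ (Fin N))}
    (hprob : ∀ i, IsProbabilityMeasure (πc i)) (hp : ∀ i, 0 ≤ p i)
    (hmix : π = ∑ i, ENNReal.ofReal (p i) • πc i) {C : ℝ} (hC : ∀ i, PoincareInequality (πc i) C)
    {g : Fin K → EuclideanSpace ℝ (Fin N) → ℝ}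
    (hg : ∀ i (f : EuclideanSpace ℝ (Fin N) → ℝ), ∫ x, f x * g i x ∂π = ∫ x, f x ∂πc i)
    {G : Fin K → Lp ℝ 2 π} (hG : ∀ i, G i =ᵐ[π] g i)
    {z : Lp ℝ 2 π × Lp ℝ 2 π} (hz : z ∈ langevinGraph V π) :
    C * (‖z.1‖ ^ 2 - ∑ i, p i * ⟪z.1, G i⟫ ^ 2) ≤ -⟪z.2, z.1⟫ := by
  obtain ⟨φ, hφ, hφs, h1, h2⟩ := hz
  have hφ1 : ContDiff ℝ 1 φ := hφ.of_le (by simp)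
  rw [langevinGraph_inner_self hV hπ hφ hφs h1 h2]
  have hLp : ∀ i, MemLp φ 2 (πc i) := fun i =>
    memLp_of_continuous_of_hasCompactSupport hφ.continuous hφs
  have hgi : ∀ i, Integrable (fun x => ‖gradient φ x‖ ^ 2) (πc i) := by
    intro i
    have hc : HasCompactSupport fun x => ‖gradient φ x‖ ^ 2 := by
      refine hφs.of_isClosed_subset (isClosed_tsupport _) (closure_minimal (fun x hx => ?_)
        (isClosed_tsupport _))
      by_contra hxt
      refine hx ?_
      simp only [norm_gradient_sq]
      refine Finset.sum_eq_zero fun j _ => ?_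
      rw [image_eq_zero_of_notMem_tsupport fun hh => hxt (tsupport_pderiv_subset j φ hh)]
      norm_num
    exact (((continuous_gradient hφ1).norm.pow 2).integrable_of_hasCompactSupport hc)
  have e1 : ‖z.1‖ ^ 2 = ∑ i, p i * ∫ x, φ x ^ 2 ∂πc i := by
    rw [norm_sq_eq_integral, ← integral_mixture hp hmix fun i => (hLp i).integrable_sq]
    refine integral_congr_ae ?_
    filter_upwards [h1] with x hx
    rw [hx]
  have e2 : ∀ i, ⟪z.1, G i⟫ = ∫ x, φ x ∂πc i := fun i => by
    rw [inner_eq_integral, ← hg]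
    exact integral_congr_ae (h1.mul (hG i))
  -- Pairing with G i gives the mean under the i-th component, so the left side is C times the
  -- weighted sum of the variances within the components.
  rw [integral_mixture hp hmix hgi, e1, ← Finset.sum_sub_distrib, Finset.mul_sum]
  refine Finset.sum_le_sum fun i _ => ?_
  rw [e2, ← mul_sub, mul_left_comm]
  refine mul_le_mul_of_nonneg_left ?_ (hp i)
  have := hC i φ hφ hφs
  rw [variance_eq_sub (hLp i)] at this
  exact this

lemma IsLangevinDiffusion.comp_absolutelyContinuous
    {κ : ℝ≥0 → Kernel (EuclideanSpace ℝ (Fin N)) (EuclideanSpace ℝ (Fin N))}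
    (hκ : IsLangevinDiffusion V π κ) (T : ℝ≥0)
    {ν : Measure (EuclideanSpace ℝ (Fin N))} (hac : ν ≪ π) : κ T ∘ₘ ν ≪ π := by
  conv_rhs => rw [← (hκ.stationary T).def]
  exact Measure.AbsolutelyContinuous.comp_right hac (κ T)

namespace IsLangevinDiffusion

variable {κ : ℝ≥0 → Kernel (EuclideanSpace ℝ (Fin N)) (EuclideanSpace ℝ (Fin N))}
  [IsProbabilityMeasure π]

lemma inner_op (hκ : IsLangevinDiffusion V π κ) (hV : ContDiff ℝ 1 V)
    (hπ : π = (volume : Measure (EuclideanSpace ℝ (Fin N))).tilted (fun x => -V x))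
    (T : ℝ≥0) (x y : Lp ℝ 2 π) : ⟪hκ.op T x, y⟫ = ⟪x, hκ.op T y⟫ := by
  have := (hκ.contractionSemigroup hV hπ).inner_apply T.coe_nonneg x y
  rwa [Real.toNNReal_coe] at this

/-- Reversibility: the evolved law is dual to the semigroup acting on functions, so self-adjointness
lets P_T act on the initial density instead. The identity is tested on indicators. -/
lemma toReal_rnDeriv_comp (hκ : IsLangevinDiffusion V π κ) (hV : ContDiff ℝ 1 V)
    (hπ : π = (volume : Measure (EuclideanSpace ℝ (Fin N))).tilted (fun x => -V x))
    (T : ℝ≥0) {ν : Measure (EuclideanSpace ℝ (Fin N))} [IsProbabilityMeasure ν]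
    (hac : ν ≪ π) {F : Lp ℝ 2 π} (hF : F =ᵐ[π] fun x => (ν.rnDeriv π x).toReal - 1) :
    (fun x => ((κ T ∘ₘ ν).rnDeriv π x).toReal) =ᵐ[π] fun x => hκ.op T F x + 1 := by
  have := hκ.markov T
  have : ν.HaveLebesgueDecomposition π := Measure.haveLebesgueDecomposition_of_sigmaFinite ν π
  refine toReal_rnDeriv_ae_eq_of_setIntegral_eq (hκ.comp_absolutelyContinuous T hac)
    (((Lp.memLp _).integrable (by norm_num)).add (integrable_const _)) fun s hs => ?_
  have hI : Integrable (hκ.op T F) π := (Lp.memLp _).integrable (by norm_num)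
  set I : Lp ℝ 2 π := indicatorConstLp 2 hs (measure_ne_top π s) 1 with hIdef
  have e1 : ∫ x in s, hκ.op T F x ∂π = ⟪F, hκ.op T I⟫ := by
    rw [← hκ.inner_op hV hπ, real_inner_comm, hIdef, L2.inner_indicatorConstLp_one]
  have hIi : Integrable I π := (Lp.memLp _).integrable (by norm_num)
  have hQm : Measurable fun x => (κ T x).real s := (Kernel.measurable_coe (κ T) hs).ennreal_toReal
  have hQb : ∀ x, |(κ T x).real s| ≤ 1 := fun x => by
    rw [abs_of_nonneg measureReal_nonneg]
    exact measureReal_le_one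
  have hopI : hκ.op T I =ᵐ[π] fun x => (κ T x).real s := by
    filter_upwards [hκ.coeFn_op T I, (hκ.stationary T).ae_ae (indicatorConstLp_coeFn (p := 2)
      (hs := hs) (hμs := measure_ne_top π s) (c := (1 : ℝ)))] with x e2 e3
    rw [e2, integral_congr_ae e3, integral_indicator_const _ hs, smul_eq_mul, mul_one]
  have hν : ∀ {μ : Measure (EuclideanSpace ℝ (Fin N))} [IsProbabilityMeasure μ],
      ∫ x, (κ T x).real s ∂μ = (κ T ∘ₘ μ).real s := by
    intro μ _
    rw [measureReal_def, Measure.bind_apply hs (κ T).aemeasurable]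
    exact integral_toReal (Kernel.measurable_coe (κ T) hs).aemeasurable
      (ae_of_all _ fun x => measure_lt_top _ _)
  have e2 : ⟪F, hκ.op T I⟫ = (κ T ∘ₘ ν).real s - π.real s := by
    have e3 : ∫ x, F x * hκ.op T I x ∂π =
        ∫ x, ((ν.rnDeriv π x).toReal • (κ T x).real s - (κ T x).real s) ∂π := by
      refine integral_congr_ae ?_
      filter_upwards [hF, hopI] with x h1 h2
      rw [h1, h2, smul_eq_mul]
      ring
    have hi1 : Integrable (fun x => (ν.rnDeriv π x).toReal • (κ T x).real s) π :=
      (integrable_rnDeriv_smul_iff hac).2 (integrable_of_measurable_of_abs_le hQm hQb)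
    rw [inner_eq_integral, e3, integral_sub hi1 (integrable_of_measurable_of_abs_le hQm hQb),
      integral_rnDeriv_smul hac, hν, hν, (hκ.stationary T).def]
  rw [integral_add hI.integrableOn (integrable_const _), e1, e2]
  simp

/-- Decay of the chi-square divergence, up to the imbalance between the components at the final
time. -/
theorem chiSqDiv_comp_le (hκ : IsLangevinDiffusion V π κ) (hV : ContDiff ℝ 1 V)
    (hπ : π = (volume : Measure (EuclideanSpace ℝ (Fin N))).tilted (fun x => -V x))
    {K : ℕ} {p : Fin K → ℝ} {πc : Fin K → Measure (EuclideanSpace ℝ (Fin N))}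
    (hprob : ∀ i, IsProbabilityMeasure (πc i)) (hp : ∀ i, 0 ≤ p i)
    (hmix : π = ∑ i, ENNReal.ofReal (p i) • πc i) {C : ℝ} (hC0 : 0 ≤ C)
    (hC : ∀ i, PoincareInequality (πc i) C)
    {g : Fin K → EuclideanSpace ℝ (Fin N) → ℝ} (hgm : ∀ i, Measurable (g i)) {A : Fin K → ℝ}
    (hgA : ∀ i x, |g i x| ≤ A i)
    (hg : ∀ i (f : EuclideanSpace ℝ (Fin N) → ℝ), ∫ x, f x * g i x ∂π = ∫ x, f x ∂πc i)
    {ν : Measure (EuclideanSpace ℝ (Fin N))} [IsProbabilityMeasure ν] {M : ℝ} (hM : 0 ≤ M)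
    (hν : chiSqDiv ν π ≤ ENNReal.ofReal M) (T : ℝ≥0) :
    chiSqDiv (κ T ∘ₘ ν) π ≤ ENNReal.ofReal (max
      (2 * ∑ i, p i * (∫ x, ∫ y, g i y ∂κ T x ∂ν - 1) ^ 2) (Real.exp (-(C * T)) * M)) := by
  have := hκ.markov T
  have : (κ T ∘ₘ ν).HaveLebesgueDecomposition π :=
    Measure.haveLebesgueDecomposition_of_sigmaFinite _ π
  have hne : chiSqDiv ν π ≠ ∞ := ne_top_of_le_ne_top ENNReal.ofReal_ne_top hν
  have hac := absolutelyContinuous_of_chiSqDiv_ne_top hne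
  have hac' := hκ.comp_absolutelyContinuous T hac
  have hgLp : ∀ i, MemLp (g i) 2 π := fun i =>
    MemLp.of_bound (hgm i).aestronglyMeasurable (A i) (ae_of_all _ (hgA i))
  set G : Fin K → Lp ℝ 2 π := fun i => (hgLp i).toLp with hGdef
  have hG : ∀ i, G i =ᵐ[π] g i := fun i => (hgLp i).coeFn_toLp
  set F : Lp ℝ 2 π := (memLp_rnDeriv_sub_one hne).toLp with hFdef
  have hF : F =ᵐ[π] fun x => (ν.rnDeriv π x).toReal - 1 := (memLp_rnDeriv_sub_one hne).coeFn_toLp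
  have hd := hκ.toReal_rnDeriv_comp hV hπ T hac hF
  have hFM : ‖F‖ ^ 2 ≤ M := by
    rw [norm_sq_eq_integral]
    refine le_of_eq_of_le (integral_congr_ae ?_) (integral_rnDeriv_sub_one_sq_le hM hν)
    filter_upwards [hF] with x hx
    rw [hx]
  -- The imbalance at time T becomes linear in the initial law ν, so it can be averaged over the
  -- independent samples.
  have hinner : ∀ i, ⟪hκ.op T F, G i⟫ = ∫ x, ∫ y, g i y ∂κ T x ∂ν - 1 := by
    intro i
    have hgi : ∀ {μ : Measure (EuclideanSpace ℝ (Fin N))} [IsProbabilityMeasure μ],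
      Integrable (g i) μ := fun {μ} _ => integrable_of_measurable_of_abs_le (hgm i) (hgA i)
    have h1 : ∫ x, hκ.op T F x * G i x ∂π =
        ∫ x, (((κ T ∘ₘ ν).rnDeriv π x).toReal • g i x - 1 * g i x) ∂π := by
      refine integral_congr_ae ?_
      filter_upwards [hd, hG i] with x h2 h3
      rw [h2, h3, smul_eq_mul]
      ring
    have h4 : Integrable (fun x => ((κ T ∘ₘ ν).rnDeriv π x).toReal • g i x) π :=
      (integrable_rnDeriv_smul_iff hac').2 hgi
    rw [inner_eq_integral, h1, integral_sub h4 (hgi.const_mul _), integral_rnDeriv_smul hac',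
      hg i fun _ => 1, Measure.integral_comp_measure hgi]
    simp
  have hsq : ∫ x, (hκ.op T F x + 1 - 1) ^ 2 ∂π = ‖hκ.op T F‖ ^ 2 := by
    simp only [add_sub_cancel_right]
    rw [norm_sq_eq_integral]
  rw [chiSqDiv_eq_of_ae_eq hac' hd (by
    simp only [add_sub_cancel_right]
    exact (Lp.memLp _).integrable_sq), hsq]
  refine ENNReal.ofReal_le_ofReal ?_
  have hkey := (hκ.contractionSemigroup hV hπ).norm_sq_apply_le
    (q := fun x => ∑ i, p i * ⟪x, G i⟫ ^ 2) T.coe_nonneg hC0 (by fun_prop)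
    (fun z hz => mixture_energy_le hV hπ hprob hp hmix hC hg hG hz) F
  simp only [Real.toNNReal_coe, hinner] at hkey
  exact hkey.trans (max_le_max le_rfl (mul_le_mul_of_nonneg_left hFM (Real.exp_pos _).le))

end IsLangevinDiffusion

end ChiSqDecay

/-! ### Concentration of weighted empirical averages -/

section Concentration

open Filter Topology Set

/-- The power series of cosh has only even terms, with nonnegative coefficients, so Jensen's
inequality for x ↦ xⁿ applies term by term. It reduces the weighted square sum to single
coordinates, without a union bound and hence without a factor K. -/
lemma cosh_mul_sqrt_le {ι : Type*} {s : Finset ι} {p d : ι → ℝ} (hp : ∀ i ∈ s, 0 ≤ p i)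
    (hsum : ∑ i ∈ s, p i = 1) (θ : ℝ) :
    Real.cosh (θ * √(∑ i ∈ s, p i * d i ^ 2)) ≤ ∑ i ∈ s, p i * Real.cosh (θ * d i) := by
  have h0 : 0 ≤ ∑ i ∈ s, p i * d i ^ 2 := Finset.sum_nonneg fun i hi =>
    mul_nonneg (hp i hi) (sq_nonneg _)
  refine hasSum_le (fun n => ?_) (Real.hasSum_cosh _)
    (hasSum_sum fun i _ => (Real.hasSum_cosh (θ * d i)).mul_left (p i))
  have h1 := Real.pow_arith_mean_le_arith_mean_pow s p (fun i => d i ^ 2) hp hsum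
    (fun i _ => sq_nonneg _) n
  have h2 : (0 : ℝ) ≤ θ ^ (2 * n) / (2 * n).factorial := by
    rw [pow_mul]
    positivity
  calc (θ * √(∑ i ∈ s, p i * d i ^ 2)) ^ (2 * n) / (2 * n).factorial
      = θ ^ (2 * n) / (2 * n).factorial * (∑ i ∈ s, p i * d i ^ 2) ^ n := by
        rw [mul_pow, pow_mul (√_), Real.sq_sqrt h0]
        ring
    _ ≤ θ ^ (2 * n) / (2 * n).factorial * ∑ i ∈ s, p i * (d i ^ 2) ^ n :=
        mul_le_mul_of_nonneg_left h1 h2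
    _ = _ := by
        rw [Finset.mul_sum]
        refine Finset.sum_congr rfl fun i _ => ?_
        rw [mul_pow, ← pow_mul]
        ring

variable {Ω : Type*} {mΩ : MeasurableSpace Ω} {P : Measure Ω} [IsProbabilityMeasure P]

lemma integrable_exp_mul_of_abs_le {X : Ω → ℝ} (hX : AEMeasurable X P) {b : ℝ}
    (hb : ∀ᵐ ω ∂P, |X ω| ≤ b) (t : ℝ) : Integrable (fun ω => Real.exp (t * X ω)) P := by
  refine Integrable.of_bound (Real.measurable_exp.comp_aemeasurable
    (hX.const_mul t)).aestronglyMeasurable (Real.exp (|t| * b)) ?_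
  filter_upwards [hb] with ω hω
  rw [Real.norm_of_nonneg (Real.exp_pos _).le, Real.exp_le_exp]
  refine (le_abs_self _).trans ?_
  rw [abs_mul]
  exact mul_le_mul_of_nonneg_left hω (abs_nonneg t)

/-- Bernstein-type bound from eˣ ≤ 1 + x + x² for |x| ≤ 1. Using b also for the second moment,
rather than b², is what makes the sample size scale like 1/p_*. -/
lemma mgf_le_exp_of_abs_le {X : Ω → ℝ} (hX : AEMeasurable X P) {b : ℝ}
    (hb : ∀ᵐ ω ∂P, |X ω| ≤ b) (h1 : ∫ ω, X ω ∂P = 0) (h2 : ∫ ω, X ω ^ 2 ∂P ≤ b) {t : ℝ}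
    (ht : |t| * b ≤ 1) : mgf X P t ≤ Real.exp (t ^ 2 * b) := by
  have hi : Integrable X P := Integrable.of_bound hX.aestronglyMeasurable b hb
  have hi2 : Integrable (fun ω => X ω ^ 2) P := by
    refine Integrable.of_bound (hX.pow_const 2).aestronglyMeasurable (b ^ 2) ?_
    filter_upwards [hb] with ω hω
    rw [norm_pow, Real.norm_eq_abs]
    gcongr
  have hle : mgf X P t ≤ ∫ ω, (1 + t * X ω + t ^ 2 * X ω ^ 2) ∂P := by
    refine integral_mono_ae (integrable_exp_mul_of_abs_le hX hb t)
      (((integrable_const 1).add (hi.const_mul t)).add (hi2.const_mul (t ^ 2))) ?_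
    filter_upwards [hb] with ω hω
    have h3 : |t * X ω| ≤ 1 := by
      rw [abs_mul]
      exact (mul_le_mul_of_nonneg_left hω (abs_nonneg t)).trans ht
    have h4 := (abs_le.1 (Real.abs_exp_sub_one_sub_id_le h3)).2
    rw [mul_pow] at h4
    linarith
  have hi1 : Integrable (fun ω => 1 + t * X ω) P := (integrable_const 1).add (hi.const_mul t)
  rw [integral_add hi1 (hi2.const_mul _), integral_add (integrable_const _)
    (hi.const_mul t), integral_const_mul t, integral_const_mul (t ^ 2), h1] at hle
  simp only [integral_const, probReal_univ, smul_eq_mul, mul_one, mul_zero, add_zero] at hle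
  have h5 : t ^ 2 * ∫ ω, X ω ^ 2 ∂P ≤ t ^ 2 * b := mul_le_mul_of_nonneg_left h2 (sq_nonneg t)
  linarith [Real.add_one_le_exp (t ^ 2 * b)]

variable {m : ℕ}

/-- The left side is half the sum of the moment generating functions of Σ X_j at ±θ/m, and both
factor by independence. -/
lemma integral_cosh_average_le (hm : m ≠ 0) {X : Fin m → Ω → ℝ} (hind : iIndepFun X P)
    (hX : ∀ j, AEMeasurable (X j) P) {b : ℝ} (hb : ∀ j, ∀ᵐ ω ∂P, |X j ω| ≤ b)
    (h1 : ∀ j, ∫ ω, X j ω ∂P = 0) (h2 : ∀ j, ∫ ω, X j ω ^ 2 ∂P ≤ b) {θ : ℝ} (hθ0 : 0 ≤ θ)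
    (hθ : θ * b ≤ m) :
    Integrable (fun ω => Real.cosh (θ * ((m : ℝ)⁻¹ * ∑ j, X j ω))) P ∧
    ∫ ω, Real.cosh (θ * ((m : ℝ)⁻¹ * ∑ j, X j ω)) ∂P ≤ Real.exp (θ ^ 2 * b / m) := by
  have hm0 : (0 : ℝ) < m := by exact_mod_cast Nat.pos_of_ne_zero hm
  have hSb : ∀ᵐ ω ∂P, |(∑ j, X j) ω| ≤ m * b := by
    filter_upwards [ae_all_iff.2 hb] with ω hω
    rw [Finset.sum_apply]
    refine (Finset.abs_sum_le_sum_abs _ _).trans ((Finset.sum_le_sum fun j _ => hω j).trans_eq ?_)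
    simp
  have hS : AEMeasurable (∑ j, X j) P := Finset.aemeasurable_sum _ fun j _ => hX j
  have key : ∀ t, |t| = θ / m → mgf (∑ j, X j) P t ≤ Real.exp (θ ^ 2 * b / m) := by
    intro t ht
    rw [hind.mgf_sum₀ hX]
    have h3 : |t| * b ≤ 1 := by
      rw [ht, div_mul_eq_mul_div, div_le_one hm0]
      exact hθ
    refine (Finset.prod_le_prod (fun j _ => mgf_nonneg) fun j _ =>
      mgf_le_exp_of_abs_le (hX j) (hb j) (h1 j) (h2 j) h3).trans_eq ?_
    rw [Finset.prod_const, Finset.card_univ, Fintype.card_fin, ← Real.exp_nat_mul, ← sq_abs, ht]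
    congr 1
    field_simp
  have hI := fun t => integrable_exp_mul_of_abs_le hS hSb t
  have e : ∀ ω, Real.cosh (θ * ((m : ℝ)⁻¹ * ∑ j, X j ω)) =
      1 / 2 * Real.exp (θ / m * (∑ j, X j) ω) + 1 / 2 * Real.exp (-(θ / m) * (∑ j, X j) ω) := by
    intro ω
    rw [Real.cosh_eq, Finset.sum_apply]
    have e1 : θ * ((m : ℝ)⁻¹ * ∑ j, X j ω) = θ / m * ∑ j, X j ω := by ring
    rw [e1, neg_mul]
    ring
  have hpos : 0 ≤ θ / m := div_nonneg hθ0 hm0.le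
  have k1 := key (θ / m) (abs_of_nonneg hpos)
  have k2 := key (-(θ / m)) (by rw [abs_neg, abs_of_nonneg hpos])
  simp_rw [e]
  refine ⟨((hI _).const_mul _).add ((hI _).const_mul _), ?_⟩
  rw [integral_add ((hI _).const_mul _) ((hI _).const_mul _), integral_const_mul (1 / 2 : ℝ),
    integral_const_mul (1 / 2 : ℝ)]
  simp only [mgf] at k1 k2
  linarith

/-- Exponential tail bound for the weighted squared deviation of empirical averages. -/
theorem measureReal_lt_weighted_deviation_le {K : ℕ} (hm : m ≠ 0) {p : Fin K → ℝ}
    (hp : ∀ i, 0 ≤ p i) (hsum : ∑ i, p i = 1) {X : Fin m → Fin K → Ω → ℝ}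
    (hind : ∀ i, iIndepFun (fun j => X j i) P) (hX : ∀ j i, AEMeasurable (X j i) P) {b : ℝ}
    (hb1 : 1 ≤ b)
    (hb : ∀ j i, ∀ᵐ ω ∂P, |X j i ω| ≤ b) (h1 : ∀ j i, ∫ ω, X j i ω ∂P = 0)
    (h2 : ∀ j i, ∫ ω, X j i ω ^ 2 ∂P ≤ b) {ε : ℝ} (hε : 0 < ε) (hε1 : ε < 1) :
    P.real {ω | ε / 2 < ∑ i, p i * ((m : ℝ)⁻¹ * ∑ j, X j i ω) ^ 2} ≤
      2 * Real.exp (-(m * ε / (8 * b))) := by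
  have hm0 : (0 : ℝ) < m := by exact_mod_cast Nat.pos_of_ne_zero hm
  have hb0 : 0 < b := zero_lt_one.trans_le hb1
  set r : ℝ := √(ε / 2) with hr
  have hr0 : 0 ≤ r := Real.sqrt_nonneg _
  have hrr : r ^ 2 = ε / 2 := Real.sq_sqrt (by linarith)
  have hr1 : r ≤ 1 := by
    rw [hr, Real.sqrt_le_left (by norm_num)]
    linarith
  -- This minimises θ²b/m − θr, with value −mr²/(4b) = −mε/(8b). The condition θb ≤ m holds because
  -- r ≤ 1.
  set θ : ℝ := m * r / (2 * b) with hθ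
  have hθ0 : 0 ≤ θ := by positivity
  have hθb : θ * b ≤ m := by
    have : θ * b = m * (r / 2) := by
      rw [hθ]
      field_simp
    rw [this]
    exact mul_le_of_le_one_right hm0.le (by linarith)
  have hco := fun i => integral_cosh_average_le hm (hind i) (fun j => hX j i) (fun j => hb j i)
    (fun j => h1 j i) (fun j => h2 j i) hθ0 hθb
  set W : Ω → ℝ := fun ω => ∑ i, p i * Real.cosh (θ * ((m : ℝ)⁻¹ * ∑ j, X j i ω)) with hW
  have hWi : Integrable W P := integrable_finsetSum _ fun i _ => (hco i).1.const_mul (p i)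
  have hWE : ∫ ω, W ω ∂P ≤ Real.exp (θ ^ 2 * b / m) := by
    rw [hW, integral_finsetSum _ fun i _ => (hco i).1.const_mul (p i)]
    calc _ ≤ ∑ i, p i * Real.exp (θ ^ 2 * b / m) := by
          refine Finset.sum_le_sum fun i _ => ?_
          rw [integral_const_mul (p i)]
          exact mul_le_mul_of_nonneg_left (hco i).2 (hp i)
      _ = _ := by rw [← Finset.sum_mul, hsum, one_mul]
  have hsub : {ω | ε / 2 < ∑ i, p i * ((m : ℝ)⁻¹ * ∑ j, X j i ω) ^ 2} ⊆
      {ω | Real.exp (θ * r) / 2 ≤ W ω} := by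
    intro ω hω
    have hω' : ε / 2 < ∑ i, p i * ((m : ℝ)⁻¹ * ∑ j, X j i ω) ^ 2 := hω
    have h3 : r ≤ √(∑ i, p i * ((m : ℝ)⁻¹ * ∑ j, X j i ω) ^ 2) := Real.sqrt_le_sqrt hω'.le
    have h4 := cosh_mul_sqrt_le (s := Finset.univ) (d := fun i => (m : ℝ)⁻¹ * ∑ j, X j i ω)
      (fun i _ => hp i) hsum θ
    change Real.exp (θ * r) / 2 ≤ W ω
    refine le_trans ?_ h4
    rw [Real.cosh_eq]
    have h5 : Real.exp (θ * r) ≤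
        Real.exp (θ * √(∑ i, p i * ((m : ℝ)⁻¹ * ∑ j, X j i ω) ^ 2)) :=
      Real.exp_le_exp.2 (mul_le_mul_of_nonneg_left h3 hθ0)
    have h6 := Real.exp_pos (-(θ * √(∑ i, p i * ((m : ℝ)⁻¹ * ∑ j, X j i ω) ^ 2)))
    linarith
  have hmarkov := mul_meas_ge_le_integral_of_nonneg (μ := P) (ae_of_all _ fun ω =>
    Finset.sum_nonneg fun i _ => mul_nonneg (hp i) (Real.cosh_pos _).le) hWi
    (Real.exp (θ * r) / 2)
  have h7 : Real.exp (θ * r) / 2 * P.real {ω | ε / 2 < ∑ i, p i * ((m : ℝ)⁻¹ * ∑ j, X j i ω) ^ 2} ≤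
      Real.exp (θ ^ 2 * b / m) :=
    (mul_le_mul_of_nonneg_left (measureReal_mono hsub) (by positivity)).trans (hmarkov.trans hWE)
  have h8 : -(m * ε / (8 * b)) = θ ^ 2 * b / m - θ * r := by
    have h9 : ε = 2 * r ^ 2 := by linarith
    rw [h9, hθ]
    field_simp
    ring
  rw [h8, Real.exp_sub, ← mul_div_assoc, le_div_iff₀ (Real.exp_pos _)]
  linarith

end Concentration

/-! ### Mixtures of random measures -/

section RandomMeasure

open Filter Topology Set

variable {X : Type*} {mX : MeasurableSpace X}

/-- The deviation of the mean of `u` under `μ` from `1`. -/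
noncomputable def meanDeviation (u : X → ℝ) (μ : Measure X) : ℝ :=
  (∫⁻ x, ENNReal.ofReal (u x) ∂μ).toReal - 1

/-- Measurability on the whole space of measures transfers independence and equality in law from the
random measures to real random variables. -/
lemma measurable_meanDeviation {u : X → ℝ} (hu : Measurable u) :
    Measurable (fun μ : Measure X => meanDeviation u μ) :=
  (Measure.measurable_lintegral hu.ennreal_ofReal).ennreal_toReal.sub_const 1

lemma meanDeviation_eq {u : X → ℝ} (hu : Measurable u) (hu0 : ∀ x, 0 ≤ u x) (μ : Measure X) :
    meanDeviation u μ = ∫ x, u x ∂μ - 1 := by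
  rw [meanDeviation, integral_eq_lintegral_of_nonneg_ae (ae_of_all _ hu0) hu.aestronglyMeasurable]

lemma integral_mem_Icc {u : X → ℝ} (hu : Measurable u) (hu0 : ∀ x, 0 ≤ u x) {b : ℝ}
    (hub : ∀ x, u x ≤ b) (μ : Measure X) [IsProbabilityMeasure μ] :
    ∫ x, u x ∂μ ∈ Icc 0 b := by
  refine ⟨integral_nonneg hu0, ?_⟩
  have h : Integrable u μ := integrable_of_measurable_of_abs_le hu fun x => by
    rw [abs_of_nonneg (hu0 x)]
    exact hub x
  simpa using integral_mono h (integrable_const b) hub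

lemma abs_meanDeviation_le {u : X → ℝ} (hu : Measurable u) (hu0 : ∀ x, 0 ≤ u x) {b : ℝ}
    (hb : 1 ≤ b) (hub : ∀ x, u x ≤ b) (μ : Measure X) [IsProbabilityMeasure μ] :
    |meanDeviation u μ| ≤ b := by
  obtain ⟨h1, h2⟩ := integral_mem_Icc hu hu0 hub μ
  rw [meanDeviation_eq hu hu0, abs_le]
  constructor <;> linarith

lemma measurableSet_isProbabilityMeasure :
    MeasurableSet {μ : Measure X | IsProbabilityMeasure μ} := by
  simp_rw [isProbabilityMeasure_iff]
  exact Measure.measurable_coe MeasurableSet.univ (measurableSet_singleton 1)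

variable {Ω₀ : Type*} {mΩ₀ : MeasurableSpace Ω₀} {P₀ : Measure Ω₀} [IsProbabilityMeasure P₀]
  {ν₀ : Ω₀ → Measure X} {π : Measure X} {u : X → ℝ} {b : ℝ}

lemma integral_meanDeviation (hm : AEMeasurable ν₀ P₀) (hν₀ : ∀ ω, IsProbabilityMeasure (ν₀ ω))
    (hmean : ∀ A, MeasurableSet A → ∫⁻ ω, ν₀ ω A ∂P₀ = π A) (hu : Measurable u)
    (hu0 : ∀ x, 0 ≤ u x) (hub : ∀ x, u x ≤ b) (h1 : ∫ x, u x ∂π = 1) :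
    ∫ ω, meanDeviation u (ν₀ ω) ∂P₀ = 0 := by
  have hπ : P₀.bind ν₀ = π := Measure.ext fun A hA => by rw [Measure.bind_apply hA hm, hmean A hA]
  have hlm : AEMeasurable (fun ω => ∫⁻ x, ENNReal.ofReal (u x) ∂ν₀ ω) P₀ :=
    (Measure.measurable_lintegral hu.ennreal_ofReal).comp_aemeasurable hm
  have hfin : ∀ ω, ∫⁻ x, ENNReal.ofReal (u x) ∂ν₀ ω < ∞ := fun ω => by
    have := hν₀ ω
    refine (lintegral_mono fun x => ENNReal.ofReal_le_ofReal (hub x)).trans_lt ?_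
    simp
  have hlb : ∀ ω, (∫⁻ x, ENNReal.ofReal (u x) ∂ν₀ ω).toReal ∈ Icc 0 b := fun ω => by
    have := hν₀ ω
    rw [← integral_eq_lintegral_of_nonneg_ae (ae_of_all _ hu0) hu.aestronglyMeasurable]
    exact integral_mem_Icc hu hu0 hub _
  have hi : Integrable (fun ω => (∫⁻ x, ENNReal.ofReal (u x) ∂ν₀ ω).toReal) P₀ :=
    Integrable.of_bound hlm.ennreal_toReal.aestronglyMeasurable b (ae_of_all _ fun ω => by
      rw [Real.norm_of_nonneg (hlb ω).1]
      exact (hlb ω).2)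
  have h2 : ∫ ω, (∫⁻ x, ENNReal.ofReal (u x) ∂ν₀ ω).toReal ∂P₀ = 1 := by
    rw [integral_toReal hlm (ae_of_all _ hfin),
      ← Measure.lintegral_bind hm hu.ennreal_ofReal.aemeasurable, hπ, ← h1,
      integral_eq_lintegral_of_nonneg_ae (ae_of_all _ hu0) hu.aestronglyMeasurable]
  simp only [meanDeviation]
  rw [integral_sub hi (integrable_const _), h2]
  simp

/-- For x in [0, b], the parabola (x − 1)² lies below its chord (b − 1) + (b − 2)(x − 1). The
deviation has mean zero, so its second moment is at most b − 1. -/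
lemma integral_meanDeviation_sq_le (hm : AEMeasurable ν₀ P₀)
    (hν₀ : ∀ ω, IsProbabilityMeasure (ν₀ ω))
    (hmean : ∀ A, MeasurableSet A → ∫⁻ ω, ν₀ ω A ∂P₀ = π A) (hu : Measurable u)
    (hu0 : ∀ x, 0 ≤ u x) (hb : 1 ≤ b) (hub : ∀ x, u x ≤ b) (h1 : ∫ x, u x ∂π = 1) :
    ∫ ω, meanDeviation u (ν₀ ω) ^ 2 ∂P₀ ≤ b := by
  have hd : AEMeasurable (fun ω => meanDeviation u (ν₀ ω)) P₀ :=
    (measurable_meanDeviation hu).comp_aemeasurable hm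
  have hi : Integrable (fun ω => meanDeviation u (ν₀ ω)) P₀ :=
    Integrable.of_bound hd.aestronglyMeasurable b (ae_of_all _ fun ω => by
      have := hν₀ ω
      exact abs_meanDeviation_le hu hu0 hb hub _)
  have h2 : ∫ ω, meanDeviation u (ν₀ ω) ^ 2 ∂P₀ ≤
      ∫ ω, ((b - 1) + (b - 2) * meanDeviation u (ν₀ ω)) ∂P₀ := by
    refine integral_mono_of_nonneg (ae_of_all _ fun ω => sq_nonneg _)
      ((integrable_const _).add (hi.const_mul _)) (ae_of_all _ fun ω => ?_)
    have := hν₀ ω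
    obtain ⟨h3, h4⟩ := integral_mem_Icc hu hu0 hub (ν₀ ω)
    simp only [meanDeviation_eq hu hu0]
    nlinarith
  rw [integral_add (integrable_const _) (hi.const_mul _), integral_const_mul (b - 2),
    integral_meanDeviation hm hν₀ hmean hu hu0 hub h1] at h2
  simp at h2
  linarith

variable {Ω : Type*} {mΩ : MeasurableSpace Ω} {P : Measure Ω} [IsProbabilityMeasure P]

/-- Concentration of the component weights of an average of i.i.d. random measures. -/
theorem measureReal_lt_meanDeviation_le {m K : ℕ} (hm : m ≠ 0)
    (hν₀ : ∀ ω, IsProbabilityMeasure (ν₀ ω))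
    (hmean : ∀ A, MeasurableSet A → ∫⁻ ω, ν₀ ω A ∂P₀ = π A) {ν : Fin m → Ω → Measure X}
    (hind : iIndepFun ν P) (hid : ∀ j, IdentDistrib (ν j) ν₀ P P₀)
    {p : Fin K → ℝ} (hp : ∀ i, 0 ≤ p i) (hsum : ∑ i, p i = 1) {u : Fin K → X → ℝ}
    (hu : ∀ i, Measurable (u i)) (hu0 : ∀ i x, 0 ≤ u i x) (hb : 1 ≤ b) (hub : ∀ i x, u i x ≤ b)
    (h1 : ∀ i, ∫ x, u i x ∂π = 1) {ε : ℝ} (hε : 0 < ε) (hε1 : ε < 1) :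
    P.real {ω | ¬ ((∀ j, IsProbabilityMeasure (ν j ω)) ∧
      ∑ i, p i * ((m : ℝ)⁻¹ * ∑ j, meanDeviation (u i) (ν j ω)) ^ 2 ≤ ε / 2)} ≤
      2 * Real.exp (-(m * ε / (8 * b))) := by
  -- Equality in law with ν₀ makes the copies probability measures only almost surely, which is why
  -- the bad event also records this failure.
  have hprob : ∀ j, ∀ᵐ ω ∂P, IsProbabilityMeasure (ν j ω) := fun j =>
    (hid j).symm.ae_snd measurableSet_isProbabilityMeasure (ae_of_all _ hν₀)
  have hm₀ : AEMeasurable ν₀ P₀ := (hid ⟨0, Nat.pos_of_ne_zero hm⟩).aemeasurable_snd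
  have hid' : ∀ j i, IdentDistrib (fun ω => meanDeviation (u i) (ν j ω))
      (fun ω => meanDeviation (u i) (ν₀ ω)) P P₀ := fun j i =>
    (hid j).comp (measurable_meanDeviation (hu i))
  have hmain := measureReal_lt_weighted_deviation_le (P := P) hm hp hsum
    (X := fun j i ω => meanDeviation (u i) (ν j ω))
    (fun i => hind.comp (fun _ => meanDeviation (u i)) fun _ => measurable_meanDeviation (hu i))
    (fun j i => (hid' j i).aemeasurable_fst) hb
    (fun j i => by
      filter_upwards [hprob j] with ω hω
      exact abs_meanDeviation_le (hu i) (hu0 i) hb (hub i) _)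
    (fun j i => by
      rw [(hid' j i).integral_eq]
      exact integral_meanDeviation hm₀ hν₀ hmean (hu i) (hu0 i) (hub i) (h1 i))
    (fun j i => by
      refine (((hid' j i).comp (measurable_id.pow_const 2)).integral_eq).trans_le ?_
      exact integral_meanDeviation_sq_le hm₀ hν₀ hmean (hu i) (hu0 i) hb (hub i) (h1 i))
    hε hε1
  refine le_trans (le_of_eq ?_) hmain
  refine measureReal_congr ?_
  filter_upwards [ae_all_iff.2 hprob] with ω hω
  refine propext ?_
  change ¬ (_ ∧ _) ↔ _ < _
  simp [hω]

end RandomMeasure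

/-! ### The main theorem: choice of constants and union bound. -/

theorem mainTheorem8 :
    -- universal constants implicit in `m = Ω(·)`, `T = Ω(·)` and `1 - O(δ)`
    ∃ a b c : ℝ, 0 < a ∧ 0 < b ∧ 0 < c ∧
    ∀ (N K m : ℕ) (ε δ pmin C M : ℝ),
      ε ∈ Set.Ioo (0 : ℝ) 1 → δ ∈ Set.Ioo (0 : ℝ) 1 → 0 < pmin → 0 < C → 0 < M →
    -- the mixture `π = ∑ pᵢ πᵢ`
    ∀ (p : Fin K → ℝ) (πc : Fin K → Measure (EuclideanSpace ℝ (Fin N)))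
      (π : Measure (EuclideanSpace ℝ (Fin N))),
      (∀ i, IsProbabilityMeasure (πc i)) → (∀ i, pmin ≤ p i) → ∑ i, p i = 1 →
      π = ∑ i, ENNReal.ofReal (p i) • πc i →
      (∀ i, PoincareInequality (πc i) C) →
    -- `π` has density proportional to `exp (-V)`; `κ` is its Langevin diffusion
    ∀ (V : EuclideanSpace ℝ (Fin N) → ℝ)
      (κ : ℝ≥0 → Kernel (EuclideanSpace ℝ (Fin N)) (EuclideanSpace ℝ (Fin N))),
      ContDiff ℝ 1 V → π = (volume : Measure (EuclideanSpace ℝ (Fin N))).tilted (fun x => -V x) →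
      IsLangevinDiffusion V π κ →
    -- the random distribution `ν₀` with mean `π`
    ∀ {Ω₀ : Type*} [MeasurableSpace Ω₀] (P₀ : Measure Ω₀) [IsProbabilityMeasure P₀]
      (ν₀ : Ω₀ → Measure (EuclideanSpace ℝ (Fin N))),
      (∀ ω, IsProbabilityMeasure (ν₀ ω)) →
      (∀ A, MeasurableSet A → ∫⁻ ω, ν₀ ω A ∂P₀ = π A) →
    -- `ν₁, …, ν_m` are i.i.d. copies of `ν₀`
    ∀ {Ω : Type*} [MeasurableSpace Ω] (P : Measure Ω) [IsProbabilityMeasure P]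
      (ν : Fin m → Ω → Measure (EuclideanSpace ℝ (Fin N))),
      iIndepFun ν P → (∀ j, IdentDistrib (ν j) ν₀ P P₀) →
      a * (Real.log (1 / δ) / (pmin * ε ^ 2)) ≤ m →
      1 - δ ≤ P.real {ω | ∀ j, chiSqDiv (ν j ω) π ≤ ENNReal.ofReal M} →
    ∀ T : ℝ≥0, b * (1 / C * Real.log (M / ε)) ≤ T →
      1 - c * δ ≤ P.real
        {ω | chiSqDiv (κ T ∘ₘ uniformMixture (fun j => ν j ω)) π ≤ ENNReal.ofReal ε} := by
  -- The 8 cancels the one in the tail exponent, 1 is what e^{−CT}M ≤ ε requires, and 3 adds the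
  -- hypothesis failure δ to the concentration failure 2δ.
  refine ⟨8, 1, 3, by norm_num, by norm_num, by norm_num, ?_⟩
  intro N K m ε δ pmin C M hε hδ hpmin hC hM p πc π hπc hp hsum hmix hPoin V κ hV hπ hκ Ω₀ _ P₀ _
    ν₀ hν₀ hmean Ω _ P _ ν hind hid hm hgood T hT
  have hp0 : ∀ i, 0 < p i := fun i => hpmin.trans_le (hp i)
  have hprob : IsProbabilityMeasure π := by
    constructor
    rw [hmix, Measure.finsetSum_apply]
    simp only [Measure.smul_apply, measure_univ, smul_eq_mul, mul_one]
    rw [← ENNReal.ofReal_sum_of_nonneg fun i _ => (hp0 i).le, hsum, ENNReal.ofReal_one]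
  have hpmin1 : pmin ≤ 1 := by
    obtain ⟨i, -⟩ : (Finset.univ : Finset (Fin K)).Nonempty := by
      by_contra h
      rw [Finset.not_nonempty_iff_eq_empty] at h
      rw [h, Finset.sum_empty] at hsum
      exact zero_ne_one hsum
    exact (hp i).trans (hsum ▸ Finset.single_le_sum (fun j _ => (hp0 j).le) (Finset.mem_univ i))
  have hlog : 0 < Real.log (1 / δ) := Real.log_pos (by
    rw [lt_div_iff₀ hδ.1, one_mul]
    exact hδ.2)
  have hden : 0 < pmin * ε ^ 2 := mul_pos hpmin (pow_pos hε.1 2)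
  have hm0 : (0 : ℝ) < m := lt_of_lt_of_le (by positivity) hm
  have hmne : m ≠ 0 := by exact_mod_cast hm0.ne'
  have hle : ∀ i, ENNReal.ofReal (p i) • πc i ≤ π := fun i => by
    intro s
    rw [hmix, Measure.finsetSum_apply]
    exact Finset.single_le_sum (f := fun i => (ENNReal.ofReal (p i) • πc i) s)
      (fun j _ => zero_le) (Finset.mem_univ i)
  choose g hgm hg0 hgp hg using fun i => exists_bounded_density (hp0 i) (hle i)
  have hgb : ∀ i x, g i x ≤ 1 / pmin := fun i x =>
    (hgp i x).trans (one_div_le_one_div_of_le hpmin (hp i))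
  have hgabs : ∀ i x, |g i x| ≤ 1 / pmin := fun i x => by
    rw [abs_of_nonneg (hg0 i x)]
    exact hgb i x
  have hb1 : 1 ≤ 1 / pmin := by rwa [le_div_iff₀ hpmin, one_mul]
  have hM1 := hκ.markov T
  -- Evolving the component density instead of the initial law keeps its range in [0, 1/p_*] and, by
  -- stationarity, its π-mean 1.
  set u : Fin K → EuclideanSpace ℝ (Fin N) → ℝ := fun i x => ∫ y, g i y ∂κ T x with hu
  have hum : ∀ i, Measurable (u i) := fun i =>
    (hgm i).stronglyMeasurable.integral_kernel.measurable
  have hu0 : ∀ i x, 0 ≤ u i x := fun i x => integral_nonneg (hg0 i)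
  have hub : ∀ i x, u i x ≤ 1 / pmin := fun i x =>
    (le_abs_self _).trans (abs_integral_kernel_le (hgabs i) x)
  have hu1 : ∀ i, ∫ x, u i x ∂π = 1 := fun i => by
    rw [hu, (hκ.stationary T).integral_integral
      (integrable_of_measurable_of_abs_le (hgm i) (hgabs i))]
    have := hg i fun _ => 1
    simpa using this
  have hconc := measureReal_lt_meanDeviation_le (P := P) hmne hν₀ hmean hind hid
    (fun i => (hp0 i).le) hsum hum hu0 hb1 hub hu1 hε.1 hε.2
  have hexp : Real.exp (-(m * ε / (8 * (1 / pmin)))) ≤ δ := by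
    rw [← Real.le_log_iff_exp_le hδ.1, neg_le, ← Real.log_inv, ← one_div]
    have h1 : 8 * Real.log (1 / δ) ≤ m * (pmin * ε ^ 2) := by
      rwa [← mul_div_assoc, div_le_iff₀ hden] at hm
    have h2 : m * ε / (8 * (1 / pmin)) = m * (pmin * ε) / 8 := by
      field_simp
    -- The tail bound needs m of order 1/ε only, so the assumption with ε² is more than enough.
    have h3 : ε ^ 2 ≤ ε := by
      rw [sq]
      exact mul_le_of_le_one_left hε.1.le hε.2.le
    have h4 : m * (pmin * ε ^ 2) ≤ m * (pmin * ε) := by gcongr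
    rw [h2]
    linarith
  have hdecay : Real.exp (-(C * T)) * M ≤ ε := by
    have h1 : Real.log (M / ε) ≤ C * T := by
      rw [one_mul, one_div, inv_mul_le_iff₀ hC] at hT
      exact hT
    rw [Real.log_le_iff_le_exp (div_pos hM hε.1), div_le_iff₀ hε.1] at h1
    rw [Real.exp_neg, inv_mul_le_iff₀ (Real.exp_pos _)]
    exact h1
  -- Covering the good event by the conclusion and the concentration failure needs only monotonicity
  -- and subadditivity of the measure, so measurability of the χ² events is never required.
  have hsub : {ω | ∀ j, chiSqDiv (ν j ω) π ≤ ENNReal.ofReal M} ⊆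
      {ω | chiSqDiv (κ T ∘ₘ uniformMixture (fun j => ν j ω)) π ≤ ENNReal.ofReal ε} ∪
      {ω | ¬ ((∀ j, IsProbabilityMeasure (ν j ω)) ∧
        ∑ i, p i * ((m : ℝ)⁻¹ * ∑ j, meanDeviation (u i) (ν j ω)) ^ 2 ≤ ε / 2)} := by
    intro ω hω
    by_cases h : (∀ j, IsProbabilityMeasure (ν j ω)) ∧
        ∑ i, p i * ((m : ℝ)⁻¹ * ∑ j, meanDeviation (u i) (ν j ω)) ^ 2 ≤ ε / 2
    · left
      obtain ⟨hpr, hw⟩ := h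
      have := isProbabilityMeasure_uniformMixture hmne hpr
      have hchi := hκ.chiSqDiv_comp_le hV hπ hπc (fun i => (hp0 i).le) hmix hC.le hPoin hgm hgabs hg
        hM.le (chiSqDiv_uniformMixture_le hmne hpr hM.le hω) T
      refine hchi.trans (ENNReal.ofReal_le_ofReal (max_le ?_ hdecay))
      have hmd : ∀ i, ∫ x, ∫ y, g i y ∂κ T x ∂uniformMixture (fun j => ν j ω) - 1 =
          (m : ℝ)⁻¹ * ∑ j, meanDeviation (u i) (ν j ω) := fun i => by
        rw [integral_uniformMixture fun j => integrable_of_measurable_of_abs_le (hum i)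
          fun x => abs_integral_kernel_le (hgabs i) x]
        simp only [meanDeviation_eq (hum i) (hu0 i), Finset.sum_sub_distrib, Finset.sum_const,
          Finset.card_univ, Fintype.card_fin, nsmul_eq_mul, mul_one, mul_sub]
        rw [inv_mul_cancel₀ hm0.ne']
      simp only [hmd]
      linarith
    · exact Or.inr h
  have hfinal := (measureReal_mono hsub (μ := P)).trans (measureReal_union_le _ _)
  linarith
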